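/- Let $(\xi_k)_{k\in\mathbb Z}$ be a strictly stationary sequence of real-valued random variables with $\mathbb E\xi_0=0$ and $\mathbb E\xi_0^2<\infty$. Put $\mathcal G_k=\sigma(\xi_j,\ j\le k)$ and $\mathcal G_{-\infty}=\bigcap_{k\in\mathbb Z}\mathcal G_k$, and assume the two regularity conditions $$\mathbb E(\xi_0\mid\mathcal G_{-\infty})=0\ \text{ a.s.},\qquad \mathbb E(\xi_0\xi_k\mid\mathcal G_{-\infty})=\mathbb E(\xi_0\xi_k)\ \text{ a.s. for every } k\in\mathbb Z .$$ Let the rows $(X_{ij})_{j\in\mathbb Z}$, $i=1,2,\dots$, be mutually independent copies of $(\xi_k)_{k\in\mathbb Z}$, defined on one probability space. For $i\ge 1$ let $\mathcal G_{ik}=\sigma(X_{ij},\ 1\le j\le k)$, which is the trivial $\sigma$-field for $k\le 0$. Then the following hold. (a) $\mathbb E X_{ij}=0$ for all $i,j\ge1$; $\sup_{i,j\ge 1}\|X_{ij}\|_2<\infty$; and for every $\varepsilon>0$, as $n\to\infty$, $$\frac1{n^2}\sum_{i=1}^n\sum_{j=1}^i\mathbb E\big(X_{ij}^2\,I(|X_{ij}|>\varepsilon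 n^{1/2})\big)\to 0 .$$ (b) As $m\to\infty$, $$\eta_m=\sup_{i\ge j\ge m}\big\|\mathbb E(X_{ij}\mid\mathcal G_{i,j-m})\big\|_2\to0$$ and $$\gamma_m=\sup_{i\ge \ell\ge k\ge m}\big\|\mathbb E(X_{ik}X_{i\ell}\mid\mathcal G_{i,k-m})-\mathbb E(X_{ik}X_{i\ell})\big\|_1\to0 ,$$ where all indices $i,j,k,\ell$ are at least $1$. (c) Let $(Y_{ij})_{i,j\ge1}$ be any centered real-valued Gaussian random field, possibly on another probability space, with $\mathrm{Cov}(Y_{ij},Y_{kl})=\mathrm{Cov}(X_{ij},X_{kl})$ for all $i,j,k,l\ge1$. Let $\mathbb X_n=n^{-1/2}\mathbf X_n$, where $\mathbf X_n$ is the symmetric $n\times n$ matrix with entries $(\mathbf X_n)_{ij}=X_{ij}$ for $i\ge j$ and $(\mathbf X_n)_{ij}=X_{ji}$ for $i<j$, and define $\mathbb Y_n$ from $(Y_{ij})$ in the same way. For a symmetric matrix $A$ of order $n$ let $S^A(z)=\frac1n\mathrm{Tr}(A-z\mathbf I_n)^{-1}$ be the Stieltjes transform of its spectral distribution. Then for every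 $z\in\mathbb C$ with $\mathrm{Im}\,z>0$, $$S^{\mathbb X_n}(z)-\mathbb E\,S^{\mathbb Y_n}(z)\to0\quad\text{almost surely, as } n\to\infty .$$ -/

import Mathlib

open MeasureTheory ProbabilityTheory Filter Topology

noncomputable section

namespace RowIndep

/-- The symmetric `n × n` matrix whose `(i, j)` entry is `x i j` for `i ≥ j` and `x j i` for
`i < j`, where `1 ≤ i, j ≤ n` (the element `a` of `Fin n` stands for the index `a + 1`). -/
def symmMatrix (x : ℕ+ → ℕ+ → ℝ) (n : ℕ) : Matrix (Fin n) (Fin n) ℝ :=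
  Matrix.of fun i j =>
    if j ≤ i then x (Nat.succPNat i) (Nat.succPNat j) else x (Nat.succPNat j) (Nat.succPNat i)

/-- The normalized matrix `n^{-1/2} symmMatrix x n`. -/
def scaledMatrix (x : ℕ+ → ℕ+ → ℝ) (n : ℕ) : Matrix (Fin n) (Fin n) ℝ :=
  (Real.sqrt n)⁻¹ • symmMatrix x n

/-- Stieltjes transform of the spectral distribution of a real matrix `A` of order `n`:
`S^A(z) = (1 / n) Tr (A - z I)⁻¹`. -/
def stieltjes {n : ℕ} (A : Matrix (Fin n) (Fin n) ℝ) (z : ℂ) : ℂ :=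
  (1 / (n : ℂ)) *
    Matrix.trace ((A.map (fun t : ℝ => (t : ℂ)) - z • (1 : Matrix (Fin n) (Fin n) ℂ))⁻¹)

section Sequence

variable {Ω : Type*} [MeasurableSpace Ω]

/-- Strict stationarity: all the shifts of the sequence have the same law, as random elements of
the product space of real sequences indexed by the integers. -/
def IsStationarySeq (ξ : ℤ → Ω → ℝ) (P : Measure Ω) : Prop :=
  ∀ h : ℤ, IdentDistrib (fun ω (k : ℤ) => ξ (k + h) ω) (fun ω (k : ℤ) => ξ k ω) P P

/-- `𝒢_k = σ(ξ_j, j ≤ k)`. -/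
abbrev pastSigma {Ω : Type*} (ξ : ℤ → Ω → ℝ) (k : ℤ) : MeasurableSpace Ω :=
  ⨆ (j : ℤ) (_ : j ≤ k), MeasurableSpace.comap (ξ j) inferInstance

/-- The left tail sigma-field `𝒢_{-∞} = ⋂_k 𝒢_k`. -/
abbrev leftTail {Ω : Type*} (ξ : ℤ → Ω → ℝ) : MeasurableSpace Ω :=
  ⨅ k : ℤ, pastSigma ξ k

/-- First regularity condition: `E(ξ_0 | 𝒢_{-∞}) = 0` a.s. -/
def Regular1 (ξ : ℤ → Ω → ℝ) (P : Measure Ω) : Prop :=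
  P[ξ 0 | leftTail ξ] =ᵐ[P] 0

/-- Second regularity condition: `E(ξ_0 ξ_k | 𝒢_{-∞}) = E(ξ_0 ξ_k)` a.s., for every integer `k`. -/
def Regular2 (ξ : ℤ → Ω → ℝ) (P : Measure Ω) : Prop :=
  ∀ k : ℤ, P[fun ω => ξ 0 ω * ξ k ω | leftTail ξ] =ᵐ[P] fun _ => ∫ ω, ξ 0 ω * ξ k ω ∂P

end Sequence

section Field

variable {Ω : Type*} [MeasurableSpace Ω]

/-- `L_n(A) = n^{-2} ∑_{i=1}^n ∑_{j=1}^i E(X_{ij}² I(|X_{ij}| > A))`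
(`a`, `b` stand for `i - 1`, `j - 1`). -/
def lindebergSum (X : ℕ+ → ℕ+ → Ω → ℝ) (P : Measure Ω) (n : ℕ) (A : ℝ) : ℝ :=
  (1 / (n : ℝ) ^ 2) * ∑ a ∈ Finset.range n, ∑ b ∈ Finset.range (a + 1),
    ∫ ω in {ω | A < |X (Nat.succPNat a) (Nat.succPNat b) ω|},
      X (Nat.succPNat a) (Nat.succPNat b) ω ^ 2 ∂P

/-- Centering, uniform boundedness in `L²` and the Lindeberg type condition. -/
structure LindebergCondition (X : ℕ+ → ℕ+ → Ω → ℝ) (P : Measure Ω) : Prop where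
  centered : ∀ i j, Integrable (X i j) P ∧ ∫ ω, X i j ω ∂P = 0
  bounded : ∃ σ : ℝ, 0 < σ ∧ ∀ i j, eLpNorm (X i j) 2 P ≤ ENNReal.ofReal σ
  lindeberg : ∀ ε : ℝ, 0 < ε →
    Tendsto (fun n : ℕ => lindebergSum X P n (ε * Real.sqrt n)) atTop (𝓝 0)

/-- `𝒢_{ik} = σ(X_{ij}, 1 ≤ j ≤ k)`, the trivial sigma-field if `k ≤ 0`. -/
abbrev rowSigma {Ω : Type*} (X : ℕ+ → ℕ+ → Ω → ℝ) (i : ℕ+) (k : ℤ) : MeasurableSpace Ω :=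
  ⨆ (j : ℕ+) (_ : (j : ℤ) ≤ k), MeasurableSpace.comap (X i j) inferInstance

/-- `η_m = sup_{i ≥ j ≥ m} ‖E(X_{ij} | 𝒢_{i,j-m})‖_2`. -/
def eta (X : ℕ+ → ℕ+ → Ω → ℝ) (P : Measure Ω) (m : ℕ) : ENNReal :=
  ⨆ (i : ℕ+) (j : ℕ+) (_ : j ≤ i ∧ m ≤ (j : ℕ)),
    eLpNorm (P[X i j | rowSigma X i ((j : ℤ) - m)]) 2 P

/-- `γ_m = sup_{i ≥ ℓ ≥ k ≥ m} ‖E(X_{ik} X_{iℓ} | 𝒢_{i,k-m}) - E(X_{ik} X_{iℓ})‖_1`. -/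
def gam (X : ℕ+ → ℕ+ → Ω → ℝ) (P : Measure Ω) (m : ℕ) : ENNReal :=
  ⨆ (i : ℕ+) (l : ℕ+) (k : ℕ+) (_ : l ≤ i ∧ k ≤ l ∧ m ≤ (k : ℕ)),
    eLpNorm (fun ω => (P[fun ω' => X i k ω' * X i l ω' | rowSigma X i ((k : ℤ) - m)]) ω
      - ∫ ω', X i k ω' * X i l ω' ∂P) 1 P

/-- `Y` is a centered Gaussian random field on `{1, 2, …}²` with the covariances of `X`. -/
structure IsGaussianCopy {Ω' : Type*} [MeasurableSpace Ω'] (Y : ℕ+ → ℕ+ → Ω' → ℝ)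
    (Q : Measure Ω') (X : ℕ+ → ℕ+ → Ω → ℝ) (P : Measure Ω) : Prop where
  gaussian : IsGaussianProcess (fun u : ℕ+ × ℕ+ => Y u.1 u.2) Q
  centered : ∀ i j, ∫ ω, Y i j ω ∂Q = 0
  covariance_eq : ∀ i j k l, cov[Y i j, Y k l; Q] = cov[X i j, X k l; P]

end Field

end RowIndep

end

/-! The conditions (a) and (b) come from stationarity and reverse martingale convergence. All
entries have the law of `ξ 0`, so the Lindeberg average is at most a single truncated second moment.
Enlarging the conditioning field from the finite past of a row to its whole past can only increase
the norms in `eta` and `gam`; a shift then turns them into norms attached to `ξ 0` and `pastSigma ξ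
(-m)`. As m grows these conditional expectations converge to those given `leftTail ξ`, which the
regularity conditions prescribe. For products the convergence must be uniform in the lag d: when d
is large, E(ξ_0 ξ_d | 𝒢_0) = ξ_0 E(ξ_d | 𝒢_0) is already small in L¹ by Cauchy–Schwarz, and only
finitely many lags remain.

For (c), the trace of the resolvent is a function of n independent rows, and changing one row moves
it by at most 2 / Im z. The bounded differences inequality and Borel–Cantelli therefore remove the
randomness (`ae_tendsto_rowTrace_sub`). The expectations are compared by Lindeberg's method, one row
at a time (`norm_integral_pi_sub_le`); the Gaussian rows are independent because they are
uncorrelated. By the Schur complement formula a row enters the trace only through its diagonal entry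
and through linear and quadratic forms whose coefficients come from the resolvent of the other rows,
an operator of norm at most 1 / Im z. If linear forms are small and quadratic forms are close to
their means, the expected trace depends, up to o(1), only on the covariances of the row
(`norm_integral_rowTrace_sub_le`). The n replacements cost o(n), which the factor 1/n absorbs.

The probabilistic core is the bound E|∑ B_jk (ξ_j ξ_k - E ξ_j ξ_k)| ≤ ε n + C, uniform over matrices
B of norm at most 1 (`exists_integral_abs_quad_le`). Fejér weights split B into a band matrix and a
remainder with small entries near the diagonal. The band is a bounded number of diagonals, each
obeying a weighted weak law by the second regularity condition. In the remainder ξ is replaced by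
bounded variables recentred m steps back, for which orthogonality gives a second moment of order n
away from the diagonal. In the Gaussian case Wick's formula bounds the variance by 2 ∑ c_jk², which
is o(n²) because the covariances vanish at infinity. -/

namespace RowIndep

/-! ### Reverse martingale convergence in L² and L¹. -/

section BackwardConvergence

/-- Orthogonal projections onto a decreasing sequence of complete subspaces converge to the
projection onto the intersection. -/
theorem starProjection_tendsto_iInf {E : Type*} [NormedAddCommGroup E] [InnerProductSpace ℝ E]
    [CompleteSpace E] (U : ℕ → Submodule ℝ E) [∀ i, CompleteSpace (U i)]
    [(⨅ i, U i).HasOrthogonalProjection] (hU : Antitone U) (x : E) :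
    Tendsto (fun i => (U i).starProjection x) atTop (𝓝 ((⨅ i, U i).starProjection x)) := by
  -- The orthogonal complements increase, so convergence for increasing subspaces applies to them;
  -- subtracting from `x` gives the limit for `U i`.
  set W := (⨆ i, (U i)ᗮ).topologicalClosure
  have : CompleteSpace W := (Submodule.isClosed_topologicalClosure _).completeSpace_coe
  have h := Submodule.starProjection_tendsto_closure_iSup (fun i => (U i)ᗮ)
    (fun i j hij => Submodule.orthogonal_le (hU hij)) x
  have h1 : Tendsto (fun i => (U i).starProjection x) atTop (𝓝 (x - W.starProjection x)) := by
    refine (tendsto_const_nhds.sub h).congr fun i => ?_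
    rw [Submodule.starProjection_orthogonal_val]; abel
  have hmem : x - W.starProjection x ∈ ⨅ i, U i := by
    rw [Submodule.mem_iInf]
    intro i
    have hc : IsClosed (U i : Set E) := (completeSpace_coe_iff_isComplete.1 inferInstance).isClosed
    refine hc.mem_of_tendsto h1 ?_
    filter_upwards [eventually_ge_atTop i] with j hj
    exact hU hj (Submodule.starProjection_apply_mem _ _)
  have hW : W ≤ (⨅ i, U i)ᗮ :=
    Submodule.topologicalClosure_minimal _
      (iSup_le fun i => Submodule.orthogonal_le (iInf_le _ i)) (Submodule.isClosed_orthogonal _)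
  have : (⨅ i, U i).starProjection x = x - W.starProjection x := by
    refine (Submodule.eq_starProjection_of_mem_orthogonal hmem ?_)
    have := hW (Submodule.starProjection_apply_mem W x)
    simpa using this
  rw [this]
  exact h1

variable {Ω : Type*} {m0 : MeasurableSpace Ω} {P : Measure Ω}

/-- A function which is a.e. equal to a `G k`-measurable function for every `k`, with `G`
decreasing, is a.e. equal to a `⨅ k, G k`-measurable function. -/
theorem aestronglyMeasurable_iInf {G : ℕ → MeasurableSpace Ω} (hG : Antitone G) {f : Ω → ℝ}
    (hf : ∀ k, AEStronglyMeasurable[G k] f P) : AEStronglyMeasurable[⨅ k, G k] f P := by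
  refine ⟨fun ω => limsup (fun k => (hf k).mk f ω) atTop, ?_, ?_⟩
  · suffices h : Measurable[⨅ k, G k] fun ω => limsup (fun k => (hf k).mk f ω) atTop from
      h.stronglyMeasurable
    rw [measurable_iff_comap_le]
    refine le_iInf fun K => ?_
    rw [← measurable_iff_comap_le]
    -- The limsup ignores the first `K` versions, and all later ones are `G K`-measurable.
    have : (fun ω => limsup (fun k => (hf k).mk f ω) atTop)
        = fun ω => limsup (fun k => (hf (k + K)).mk f ω) atTop := by
      ext ω
      exact (limsup_nat_add (fun k => (hf k).mk f ω) K).symm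
    rw [this]
    have hm : ∀ k, Measurable[G K] ((hf (k + K)).mk f) := fun k =>
      ((hf (k + K)).stronglyMeasurable_mk.measurable).mono (hG (by omega)) le_rfl
    let := G K
    exact Measurable.limsup hm
  · have : ∀ᵐ ω ∂P, ∀ k, f ω = (hf k).mk f ω := ae_all_iff.2 fun k => (hf k).ae_eq_mk
    filter_upwards [this] with ω hω
    simp [← hω]

/-- Functions in `L^p` are approximated by bounded measurable functions of themselves. -/
theorem exists_bounded_comp_approx {f : Ω → ℝ} {p : ENNReal} (hfm : Measurable f)
    (hf : MemLp f p P) {ε : ℝ} (hε : 0 < ε) :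
    ∃ (φ : ℝ → ℝ) (M : ℝ), Measurable φ ∧ 0 < M ∧ (∀ x, |φ x| ≤ M) ∧
      eLpNorm (fun ω => f ω - φ (f ω)) p P ≤ ENNReal.ofReal ε := by
  obtain ⟨M, hM, hM'⟩ := hf.eLpNorm_indicator_norm_ge_pos_le hfm.stronglyMeasurable hε
  -- The truncation is a function of `f` itself, so one φ serves all variables with the same law and
  -- preserves measurability with respect to the past.
  refine ⟨fun x => if M ≤ |x| then 0 else x, M,
    Measurable.ite (measurableSet_le measurable_const measurable_abs) measurable_const
      measurable_id, hM, fun x => ?_, ?_⟩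
  · dsimp only
    split_ifs with h
    · simpa using hM.le
    · exact (not_le.1 h).le
  · refine le_trans (le_of_eq ?_) hM'
    congr 1
    ext ω
    by_cases h : M ≤ |f ω|
    · rw [Set.indicator_of_mem (by simpa using h)]; simp [h]
    · rw [Set.indicator_of_notMem (by simpa using h)]; simp [h]

variable [IsProbabilityMeasure P]

/-- On L² conditional expectation is the orthogonal projection onto `lpMeas`. These subspaces
decrease, and their intersection is the one attached to `⨅ k, G k`. -/
theorem tendsto_eLpNorm_condExp_iInf_two {G : ℕ → MeasurableSpace Ω} (hG : Antitone G)
    (hle : ∀ k, G k ≤ m0) {f : Ω → ℝ} (hf : MemLp f 2 P) :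
    Tendsto (fun k => eLpNorm (P[f | G k] - P[f | ⨅ k, G k]) 2 P) atTop (𝓝 0) := by
  have hinf : ⨅ k, G k ≤ m0 := (iInf_le _ 0).trans (hle 0)
  let U : ℕ → Submodule ℝ (Lp ℝ 2 P) := fun k => lpMeas ℝ ℝ (G k) 2 P
  have hfact : ∀ k, Fact (G k ≤ m0) := fun k => ⟨hle k⟩
  have hfact' : Fact (⨅ k, G k ≤ m0) := ⟨hinf⟩
  have hUinf : ⨅ k, U k = lpMeas ℝ ℝ (⨅ k, G k) 2 P := by
    ext g
    rw [Submodule.mem_iInf, mem_lpMeas_iff_aestronglyMeasurable]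
    exact ⟨fun h => aestronglyMeasurable_iInf hG fun k =>
      mem_lpMeas_iff_aestronglyMeasurable.1 (h k), fun h k =>
      mem_lpMeas_iff_aestronglyMeasurable.2 (h.mono (iInf_le _ k))⟩
  have hcomp : ∀ k, CompleteSpace (U k) := fun k => by
    change CompleteSpace (lpMeas ℝ ℝ (G k) 2 P); infer_instance
  have hproj : (⨅ k, U k).HasOrthogonalProjection := by rw [hUinf]; infer_instance
  have h := starProjection_tendsto_iInf U (fun i j hij g hg =>
    mem_lpMeas_iff_aestronglyMeasurable.2
      ((mem_lpMeas_iff_aestronglyMeasurable.1 hg).mono (hG hij))) hf.toLp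
  have e1 : ∀ k, (U k).starProjection hf.toLp =ᵐ[P] P[f | G k] := fun k =>
    hf.condExpL2_ae_eq_condExp (𝕜 := ℝ) (hle k)
  have e2 : (⨅ k, U k).starProjection hf.toLp =ᵐ[P] P[f | ⨅ k, G k] := by
    have := hf.condExpL2_ae_eq_condExp (𝕜 := ℝ) hinf
    refine EventuallyEq.trans (Eq.eventuallyEq ?_) this
    congr 1
    simp only [hUinf]
    rfl
  rw [Lp.tendsto_Lp_iff_tendsto_eLpNorm'] at h
  refine h.congr fun k => eLpNorm_congr_ae ?_
  exact (e1 k).sub e2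

/-- The L² result applies to a bounded truncation of `f`. Conditional expectation contracts L¹, so
the truncation error enters twice, once for each σ-field. -/
theorem tendsto_eLpNorm_condExp_iInf_one {G : ℕ → MeasurableSpace Ω} (hG : Antitone G)
    (hle : ∀ k, G k ≤ m0) {f : Ω → ℝ} (hfm : Measurable f) (hf : Integrable f P) :
    Tendsto (fun k => eLpNorm (P[f | G k] - P[f | ⨅ k, G k]) 1 P) atTop (𝓝 0) := by
  rw [ENNReal.tendsto_nhds_zero]
  intro ε hε
  obtain ⟨δ, hδ, hδε⟩ : ∃ δ : ℝ, 0 < δ ∧ ENNReal.ofReal (3 * δ) ≤ ε := by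
    by_cases htop : ε = ⊤
    · exact ⟨1, one_pos, by simp [htop]⟩
    · refine ⟨ε.toReal / 3, by have := ENNReal.toReal_pos hε.ne' htop; positivity, ?_⟩
      rw [mul_div_cancel₀ _ (by norm_num), ENNReal.ofReal_toReal htop]
  obtain ⟨φ, M, hφ, hM, hφM, hφε⟩ := exists_bounded_comp_approx hfm
    (memLp_one_iff_integrable.2 hf) hδ
  set g : Ω → ℝ := fun ω => φ (f ω)
  have hg : MemLp g 2 P := MemLp.of_bound
    (hφ.comp_aemeasurable hf.1.aemeasurable).aestronglyMeasurable M (ae_of_all _ fun ω => hφM _)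
  have hg1 : Integrable g P := hg.integrable one_le_two
  have h := tendsto_eLpNorm_condExp_iInf_two hG hle hg
  rw [ENNReal.tendsto_nhds_zero] at h
  filter_upwards [h (ENNReal.ofReal δ) (by simpa using hδ)] with k hk
  have hae : P[f | G k] - P[f | ⨅ k, G k] =ᵐ[P]
      (P[f - g | G k] + (P[g | G k] - P[g | ⨅ k, G k])) - P[f - g | ⨅ k, G k] := by
    filter_upwards [condExp_sub hf hg1 (G k), condExp_sub hf hg1 (⨅ k, G k)] with ω h1 h2
    simp only [Pi.sub_apply, Pi.add_apply, h1, h2]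
    ring
  rw [eLpNorm_congr_ae hae]
  have e0 : eLpNorm (f - g) 1 P ≤ ENNReal.ofReal δ := hφε
  have e1 : ∀ m, eLpNorm (P[f - g | m]) 1 P ≤ ENNReal.ofReal δ := fun m =>
    (eLpNorm_condExp_le_eLpNorm _ le_rfl).trans e0
  have e2 : eLpNorm (P[g | G k] - P[g | ⨅ k, G k]) 1 P ≤ ENNReal.ofReal δ :=
    (eLpNorm_le_eLpNorm_of_exponent_le one_le_two
      (integrable_condExp.sub integrable_condExp).1).trans hk
  refine (eLpNorm_sub_le (integrable_condExp.add (integrable_condExp.sub integrable_condExp)).1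
    integrable_condExp.1 le_rfl).trans (le_trans (add_le_add
      ((eLpNorm_add_le integrable_condExp.1 (integrable_condExp.sub integrable_condExp).1
        le_rfl).trans (add_le_add (e1 _) e2)) (e1 _)) ?_)
  rw [← ENNReal.ofReal_add hδ.le hδ.le, ← ENNReal.ofReal_add (by positivity) hδ.le]
  refine le_trans (le_of_eq ?_) hδε
  congr 1
  ring

end BackwardConvergence

/-! ### Norms of conditional expectations depend only on joint laws. -/

section LawInvariance

/-- The norm of a recentred conditional expectation depends only on the joint law. -/
theorem eLpNorm_condExp_sub_const_eq {Ω Ω' β : Type*} [MeasurableSpace Ω] [MeasurableSpace Ω']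
    [mβ : MeasurableSpace β] {P : Measure Ω} {P' : Measure Ω'} [IsProbabilityMeasure P]
    [IsProbabilityMeasure P'] {U : Ω → ℝ} {U' : Ω' → ℝ} {V : Ω → β} {V' : Ω' → β}
    (hV : Measurable V) (hV' : Measurable V') (hU : Integrable U P) (hU' : Integrable U' P')
    (h : P.map (fun ω => (V ω, U ω)) = P'.map (fun ω => (V' ω, U' ω))) (c : ℝ) (p : ENNReal) :
    eLpNorm (fun ω => P[U | mβ.comap V] ω - c) p P
      = eLpNorm (fun ω => P'[U' | mβ.comap V'] ω - c) p P' := by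
  -- The regular conditional distribution is built from the joint law alone. Hence both conditional
  -- expectations are the same function of `V` and of `V'`, and these have the same law.
  have hκ : condDistrib U V P = condDistrib U' V' P' := by
    simp only [condDistrib, h]
  have hmap : P.map V = P'.map V' := by
    have := congrArg Measure.fst h
    rwa [Measure.fst_map_prodMk₀ hU.1.aemeasurable, Measure.fst_map_prodMk₀ hU'.1.aemeasurable]
      at this
  have hm : StronglyMeasurable fun b => ∫ y, y ∂(condDistrib U V P b) - c :=
    (StronglyMeasurable.integral_kernel (κ := condDistrib U V P)
      stronglyMeasurable_id).sub stronglyMeasurable_const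
  have e1 : eLpNorm (fun ω => P[U | mβ.comap V] ω - c) p P
      = eLpNorm (fun b => ∫ y, y ∂(condDistrib U V P b) - c) p (P.map V) := by
    rw [eLpNorm_map_measure hm.aestronglyMeasurable hV.aemeasurable]
    refine eLpNorm_congr_ae ?_
    filter_upwards [condExp_ae_eq_integral_condDistrib' hV hU] with ω hω
    simp [hω]
  have e2 : eLpNorm (fun ω => P'[U' | mβ.comap V'] ω - c) p P'
      = eLpNorm (fun b => ∫ y, y ∂(condDistrib U V P b) - c) p (P'.map V') := by
    rw [eLpNorm_map_measure hm.aestronglyMeasurable hV'.aemeasurable]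
    refine eLpNorm_congr_ae ?_
    filter_upwards [condExp_ae_eq_integral_condDistrib' hV' hU'] with ω hω
    simp [hω, hκ]
  rw [e1, e2, hmap]

end LawInvariance
end RowIndep

namespace RowIndep

/-- A strictly stationary, centered, square integrable sequence satisfying the two regularity
conditions. -/
structure IsRegularSeq {Ω : Type*} [MeasurableSpace Ω] (ξ : ℤ → Ω → ℝ) (P : Measure Ω) : Prop where
  measurable : ∀ k, Measurable (ξ k)
  stationary : IsStationarySeq ξ P
  memLp : ∀ k, MemLp (ξ k) 2 P
  centered : ∀ k, ∫ ω, ξ k ω ∂P = 0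
  regular1 : Regular1 ξ P
  regular2 : Regular2 ξ P

/-! ### The past of a sequence and its transport under shifts. -/

section Past

variable {Ω : Type*}

theorem pastSigma_le [MeasurableSpace Ω] {ξ : ℤ → Ω → ℝ} (hξ : ∀ k, Measurable (ξ k)) (k : ℤ) :
    pastSigma ξ k ≤ ‹MeasurableSpace Ω› :=
  iSup₂_le fun j _ => (hξ j).comap_le

theorem pastSigma_mono (ξ : ℤ → Ω → ℝ) {k l : ℤ} (h : k ≤ l) : pastSigma ξ k ≤ pastSigma ξ l :=
  iSup₂_le fun j hj => le_iSup₂_of_le j (hj.trans h) le_rfl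

theorem measurable_pastSigma (ξ : ℤ → Ω → ℝ) {j k : ℤ} (h : j ≤ k) :
    Measurable[pastSigma ξ k] (ξ j) :=
  measurable_iff_comap_le.2 (le_iSup₂_of_le j h le_rfl)

theorem leftTail_eq_iInf_nat (ξ : ℤ → Ω → ℝ) : leftTail ξ = ⨅ m : ℕ, pastSigma ξ (-(m : ℤ)) := by
  refine le_antisymm (le_iInf fun m => iInf_le _ _) (le_iInf fun k => ?_)
  exact (iInf_le _ k.natAbs).trans (pastSigma_mono ξ (by omega))

/-- Presents the past as generated by a single random element of `ℕ → ℝ`, the form required by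
`eLpNorm_condExp_sub_const_eq`. -/
theorem pastSigma_eq_comap (ξ : ℤ → Ω → ℝ) (k : ℤ) :
    pastSigma ξ k
      = MeasurableSpace.comap (fun ω (i : ℕ) => ξ (k - i) ω) MeasurableSpace.pi := by
  rw [MeasurableSpace.pi, MeasurableSpace.comap_iSup]
  refine le_antisymm (iSup₂_le fun j hj => ?_) (iSup_le fun i => ?_)
  · refine le_iSup_of_le (k - j).toNat ?_
    rw [MeasurableSpace.comap_comp]
    refine le_of_eq (congrArg (fun f => MeasurableSpace.comap f _) ?_)
    ext ω
    simp only [Function.comp_apply]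
    congr 1
    omega
  · rw [MeasurableSpace.comap_comp]
    exact le_iSup₂_of_le (k - i) (by omega) le_rfl

variable [MeasurableSpace Ω] {Ω' : Type*} [MeasurableSpace Ω'] {P : Measure Ω} {P' : Measure Ω'}
  [IsProbabilityMeasure P] [IsProbabilityMeasure P']

/-- Conditioning a functional of a sequence with the law of a stationary sequence on its past. -/
theorem eLpNorm_condExp_past_eq {ξ : ℤ → Ω → ℝ} {X : ℤ → Ω' → ℝ} (hξ : ∀ k, Measurable (ξ k))
    (hstat : IsStationarySeq ξ P)
    (hX : ∀ k, Measurable (X k))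
    (hlaw : IdentDistrib (fun ω (j : ℤ) => X j ω) (fun ω (j : ℤ) => ξ j ω) P' P)
    {h : (ℤ → ℝ) → ℝ} (hh : Measurable h) (hint : Integrable (fun ω => h fun k => ξ k ω) P)
    (j : ℤ) (m : ℤ) (c : ℝ) (p : ENNReal) :
    eLpNorm (fun ω => P'[fun ω => h fun k => X (k + j) ω | pastSigma X (j - m)] ω - c) p P'
      = eLpNorm (fun ω => P[fun ω => h fun k => ξ k ω | pastSigma ξ (-m)] ω - c) p P := by
  -- Copying and then shifting: `X` moved by `j` has the law of `ξ`. The case `X = ξ` gives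
  -- invariance under time shifts.
  have hs : IdentDistrib (fun ω (k : ℤ) => X (k + j) ω) (fun ω (k : ℤ) => ξ k ω) P' P :=
    (hlaw.comp (u := fun (x : ℤ → ℝ) k => x (k + j)) (by fun_prop)).trans (hstat j)
  rw [pastSigma_eq_comap, pastSigma_eq_comap]
  refine eLpNorm_condExp_sub_const_eq (by fun_prop) (by fun_prop)
    ((hs.comp hh).integrable_iff.2 hint) hint ?_ c p
  refine Eq.trans ?_
    (hs.comp (u := fun (x : ℤ → ℝ) => (fun i : ℕ => x (-m - i), h x)) (by fun_prop)).map_eq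
  congr 1
  ext ω
  · simp only [Function.comp_apply]
    congr 1
    ring
  · rfl

end Past

/-! ### Consequences of the two regularity conditions. -/

namespace IsRegularSeq

section

variable {Ω : Type*} [MeasurableSpace Ω] {ξ : ℤ → Ω → ℝ} {P : Measure Ω}

theorem identDistrib_shift (hξ : IsRegularSeq ξ P) {h : (ℤ → ℝ) → ℝ} (hh : Measurable h) (j : ℤ) :
    IdentDistrib (fun ω => h fun k => ξ (k + j) ω) (fun ω => h fun k => ξ k ω) P P :=
  (hξ.stationary j).comp hh

theorem identDistrib_zero (hξ : IsRegularSeq ξ P) (j : ℤ) : IdentDistrib (ξ j) (ξ 0) P P := by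
  simpa using hξ.identDistrib_shift (h := fun x => x 0) (by fun_prop) j

theorem eLpNorm_eq (hξ : IsRegularSeq ξ P) (j : ℤ) (p : ENNReal) :
    eLpNorm (ξ j) p P = eLpNorm (ξ 0) p P := (hξ.identDistrib_zero j).eLpNorm_eq p

theorem identDistrib_mul (hξ : IsRegularSeq ξ P) (j d : ℤ) :
    IdentDistrib (fun ω => ξ j ω * ξ (j + d) ω) (fun ω => ξ 0 ω * ξ d ω) P P := by
  simpa [add_comm] using hξ.identDistrib_shift (h := fun x => x 0 * x d) (by fun_prop) j

theorem integrable_mul (hξ : IsRegularSeq ξ P) (j k : ℤ) :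
    Integrable (fun ω => ξ j ω * ξ k ω) P :=
  (hξ.memLp j).integrable_mul (hξ.memLp k)

end

variable {Ω : Type*} [MeasurableSpace Ω] {ξ : ℤ → Ω → ℝ} {P : Measure Ω} [IsProbabilityMeasure P]

theorem tendsto_condExp_two (hξ : IsRegularSeq ξ P) :
    Tendsto (fun m : ℕ => eLpNorm (P[ξ 0 | pastSigma ξ (-(m : ℤ))]) 2 P) atTop (𝓝 0) := by
  have h := tendsto_eLpNorm_condExp_iInf_two (P := P) (G := fun m : ℕ => pastSigma ξ (-(m : ℤ)))
    (fun a b hab => pastSigma_mono ξ (by omega)) (fun k => pastSigma_le hξ.measurable _)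
    (hξ.memLp 0)
  refine h.congr fun m => eLpNorm_congr_ae ?_
  have h1 := hξ.regular1
  rw [Regular1, leftTail_eq_iInf_nat] at h1
  filter_upwards [h1] with ω hω
  simp [hω]

theorem tendsto_condExp_one (hξ : IsRegularSeq ξ P) (d : ℤ) :
    Tendsto (fun m : ℕ => eLpNorm (fun ω =>
      P[fun ω => ξ 0 ω * ξ d ω | pastSigma ξ (-(m : ℤ))] ω - ∫ ω, ξ 0 ω * ξ d ω ∂P) 1 P)
      atTop (𝓝 0) := by
  have h := tendsto_eLpNorm_condExp_iInf_one (P := P) (G := fun m : ℕ => pastSigma ξ (-(m : ℤ)))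
    (fun a b hab => pastSigma_mono ξ (by omega)) (fun k => pastSigma_le hξ.measurable _)
    ((hξ.measurable 0).mul (hξ.measurable d)) (hξ.integrable_mul 0 d)
  refine h.congr fun m => eLpNorm_congr_ae ?_
  have h1 := hξ.regular2 d
  rw [leftTail_eq_iInf_nat] at h1
  filter_upwards [h1] with ω hω
  simp [Pi.mul_def, hω]

/-- The conditional expectation of `ξ_d` given the past at time `0`. -/
theorem eLpNorm_condExp_zero (hξ : IsRegularSeq ξ P) (d : ℤ) :
    eLpNorm (P[ξ d | pastSigma ξ 0]) 2 P = eLpNorm (P[ξ 0 | pastSigma ξ (-d)]) 2 P := by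
  have := eLpNorm_condExp_past_eq hξ.measurable hξ.stationary hξ.measurable
    (by simpa using hξ.stationary 0) (h := fun x => x 0) (by fun_prop)
    ((hξ.memLp 0).integrable one_le_two) d d 0 2
  simpa using this

/-- Conditionally on the past at time `0`, products at a large lag are small. -/
theorem eLpNorm_condExp_mul_le (hξ : IsRegularSeq ξ P) (d : ℤ) :
    eLpNorm (P[fun ω => ξ 0 ω * ξ d ω | pastSigma ξ 0]) 1 P
      ≤ eLpNorm (ξ 0) 2 P * eLpNorm (P[ξ 0 | pastSigma ξ (-d)]) 2 P := by
  have hle := pastSigma_le hξ.measurable 0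
  -- `ξ 0` belongs to the past at time 0 and leaves the conditional expectation; Hölder with
  -- exponents 2 and 2 finishes.
  have h := condExp_mul_of_aestronglyMeasurable_left (m := pastSigma ξ 0) (μ := P) (f := ξ 0)
    (g := ξ d) (measurable_pastSigma ξ le_rfl).aestronglyMeasurable (hξ.integrable_mul 0 d)
    ((hξ.memLp d).integrable one_le_two)
  rw [← hξ.eLpNorm_condExp_zero]
  have h' : eLpNorm (P[fun ω => ξ 0 ω * ξ d ω | pastSigma ξ 0]) 1 P
      = eLpNorm (ξ 0 • P[ξ d | pastSigma ξ 0]) 1 P := eLpNorm_congr_ae h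
  rw [h']
  exact eLpNorm_smul_le_mul_eLpNorm (p := 2) (q := 2) (r := 1)
    (integrable_condExp.1) (hξ.memLp 0).1

theorem enorm_covariance_le (hξ : IsRegularSeq ξ P) (d : ℤ) :
    ‖∫ ω, ξ 0 ω * ξ d ω ∂P‖ₑ
      ≤ eLpNorm (ξ 0) 2 P * eLpNorm (P[ξ 0 | pastSigma ξ (-d)]) 2 P := by
  rw [← integral_condExp (pastSigma_le hξ.measurable 0)]
  refine (enorm_integral_le_lintegral_enorm _).trans ?_
  rw [← eLpNorm_one_eq_lintegral_enorm]
  exact hξ.eLpNorm_condExp_mul_le d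

theorem tendsto_eLpNorm_mul_condExp (hξ : IsRegularSeq ξ P) :
    Tendsto (fun d : ℕ => eLpNorm (ξ 0) 2 P * eLpNorm (P[ξ 0 | pastSigma ξ (-(d : ℤ))]) 2 P)
      atTop (𝓝 0) := by
  simpa using ENNReal.Tendsto.const_mul (hξ.tendsto_condExp_two)
    (Or.inr (hξ.memLp 0).eLpNorm_lt_top.ne)

/-- The covariances of a regular sequence vanish at infinity. -/
theorem tendsto_covariance (hξ : IsRegularSeq ξ P) :
    Tendsto (fun d : ℕ => ∫ ω, ξ 0 ω * ξ (d : ℤ) ω ∂P) atTop (𝓝 0) := by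
  rw [tendsto_zero_iff_enorm_tendsto_zero]
  exact tendsto_of_tendsto_of_tendsto_of_le_of_le tendsto_const_nhds
    hξ.tendsto_eLpNorm_mul_condExp (fun _ => zero_le) fun d => hξ.enorm_covariance_le d

/-- By the tower property through the past at time 0, the bound does not depend on `m`; it serves
for large lags. -/
theorem eLpNorm_condExp_mul_sub_le (hξ : IsRegularSeq ξ P) (d : ℤ) (m : ℕ) :
    eLpNorm (fun ω => P[fun ω => ξ 0 ω * ξ d ω | pastSigma ξ (-(m : ℤ))] ω
        - ∫ ω, ξ 0 ω * ξ d ω ∂P) 1 P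
      ≤ 2 * (eLpNorm (ξ 0) 2 P * eLpNorm (P[ξ 0 | pastSigma ξ (-d)]) 2 P) := by
  refine (eLpNorm_sub_le (g := fun _ => ∫ ω, ξ 0 ω * ξ d ω ∂P) integrable_condExp.1
    aestronglyMeasurable_const le_rfl).trans ?_
  rw [two_mul]
  refine add_le_add ?_ ?_
  · refine le_trans ?_ (hξ.eLpNorm_condExp_mul_le d)
    rw [← eLpNorm_congr_ae (condExp_condExp_of_le
      (pastSigma_mono ξ (by omega : -(m : ℤ) ≤ 0)) (pastSigma_le hξ.measurable 0))]
    exact eLpNorm_condExp_le_eLpNorm _ le_rfl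
  · rw [eLpNorm_const _ one_ne_zero (NeZero.ne P)]
    simpa using hξ.enorm_covariance_le d

/-- The second regularity condition holds uniformly in the lag. -/
theorem eventually_condExp_one_le (hξ : IsRegularSeq ξ P) {ε : ENNReal} (hε : 0 < ε) :
    ∀ᶠ m : ℕ in atTop, ∀ d : ℕ, eLpNorm (fun ω =>
      P[fun ω => ξ 0 ω * ξ (d : ℤ) ω | pastSigma ξ (-(m : ℤ))] ω
        - ∫ ω, ξ 0 ω * ξ (d : ℤ) ω ∂P) 1 P ≤ ε := by
  have h2 := ENNReal.Tendsto.const_mul (a := 2) hξ.tendsto_eLpNorm_mul_condExp (Or.inr (by simp))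
  rw [mul_zero, ENNReal.tendsto_nhds_zero] at h2
  obtain ⟨D, hD⟩ := eventually_atTop.1 (h2 ε hε)
  have h3 : ∀ d ∈ Finset.range D, ∀ᶠ m : ℕ in atTop, eLpNorm (fun ω =>
      P[fun ω => ξ 0 ω * ξ (d : ℤ) ω | pastSigma ξ (-(m : ℤ))] ω
        - ∫ ω, ξ 0 ω * ξ (d : ℤ) ω ∂P) 1 P ≤ ε := fun d _ =>
    (ENNReal.tendsto_nhds_zero.1 (hξ.tendsto_condExp_one d)) ε hε
  -- Lags below `D` are finitely many and use the second regularity condition one by one; the others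
  -- use the bound that is uniform in `m`.
  filter_upwards [(Finset.eventually_all _).2 h3] with m hm d
  by_cases hd : d < D
  · exact hm d (Finset.mem_range.2 hd)
  · exact (hξ.eLpNorm_condExp_mul_sub_le d m).trans (hD d (not_lt.1 hd))

end IsRegularSeq
end RowIndep

namespace RowIndep

/-! ### Conditions (a) and (b). -/

section Conditions

theorem rowSigma_le_pastSigma {Ω : Type*} (X : ℕ+ → ℤ → Ω → ℝ) (i : ℕ+) (k : ℤ) :
    rowSigma (fun i j : ℕ+ => X i (j : ℤ)) i k ≤ pastSigma (X i) k :=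
  iSup₂_le fun j hj => le_iSup₂_of_le (j : ℤ) hj le_rfl

/-- Conditioning on a coarser sigma-field decreases the norm of the recentred expectation. -/
theorem eLpNorm_condExp_sub_const_mono {Ω : Type*} {m₁ m₂ m₀ : MeasurableSpace Ω}
    {P : Measure Ω} [IsProbabilityMeasure P] (h₁₂ : m₁ ≤ m₂)
    (h₂ : m₂ ≤ m₀) (f : Ω → ℝ) (c : ℝ) {p : ENNReal} (hp : 1 ≤ p) :
    eLpNorm (fun ω => P[f | m₁] ω - c) p P ≤ eLpNorm (fun ω => P[f | m₂] ω - c) p P := by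
  have h : (fun ω => P[f | m₁] ω - c) =ᵐ[P] P[fun ω => P[f | m₂] ω - c | m₁] := by
    filter_upwards [condExp_sub (m := m₁) (integrable_condExp (f := f) (m := m₂) (μ := P))
      (integrable_const c), condExp_condExp_of_le (f := f) (μ := P) h₁₂ h₂] with ω h1 h2
    have h3 : P[fun _ => c | m₁] ω = c := congrFun (condExp_const (h₁₂.trans h₂) c) ω
    have h4 : P[fun ω => P[f | m₂] ω - c | m₁] ω
      = (P[P[f | m₂] | m₁] - P[fun _ => c | m₁]) ω := h1
    rw [h4, Pi.sub_apply, h2, h3]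
  rw [eLpNorm_congr_ae h]
  exact eLpNorm_condExp_le_eLpNorm _ hp

variable {Ω₀ : Type*} [MeasurableSpace Ω₀] {P₀ : Measure Ω₀} [IsProbabilityMeasure P₀]
  {ξ : ℤ → Ω₀ → ℝ} {Ω : Type*} [MeasurableSpace Ω] {P : Measure Ω}
  {X : ℕ+ → ℤ → Ω → ℝ}

variable (hξ : IsRegularSeq ξ P₀) (hX_meas : ∀ i j, Measurable (X i j))
  (hX_copy : ∀ i, IdentDistrib (fun ω (j : ℤ) => X i j ω) (fun ω (j : ℤ) => ξ j ω) P P₀)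

include hξ hX_meas hX_copy

/-- All entries share the truncated second moment `g`. At most n² terms are averaged, so the sum is
bounded by `g (ε √n)`, which tends to 0 by dominated convergence. -/
theorem lindebergCondition :
    LindebergCondition (fun i j : ℕ+ => X i (j : ℤ)) P where
  centered i j := by
    have h : IdentDistrib (X i j) (ξ j) P P₀ :=
      (hX_copy i).comp (u := fun (x : ℤ → ℝ) => x j) (by fun_prop)
    exact ⟨h.integrable_iff.2 ((hξ.memLp _).integrable one_le_two),
      h.integral_eq.trans (hξ.centered _)⟩
  bounded := by
    -- The `+ 1` secures strict positivity even if `ξ 0` vanishes almost surely.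
    refine ⟨(eLpNorm (ξ 0) 2 P₀).toReal + 1, by positivity, fun i j => ?_⟩
    have h : IdentDistrib (X i j) (ξ j) P P₀ :=
      (hX_copy i).comp (u := fun (x : ℤ → ℝ) => x j) (by fun_prop)
    rw [h.eLpNorm_eq, hξ.eLpNorm_eq, ENNReal.ofReal_add (by positivity) zero_le_one,
      ENNReal.ofReal_toReal (hξ.memLp 0).eLpNorm_lt_top.ne]
    exact le_self_add
  lindeberg ε hε := by
    set g : ℝ → ℝ := fun A => ∫ ω in {ω | A < |ξ 0 ω|}, ξ 0 ω ^ 2 ∂P₀ with hg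
    have hgX : ∀ (i j : ℕ+) (A : ℝ), ∫ ω in {ω | A < |X i j ω|}, X i j ω ^ 2 ∂P = g A := by
      intro i j A
      have h : IdentDistrib (X i j) (ξ 0) P P₀ :=
        ((hX_copy i).comp (u := fun (x : ℤ → ℝ) => x j) (by fun_prop)).trans
          (hξ.identDistrib_zero j)
      have hs : MeasurableSet {x : ℝ | A < |x|} := measurableSet_lt measurable_const measurable_abs
      have e1 := integral_indicator (μ := P) (f := fun ω => X i j ω ^ 2) (hX_meas i j hs)
      have e2 := integral_indicator (μ := P₀) (f := fun ω => ξ 0 ω ^ 2) (hξ.measurable 0 hs)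
      refine e1.symm.trans (Eq.trans ?_ e2)
      exact (h.comp (u := {x : ℝ | A < |x|}.indicator fun x => x ^ 2)
        ((measurable_id.pow_const 2).indicator hs)).integral_eq
    have hg0 : ∀ A, 0 ≤ g A := fun A => integral_nonneg fun ω => sq_nonneg _
    have hlim : Tendsto (fun n : ℕ => g (ε * Real.sqrt n)) atTop (𝓝 0) := by
      have h0 : (0 : ℝ) = ∫ _, (0 : ℝ) ∂P₀ := by simp
      rw [h0]
      have hind : ∀ A, g A = ∫ ω, {ω | A < |ξ 0 ω|}.indicator (fun ω => ξ 0 ω ^ 2) ω ∂P₀ :=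
        fun A => (integral_indicator (hξ.measurable 0
          (measurableSet_lt measurable_const measurable_abs))).symm
      simp only [hind]
      refine tendsto_integral_of_dominated_convergence (fun ω => ξ 0 ω ^ 2) (fun n => ?_)
        (hξ.memLp 0).integrable_sq (fun n => ae_of_all _ fun ω => ?_) (ae_of_all _ fun ω => ?_)
      · exact (((hξ.measurable 0).pow_const 2).indicator (hξ.measurable 0
          (measurableSet_lt measurable_const measurable_abs))).aestronglyMeasurable
      · refine (norm_indicator_le_norm_self _ _).trans ?_
        rw [Real.norm_eq_abs, abs_of_nonneg (sq_nonneg _)]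
      · have h : Tendsto (fun n : ℕ => ε * Real.sqrt n) atTop atTop :=
          (Real.tendsto_sqrt_atTop.comp tendsto_natCast_atTop_atTop).const_mul_atTop hε
        refine tendsto_const_nhds.congr' ?_
        filter_upwards [h.eventually_ge_atTop |ξ 0 ω|] with n hn
        rw [Set.indicator_of_notMem (by simpa using hn)]
    refine tendsto_of_tendsto_of_tendsto_of_le_of_le tendsto_const_nhds hlim (fun n => ?_)
      fun n => ?_
    · simp only [lindebergSum, hgX]
      have := hg0
      positivity
    · simp only [lindebergSum, hgX]
      rcases Nat.eq_zero_or_pos n with rfl | hn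
      · simpa using hg0 _
      have hn' : (0 : ℝ) < n := by exact_mod_cast hn
      rw [one_div, inv_mul_le_iff₀ (by positivity)]
      calc ∑ a ∈ Finset.range n, ∑ b ∈ Finset.range (a + 1), g (ε * √n)
          ≤ ∑ a ∈ Finset.range n, (n : ℝ) * g (ε * √n) := by
            refine Finset.sum_le_sum fun a ha => ?_
            rw [Finset.sum_const, Finset.card_range, nsmul_eq_mul]
            refine mul_le_mul_of_nonneg_right ?_ (hg0 _)
            exact_mod_cast Finset.mem_range.1 ha
        _ = (n : ℝ) ^ 2 * g (ε * √n) := by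
            rw [Finset.sum_const, Finset.card_range, nsmul_eq_mul]; ring

variable [IsProbabilityMeasure P]

/-- Passing to the full past of the row increases the norm, and a shift by `j` makes it independent
of `i` and `j`. -/
theorem tendsto_eta : Tendsto (eta (fun i j : ℕ+ => X i (j : ℤ)) P) atTop (𝓝 0) := by
  refine tendsto_of_tendsto_of_tendsto_of_le_of_le tendsto_const_nhds hξ.tendsto_condExp_two
    (fun _ => zero_le) fun m => ?_
  refine iSup_le fun i => iSup_le fun j => iSup_le fun _ => ?_
  have h1 := eLpNorm_condExp_sub_const_mono (P := P)
    (rowSigma_le_pastSigma X i ((j : ℤ) - m)) (pastSigma_le (hX_meas i) _) (X i j) 0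
    (one_le_two (α := ENNReal))
  have h2 := eLpNorm_condExp_past_eq hξ.measurable hξ.stationary (hX_meas i) (hX_copy i)
    (h := fun x => x 0) (by fun_prop) ((hξ.memLp 0).integrable one_le_two) j m 0 2
  simp only [sub_zero, zero_add] at h1 h2
  exact h1.trans h2.le

theorem tendsto_gam : Tendsto (gam (fun i j : ℕ+ => X i (j : ℤ)) P) atTop (𝓝 0) := by
  rw [ENNReal.tendsto_nhds_zero]
  intro ε hε
  filter_upwards [hξ.eventually_condExp_one_le hε] with m hm
  refine iSup_le fun i => iSup_le fun l => iSup_le fun k => iSup_le fun hlk => ?_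
  -- After a shift by `k` only the lag `d` remains, hence the need for uniformity in the lag.
  obtain ⟨d, hd⟩ : ∃ d : ℕ, (l : ℤ) = d + k :=
    ⟨(l : ℕ) - k, by have : (k : ℕ) ≤ l := hlk.2.1; omega⟩
  have hc : ∫ ω, X i k ω * X i l ω ∂P = ∫ ω, ξ 0 ω * ξ (d : ℤ) ω ∂P₀ := by
    have h1 := ((hX_copy i).comp (u := fun (x : ℤ → ℝ) => x k * x l) (by fun_prop)).integral_eq
    have h2 := (hξ.identDistrib_mul k d).integral_eq
    rw [← h2, add_comm, ← hd]
    exact h1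
  have h2 := eLpNorm_condExp_past_eq hξ.measurable hξ.stationary (hX_meas i) (hX_copy i)
    (h := fun x => x 0 * x d) (by fun_prop) (hξ.integrable_mul 0 d) k m
    (∫ ω, ξ 0 ω * ξ (d : ℤ) ω ∂P₀) 1
  have h1 := eLpNorm_condExp_sub_const_mono (P := P)
    (rowSigma_le_pastSigma X i ((k : ℤ) - m)) (pastSigma_le (hX_meas i) _)
    (fun ω => X i k ω * X i l ω) (∫ ω, ξ 0 ω * ξ (d : ℤ) ω ∂P₀) le_rfl
  simp only [zero_add, ← hd] at h2
  rw [hc]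
  exact h1.trans (h2.le.trans (hm d))

end Conditions
end RowIndep

namespace RowIndep

/-! ### Elementary moment inequalities. -/

section Norms

variable {Ω : Type*} {m0 : MeasurableSpace Ω} {P : Measure Ω}

theorem integral_abs_le_of_eLpNorm_one_le {f : Ω → ℝ} (hf : AEStronglyMeasurable f P) {ε : ℝ}
    (hε : 0 ≤ ε) (h : eLpNorm f 1 P ≤ ENNReal.ofReal ε) : ∫ ω, |f ω| ∂P ≤ ε := by
  have h1 := integral_norm_eq_lintegral_enorm hf
  simp only [Real.norm_eq_abs] at h1
  rw [h1, ← eLpNorm_one_eq_lintegral_enorm]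
  exact ENNReal.toReal_le_of_le_ofReal hε h

theorem integral_sq_le_of_eLpNorm_two_le {f : Ω → ℝ} (hf : MemLp f 2 P) {ε : ℝ}
    (hε : 0 ≤ ε) (h : eLpNorm f 2 P ≤ ENNReal.ofReal ε) : ∫ ω, f ω ^ 2 ∂P ≤ ε ^ 2 := by
  rw [hf.eLpNorm_eq_integral_rpow_norm two_ne_zero (by simp),
    ENNReal.ofReal_le_ofReal_iff hε] at h
  simp only [ENNReal.toReal_ofNat, Real.rpow_ofNat, Real.norm_eq_abs, sq_abs] at h
  have h0 : 0 ≤ ∫ ω, f ω ^ 2 ∂P := integral_nonneg fun ω => sq_nonneg _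
  calc ∫ ω, f ω ^ 2 ∂P = ((∫ ω, f ω ^ 2 ∂P) ^ (2⁻¹ : ℝ)) ^ 2 := by
        rw [← Real.rpow_natCast, ← Real.rpow_mul h0]; norm_num
    _ ≤ ε ^ 2 := by gcongr

/-- A first moment is controlled by a second moment. -/
theorem integral_abs_le_of_integral_sq_le [IsProbabilityMeasure P] {f : Ω → ℝ} (hf : MemLp f 2 P)
    {A t : ℝ} (ht : 0 < t) (h : ∫ ω, f ω ^ 2 ∂P ≤ A) : ∫ ω, |f ω| ∂P ≤ t / 2 + A / (2 * t) := by
  -- AM–GM with a free parameter replaces Cauchy–Schwarz and avoids square roots.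
  have hpt : ∀ ω, |f ω| ≤ t / 2 + f ω ^ 2 / (2 * t) := fun ω => by
    have h1 : t / 2 + f ω ^ 2 / (2 * t) - |f ω| = (t - |f ω|) ^ 2 / (2 * t) := by
      rw [← sq_abs (f ω)]; field_simp; ring
    have h2 : 0 ≤ (t - |f ω|) ^ 2 / (2 * t) := by positivity
    linarith
  calc ∫ ω, |f ω| ∂P ≤ ∫ ω, (t / 2 + f ω ^ 2 / (2 * t)) ∂P :=
        integral_mono (hf.integrable one_le_two).abs
          ((integrable_const _).add (hf.integrable_sq.div_const _)) hpt
    _ = t / 2 + (∫ ω, f ω ^ 2 ∂P) / (2 * t) := by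
        rw [integral_add (integrable_const _) (hf.integrable_sq.div_const _), integral_const,
          integral_div]; simp
    _ ≤ t / 2 + A / (2 * t) := by gcongr

end Norms

/-! ### Sums of variables orthogonal at distance m. -/

section Orthogonality

variable {Ω : Type*} {m0 : MeasurableSpace Ω} {P : Measure Ω}

/-- Variance bound for sums of variables that are orthogonal at distance at least `m`. -/
theorem integral_sq_sum_le_of_orthogonal {V : ℕ → Ω → ℝ} {m : ℕ} (hV : ∀ j, MemLp (V j) 2 P)
    (horth : ∀ j k, j + m ≤ k → ∫ ω, V j ω * V k ω ∂P = 0) (n : ℕ) :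
    ∫ ω, (∑ j ∈ Finset.range n, V j ω) ^ 2 ∂P
      ≤ 2 * m * ∑ j ∈ Finset.range n, ∫ ω, V j ω ^ 2 ∂P := by
  have hint : ∀ j k, Integrable (fun ω => V j ω * V k ω) P := fun j k =>
    (hV j).integrable_mul (hV k)
  set a : ℕ → ℝ := fun j => ∫ ω, V j ω ^ 2 ∂P with ha
  have ha0 : ∀ j, 0 ≤ a j := fun j => integral_nonneg fun ω => sq_nonneg _
  have hcs : ∀ j k, ∫ ω, V j ω * V k ω ∂P ≤ (a j + a k) / 2 := fun j k => by
    rw [ha, ← integral_add (hV j).integrable_sq (hV k).integrable_sq, ← integral_div]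
    refine integral_mono (hint j k) (((hV j).integrable_sq.add (hV k).integrable_sq).div_const _)
      fun ω => ?_
    simp only
    nlinarith [sq_nonneg (V j ω - V k ω)]
  have hterm : ∀ j k, ∫ ω, V j ω * V k ω ∂P
      ≤ if k < j + m ∧ j < k + m then (a j + a k) / 2 else 0 := fun j k => by
    split_ifs with h
    · exact hcs j k
    · rcases not_and_or.1 h with h | h
      · exact (horth j k (not_lt.1 h)).le
      · simp only [mul_comm (V j _)]
        exact (horth k j (not_lt.1 h)).le
  -- Only pairs at distance less than `m` contribute, and each index has at most 2m - 1 such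
  -- partners.
  have hcard : ∀ j, (∑ k ∈ Finset.range n, if k < j + m ∧ j < k + m then (1 : ℝ) else 0)
      ≤ 2 * m := fun j => by
    rw [Finset.sum_boole]
    have hsub : (Finset.range n).filter (fun k => k < j + m ∧ j < k + m)
        ⊆ Finset.Ico (j + 1 - m) (j + m) := fun k hk => by
      simp only [Finset.mem_filter, Finset.mem_Ico] at hk ⊢
      omega
    have := Finset.card_le_card hsub
    rw [Nat.card_Ico] at this
    exact_mod_cast this.trans (by omega)
  calc ∫ ω, (∑ j ∈ Finset.range n, V j ω) ^ 2 ∂P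
      = ∑ j ∈ Finset.range n, ∑ k ∈ Finset.range n, ∫ ω, V j ω * V k ω ∂P := by
        simp only [sq, Finset.sum_mul_sum]
        rw [integral_finsetSum _ fun j _ => integrable_finsetSum _ fun k _ => hint j k]
        exact Finset.sum_congr rfl fun j _ => integral_finsetSum _ fun k _ => hint j k
    _ ≤ ∑ j ∈ Finset.range n, ∑ k ∈ Finset.range n,
          (if k < j + m ∧ j < k + m then (a j + a k) / 2 else 0) :=
        Finset.sum_le_sum fun j _ => Finset.sum_le_sum fun k _ => hterm j k
    _ = (∑ j ∈ Finset.range n, ∑ k ∈ Finset.range n,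
          a j / 2 * (if k < j + m ∧ j < k + m then 1 else 0))
        + ∑ j ∈ Finset.range n, ∑ k ∈ Finset.range n,
          a k / 2 * (if k < j + m ∧ j < k + m then 1 else 0) := by
        rw [← Finset.sum_add_distrib]
        refine Finset.sum_congr rfl fun j _ => ?_
        rw [← Finset.sum_add_distrib]
        refine Finset.sum_congr rfl fun k _ => ?_
        split_ifs <;> ring
    _ = 2 * ∑ j ∈ Finset.range n, ∑ k ∈ Finset.range n,
          a j / 2 * (if k < j + m ∧ j < k + m then 1 else 0) := by
        rw [two_mul]
        congr 1
        rw [Finset.sum_comm]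
        refine Finset.sum_congr rfl fun j _ => Finset.sum_congr rfl fun k _ => ?_
        simp only [and_comm]
    _ ≤ 2 * ∑ j ∈ Finset.range n, a j / 2 * (2 * m) := by
        gcongr with j
        rw [← Finset.mul_sum]
        exact mul_le_mul_of_nonneg_left (hcard j) (by have := ha0 j; positivity)
    _ = _ := by
        rw [Finset.mul_sum, Finset.mul_sum]
        exact Finset.sum_congr rfl fun j _ => by ring

theorem ae_abs_sub_condExp_le {G : MeasurableSpace Ω} {f : Ω → ℝ} {K : ℝ}
    (hf : ∀ ω, |f ω| ≤ K) : ∀ᵐ ω ∂P, |f ω - P[f | G] ω| ≤ 2 * K := by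
  have h := ae_bdd_abs_condExp_of_ae_bdd_abs (m := G) (μ := P) (R := K) (ae_of_all _ hf)
  filter_upwards [h] with ω hω
  have h1 := hf ω
  have h2 : |P[f | G] ω| ≤ K := hω
  exact (abs_sub _ _).trans (by linarith)

variable [IsProbabilityMeasure P]

/-- A variable with vanishing conditional expectation is orthogonal to bounded functions. -/
theorem integral_mul_eq_zero_of_condExp {G : MeasurableSpace Ω} (hG : G ≤ m0) {U H : Ω → ℝ}
    {K : ℝ} (hU : Integrable U P) (hU0 : P[U | G] =ᵐ[P] 0) (hH : StronglyMeasurable[G] H)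
    (hK : ∀ᵐ ω ∂P, |H ω| ≤ K) : ∫ ω, U ω * H ω ∂P = 0 := by
  have hint : Integrable (fun ω => H ω * U ω) P :=
    hU.bdd_mul (hH.mono hG).aestronglyMeasurable hK
  have h := condExp_mul_of_stronglyMeasurable_left hH hint hU
  simp only [mul_comm (U _)]
  rw [← integral_condExp hG]
  have : P[H * U | G] =ᵐ[P] 0 := by
    filter_upwards [h, hU0] with ω h1 h2
    simp [h1, h2]
  exact (integral_congr_ae this).trans (by simp)

/-- Recentring a bounded variable by its conditional expectation. -/
theorem condExp_sub_condExp_eq_zero {G : MeasurableSpace Ω} (hG : G ≤ m0) {f : Ω → ℝ}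
    (hf : Integrable f P) : P[fun ω => f ω - P[f | G] ω | G] =ᵐ[P] 0 := by
  have h := condExp_sub hf (integrable_condExp (f := f) (m := G) (μ := P)) G
  have h' : P[P[f | G] | G] = P[f | G] :=
    condExp_of_stronglyMeasurable hG stronglyMeasurable_condExp integrable_condExp
  rw [h'] at h
  exact h.trans (by simp)

end Orthogonality
end RowIndep

namespace RowIndep

/-! ### Contraction forms and Fejér weights. -/

section Bilinear

/-- The bilinear form with coefficients `B` on `ℝⁿ` has norm at most `1`. -/
def BilinBound (n : ℕ) (B : ℕ → ℕ → ℝ) : Prop :=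
  ∀ x y : ℕ → ℝ, |∑ j ∈ Finset.range n, ∑ k ∈ Finset.range n, B j k * x j * y k|
    ≤ (∑ j ∈ Finset.range n, x j ^ 2 + ∑ k ∈ Finset.range n, y k ^ 2) / 2

namespace BilinBound

variable {n : ℕ} {B : ℕ → ℕ → ℝ}

/-- Multiplying `x` by √t and `y` by its inverse leaves the form unchanged but rebalances the two
sums of squares. -/
theorem scaled (hB : BilinBound n B) {t : ℝ} (ht : 0 < t) (x y : ℕ → ℝ) :
    |∑ j ∈ Finset.range n, ∑ k ∈ Finset.range n, B j k * x j * y k|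
      ≤ (t * ∑ j ∈ Finset.range n, x j ^ 2 + t⁻¹ * ∑ k ∈ Finset.range n, y k ^ 2) / 2 := by
  have hs : √t ≠ 0 := (Real.sqrt_pos.2 ht).ne'
  have h := hB (fun j => √t * x j) (fun k => (√t)⁻¹ * y k)
  simp only [mul_pow, inv_pow, Real.sq_sqrt ht.le, ← Finset.mul_sum] at h
  refine le_trans (le_of_eq ?_) h
  refine congrArg _ (Finset.sum_congr rfl fun j _ => Finset.sum_congr rfl fun k _ => ?_)
  field_simp

theorem transpose (hB : BilinBound n B) : BilinBound n fun j k => B k j := fun x y => by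
  rw [Finset.sum_comm, add_comm]
  refine le_trans (le_of_eq ?_) (hB y x)
  refine congrArg _ (Finset.sum_congr rfl fun j _ => Finset.sum_congr rfl fun k _ => ?_)
  ring

theorem abs_le (hB : BilinBound n B) {j k : ℕ} (hj : j < n) (hk : k < n) : |B j k| ≤ 1 := by
  have h := hB (fun i => if i = j then 1 else 0) (fun i => if i = k then 1 else 0)
  simpa [hj, hk] using h

/-- Testing with S times the basis vector `j` and with row `j` itself gives S² ≤ (S² + S) / 2, so S
≤ 1. -/
theorem sum_sq_le (hB : BilinBound n B) {j : ℕ} (hj : j < n) :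
    ∑ k ∈ Finset.range n, B j k ^ 2 ≤ 1 := by
  set S := ∑ k ∈ Finset.range n, B j k ^ 2 with hS
  have h := hB (fun i => if i = j then S else 0) (fun k => B j k)
  have e : ∑ i ∈ Finset.range n, ∑ k ∈ Finset.range n, B i k * (if i = j then S else 0) * B j k
      = S * S := by
    rw [Finset.sum_eq_single_of_mem j (Finset.mem_range.2 hj)]
    · simp only [if_true]
      rw [hS, Finset.sum_mul]
      simp only [← hS]
      exact Finset.sum_congr rfl fun k _ => by ring
    · intro i _ hi
      simp [hi]
  rw [e] at h
  have e2 : ∑ i ∈ Finset.range n, (if i = j then S else 0) ^ 2 = S ^ 2 := by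
    rw [Finset.sum_eq_single_of_mem j (Finset.mem_range.2 hj)]
    · simp
    · intro i _ hi
      simp [hi]
  rw [e2] at h
  have h0 : 0 ≤ S := Finset.sum_nonneg fun _ _ => sq_nonneg _
  rw [abs_of_nonneg (by positivity)] at h
  by_contra hlt
  push Not at hlt
  nlinarith

end BilinBound

/-- Fejér type weights: the fraction of windows of length `L` containing both `j` and `k`. -/
noncomputable def windowWeight (L j k : ℕ) : ℝ :=
  ((Finset.Ico j (j + L) ∩ Finset.Ico k (k + L)).card : ℝ) / L

theorem windowWeight_nonneg (L j k : ℕ) : 0 ≤ windowWeight L j k := by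
  unfold windowWeight; positivity

theorem windowWeight_le_one (L j k : ℕ) : windowWeight L j k ≤ 1 := by
  unfold windowWeight
  refine div_le_one_of_le₀ ?_ (by positivity)
  have := Finset.card_le_card (Finset.inter_subset_left (s₁ := Finset.Ico j (j + L))
    (s₂ := Finset.Ico k (k + L)))
  rw [Nat.card_Ico] at this
  exact_mod_cast this.trans (by omega)

theorem windowWeight_eq_zero {L j k : ℕ} (h : j + L ≤ k ∨ k + L ≤ j) : windowWeight L j k = 0 := by
  unfold windowWeight
  rw [Finset.Ico_inter_Ico, Nat.card_Ico]
  have : min (j + L) (k + L) - max j k = 0 := by omega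
  rw [this]
  simp

theorem one_sub_windowWeight_le {L m j k : ℕ} (hL : 0 < L) (h1 : j ≤ k + m) (h2 : k ≤ j + m) :
    1 - windowWeight L j k ≤ m / L := by
  unfold windowWeight
  rw [Finset.Ico_inter_Ico, Nat.card_Ico]
  have hL' : (0 : ℝ) < L := by exact_mod_cast hL
  rw [sub_le_iff_le_add, ← add_div, le_div_iff₀ hL', one_mul]
  exact_mod_cast (by omega : L ≤ m + (min (j + L) (k + L) - max j k))

/-- The weighted form is 1/L times the sum, over the positions s, of the form of `B` applied to `x`
and `y` cut off to the indices whose window contains s. Each index occurs for exactly `L` positions,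
so the contraction bound survives. -/
theorem BilinBound.window {n : ℕ} {B : ℕ → ℕ → ℝ} (hB : BilinBound n B) {L : ℕ} (hL : 0 < L) :
    BilinBound n fun j k => windowWeight L j k * B j k := by
  intro x y
  have hL' : (0 : ℝ) < L := by exact_mod_cast hL
  set I : ℕ → ℕ → ℝ := fun j s => if s ∈ Finset.Ico j (j + L) then 1 else 0 with hI
  have hw : ∀ j ∈ Finset.range n, ∀ k, windowWeight L j k
      = (∑ s ∈ Finset.range (n + L), I j s * I k s) / L := fun j hj k => by
    unfold windowWeight
    congr 1
    have hsub : Finset.Ico j (j + L) ∩ Finset.Ico k (k + L) = (Finset.range (n + L)).filter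
        fun s => s ∈ Finset.Ico j (j + L) ∧ s ∈ Finset.Ico k (k + L) := by
      ext s
      simp only [Finset.mem_inter, Finset.mem_filter, Finset.mem_Ico, Finset.mem_range] at hj ⊢
      omega
    rw [hsub, ← Finset.sum_boole]
    refine Finset.sum_congr rfl fun s _ => ?_
    simp only [hI, ite_and, mul_ite, mul_one, mul_zero]
    split_ifs <;> rfl
  have hI2 : ∀ j ∈ Finset.range n, ∑ s ∈ Finset.range (n + L), I j s ^ 2 = L := fun j hj => by
    have hsub : Finset.Ico j (j + L) = (Finset.range (n + L)).filter
        fun s => s ∈ Finset.Ico j (j + L) := by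
      ext s
      simp only [Finset.mem_filter, Finset.mem_Ico, Finset.mem_range] at hj ⊢
      omega
    have hc : ((Finset.Ico j (j + L)).card : ℝ) = L := by simp
    rw [← hc, hsub, ← Finset.sum_boole]
    refine Finset.sum_congr rfl fun s _ => ?_
    simp only [hI]
    split_ifs <;> simp
  have hsq : ∀ x : ℕ → ℝ, ∑ s ∈ Finset.range (n + L), ∑ j ∈ Finset.range n, (I j s * x j) ^ 2
      = L * ∑ j ∈ Finset.range n, x j ^ 2 := fun x => by
    rw [Finset.sum_comm, Finset.mul_sum]
    refine Finset.sum_congr rfl fun j hj => ?_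
    simp only [mul_pow, ← Finset.sum_mul, hI2 j hj]
  have e : ∑ j ∈ Finset.range n, ∑ k ∈ Finset.range n, windowWeight L j k * B j k * x j * y k
      = (∑ s ∈ Finset.range (n + L), ∑ j ∈ Finset.range n, ∑ k ∈ Finset.range n,
          B j k * (I j s * x j) * (I k s * y k)) / L := by
    rw [Finset.sum_comm (s := Finset.range (n + L)), Finset.sum_div]
    refine Finset.sum_congr rfl fun j hj => ?_
    rw [Finset.sum_comm (s := Finset.range (n + L)), Finset.sum_div]
    refine Finset.sum_congr rfl fun k _ => ?_
    rw [hw j hj k, Finset.sum_div, Finset.sum_div, Finset.sum_mul, Finset.sum_mul, Finset.sum_mul]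
    exact Finset.sum_congr rfl fun s _ => by ring
  rw [e, abs_div, abs_of_pos hL', div_le_iff₀ hL']
  calc |∑ s ∈ Finset.range (n + L), ∑ j ∈ Finset.range n, ∑ k ∈ Finset.range n,
          B j k * (I j s * x j) * (I k s * y k)|
      ≤ ∑ s ∈ Finset.range (n + L), (∑ j ∈ Finset.range n, (I j s * x j) ^ 2
          + ∑ k ∈ Finset.range n, (I k s * y k) ^ 2) / 2 :=
        (Finset.abs_sum_le_sum_abs _ _).trans (Finset.sum_le_sum fun s _ => hB _ _)
    _ = _ := by
        rw [← Finset.sum_div, Finset.sum_add_distrib, hsq, hsq]; ring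

end Bilinear

/-! ### Weak law for weighted sums. -/

section Orthogonal

variable {Ω : Type*} {m0 : MeasurableSpace Ω} {P : Measure Ω} [IsProbabilityMeasure P]
  {G : ℤ → MeasurableSpace Ω}

/-- First moment of weighted sums of integrable variables that are uniformly close to bounded ones
and have small conditional expectations given the remote past. -/
theorem integral_abs_weighted_sum_le (hG : Monotone G) (hle : ∀ k, G k ≤ m0) {Z : ℕ → Ω → ℝ}
    {d N : ℕ} {K δ : ℝ} {φ : ℝ → ℝ} (hδ : 0 < δ) (hφ : Measurable φ) (hφK : ∀ x, |φ x| ≤ K)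
    (hZm : ∀ j : ℕ, Measurable[G (j + d)] (Z j)) (hZ : ∀ j, Integrable (Z j) P)
    (h1 : ∀ j, ∫ ω, |Z j ω - φ (Z j ω)| ∂P ≤ δ)
    (h2 : ∀ j : ℕ, ∫ ω, |P[Z j | G (j - N)] ω| ∂P ≤ δ) (n : ℕ) (a : ℕ → ℝ) (ha : ∀ j, |a j| ≤ 1) :
    ∫ ω, |∑ j ∈ Finset.range n, a j * Z j ω| ∂P ≤ 4 * δ * n + 4 * (N + d) * K ^ 2 / δ := by
  -- Truncating and recentring makes `V j` bounded, measurable at time j + d and conditionally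
  -- centred given time j - N. Hence the `V j` are orthogonal at distance N + d.
  set V : ℕ → Ω → ℝ := fun j ω => φ (Z j ω) - P[fun ω => φ (Z j ω) | G (j - N)] ω with hVdef
  have hφZ : ∀ j : ℕ, StronglyMeasurable[G (j + d)] fun ω => φ (Z j ω) := fun j =>
    (hφ.comp (hZm j)).stronglyMeasurable
  have hφi : ∀ j, Integrable (fun ω => φ (Z j ω)) P := fun j =>
    Integrable.of_bound ((hφZ j).mono (hle _)).aestronglyMeasurable K (ae_of_all _ fun ω => hφK _)
  have hVm : ∀ j : ℕ, StronglyMeasurable[G (j + d)] (V j) := fun j =>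
    (hφZ j).sub (stronglyMeasurable_condExp.mono (hG (by omega)))
  have hVb : ∀ j, ∀ᵐ ω ∂P, |V j ω| ≤ 2 * K := fun j => ae_abs_sub_condExp_le fun ω => hφK _
  have hV2 : ∀ j, MemLp (V j) 2 P := fun j =>
    MemLp.of_bound ((hVm j).mono (hle _)).aestronglyMeasurable (2 * K) (hVb j)
  have hV0 : ∀ j : ℕ, P[V j | G (j - N)] =ᵐ[P] 0 := fun j =>
    condExp_sub_condExp_eq_zero (hle _) (hφi j)
  have haV2 : ∀ j, MemLp (fun ω => a j * V j ω) 2 P := fun j => (hV2 j).const_mul _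
  have horth : ∀ j k, j + (N + d) ≤ k → ∫ ω, (a j * V j ω) * (a k * V k ω) ∂P = 0 := by
    intro j k hjk
    have h := integral_mul_eq_zero_of_condExp (hle (k - N)) ((hV2 k).integrable one_le_two) (hV0 k)
      ((hVm j).mono (hG (by omega))) (hVb j)
    calc ∫ ω, (a j * V j ω) * (a k * V k ω) ∂P = ∫ ω, a j * a k * (V k ω * V j ω) ∂P := by
          congr 1; ext ω; ring
      _ = 0 := by rw [integral_const_mul, h, mul_zero]
  have hsqV : ∀ j, ∫ ω, (a j * V j ω) ^ 2 ∂P ≤ 4 * K ^ 2 := fun j => by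
    have : ∀ᵐ ω ∂P, (a j * V j ω) ^ 2 ≤ 4 * K ^ 2 := by
      filter_upwards [hVb j] with ω hω
      have : |a j * V j ω| ≤ 2 * K := by
        rw [abs_mul]
        calc |a j| * |V j ω| ≤ 1 * (2 * K) := mul_le_mul (ha j) hω (abs_nonneg _) zero_le_one
          _ = 2 * K := one_mul _
      calc (a j * V j ω) ^ 2 = |a j * V j ω| ^ 2 := (sq_abs _).symm
        _ ≤ (2 * K) ^ 2 := by gcongr
        _ = 4 * K ^ 2 := by ring
    calc ∫ ω, (a j * V j ω) ^ 2 ∂P ≤ ∫ _, 4 * K ^ 2 ∂P :=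
          integral_mono_ae (haV2 j).integrable_sq (integrable_const _) this
      _ = 4 * K ^ 2 := by simp
  have hsum2 : MemLp (fun ω => ∑ j ∈ Finset.range n, a j * V j ω) 2 P :=
    memLp_finsetSum _ fun j _ => haV2 j
  have hvar : ∫ ω, (∑ j ∈ Finset.range n, a j * V j ω) ^ 2 ∂P
      ≤ 2 * (N + d) * (n * (4 * K ^ 2)) := by
    refine (integral_sq_sum_le_of_orthogonal haV2 horth n).trans ?_
    push_cast
    gcongr
    calc ∑ j ∈ Finset.range n, ∫ ω, (a j * V j ω) ^ 2 ∂P ≤ ∑ j ∈ Finset.range n, 4 * K ^ 2 :=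
          Finset.sum_le_sum fun j _ => hsqV j
      _ = n * (4 * K ^ 2) := by simp
  -- Three errors of size δ: the truncation, its conditional expectation, and the conditional
  -- expectation of `Z j`.
  have hdiff : ∀ j, ∫ ω, |Z j ω - V j ω| ∂P ≤ 3 * δ := by
    intro j
    have hr : Integrable (fun ω => Z j ω - φ (Z j ω)) P := (hZ j).sub (hφi j)
    have hae : ∀ᵐ ω ∂P, |Z j ω - V j ω| ≤ |Z j ω - φ (Z j ω)|
        + |P[fun ω => Z j ω - φ (Z j ω) | G (j - N)] ω| + |P[Z j | G (j - N)] ω| := by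
      filter_upwards [condExp_sub (hZ j) (hφi j) (G (j - N))] with ω hω
      have hω' : P[fun ω => Z j ω - φ (Z j ω) | G (j - N)] ω
        = P[Z j | G (j - N)] ω - P[fun ω => φ (Z j ω) | G (j - N)] ω := hω
      have : Z j ω - V j ω = (Z j ω - φ (Z j ω))
          + -P[fun ω => Z j ω - φ (Z j ω) | G (j - N)] ω + P[Z j | G (j - N)] ω := by
        rw [hω']; simp only [hVdef]; ring
      rw [this]
      refine (abs_add_three _ _ _).trans ?_
      rw [abs_neg]
    have hc : ∫ ω, |P[fun ω => Z j ω - φ (Z j ω) | G (j - N)] ω| ∂P ≤ δ :=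
      (integral_abs_condExp_le _).trans (h1 j)
    calc ∫ ω, |Z j ω - V j ω| ∂P ≤ ∫ ω, (|Z j ω - φ (Z j ω)|
        + |P[fun ω => Z j ω - φ (Z j ω) | G (j - N)] ω| + |P[Z j | G (j - N)] ω|) ∂P :=
          integral_mono_ae ((hZ j).sub ((hV2 j).integrable one_le_two)).abs
            ((hr.abs.add integrable_condExp.abs).add integrable_condExp.abs) hae
      _ = ∫ ω, |Z j ω - φ (Z j ω)| ∂P
        + ∫ ω, |P[fun ω => Z j ω - φ (Z j ω) | G (j - N)] ω| ∂P
        + ∫ ω, |P[Z j | G (j - N)] ω| ∂P := by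
          rw [← integral_add hr.abs integrable_condExp.abs]
          exact integral_add (hr.abs.add integrable_condExp.abs) integrable_condExp.abs
      _ ≤ 3 * δ := by linarith [h1 j, h2 j]
  have hdi : ∀ j, Integrable (fun ω => |Z j ω - V j ω|) P := fun j =>
    ((hZ j).sub ((hV2 j).integrable one_le_two)).abs
  have hpt : ∀ ω, |∑ j ∈ Finset.range n, a j * Z j ω|
      ≤ ∑ j ∈ Finset.range n, |Z j ω - V j ω| + |∑ j ∈ Finset.range n, a j * V j ω| := fun ω => by
    have : ∑ j ∈ Finset.range n, a j * Z j ω = ∑ j ∈ Finset.range n, a j * (Z j ω - V j ω)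
        + ∑ j ∈ Finset.range n, a j * V j ω := by
      rw [← Finset.sum_add_distrib]; exact Finset.sum_congr rfl fun j _ => by ring
    rw [this]
    refine (abs_add_le _ _).trans (add_le_add_left ((Finset.abs_sum_le_sum_abs _ _).trans
      (Finset.sum_le_sum fun j _ => ?_)) _)
    rw [abs_mul]
    exact mul_le_of_le_one_left (abs_nonneg _) (ha j)
  rcases Nat.eq_zero_or_pos n with rfl | hn
  · simp only [Finset.range_zero, Finset.sum_empty, abs_zero, integral_zero]
    positivity
  have hn' : (0 : ℝ) < n := by exact_mod_cast hn
  calc ∫ ω, |∑ j ∈ Finset.range n, a j * Z j ω| ∂P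
      ≤ ∫ ω, (∑ j ∈ Finset.range n, |Z j ω - V j ω| + |∑ j ∈ Finset.range n, a j * V j ω|) ∂P :=
        integral_mono (integrable_finsetSum _ fun j _ => (hZ j).const_mul _).abs
          ((integrable_finsetSum _ fun j _ => hdi j).add (hsum2.integrable one_le_two).abs) hpt
    _ = ∑ j ∈ Finset.range n, ∫ ω, |Z j ω - V j ω| ∂P
        + ∫ ω, |∑ j ∈ Finset.range n, a j * V j ω| ∂P := by
        rw [integral_add (integrable_finsetSum _ fun j _ => hdi j)
          (hsum2.integrable one_le_two).abs, integral_finsetSum _ fun j _ => hdi j]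
    -- With t = 2 δ n the linear part is δ n and the variance part no longer depends on n.
    _ ≤ n * (3 * δ) + (2 * δ * n / 2 + 2 * (N + d) * (n * (4 * K ^ 2)) / (2 * (2 * δ * n))) := by
        refine add_le_add ?_ (integral_abs_le_of_integral_sq_le hsum2 (by positivity) hvar)
        calc ∑ j ∈ Finset.range n, ∫ ω, |Z j ω - V j ω| ∂P ≤ ∑ j ∈ Finset.range n, 3 * δ :=
            Finset.sum_le_sum fun j _ => hdiff j
          _ = n * (3 * δ) := by simp
    _ = 4 * δ * n + 2 * (N + d) * K ^ 2 / δ := by field_simp; ring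
    _ ≤ _ := by gcongr; norm_num

end Orthogonal
end RowIndep

namespace RowIndep

/-! ### Quadratic forms of bounded, recentred variables. -/

section Quadratic

variable {Ω : Type*} {m0 : MeasurableSpace Ω} {P : Measure Ω} [IsProbabilityMeasure P]
  {G : ℤ → MeasurableSpace Ω}

/-- Second moment of a quadratic form without entries near the diagonal. -/
theorem integral_sq_far_le (hG : Monotone G) (hle : ∀ k, G k ≤ m0) {ζ : ℕ → Ω → ℝ} {m : ℕ}
    {K : ℝ} (hζm : ∀ j : ℕ, StronglyMeasurable[G j] (ζ j)) (hζb : ∀ j, ∀ᵐ ω ∂P, |ζ j ω| ≤ K)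
    (hζ0 : ∀ j : ℕ, P[ζ j | G (j - m)] =ᵐ[P] 0) {n : ℕ} {C : ℕ → ℕ → ℝ}
    (hC : ∀ k < n, ∑ j ∈ Finset.range n, C j k ^ 2 ≤ 1) :
    MemLp (fun ω => ∑ k ∈ Finset.range n, ∑ j ∈ Finset.range n,
      (if j + m ≤ k then C j k * ζ j ω * ζ k ω else 0)) 2 P ∧
    ∫ ω, (∑ k ∈ Finset.range n, ∑ j ∈ Finset.range n,
      (if j + m ≤ k then C j k * ζ j ω * ζ k ω else 0)) ^ 2 ∂P ≤ 4 * m ^ 2 * K ^ 4 * n := by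
  have hbdd : ∀ {f : Ω → ℝ} {g : Ω → ℝ} {a b : ℝ}, (∀ᵐ ω ∂P, |f ω| ≤ a) → (∀ᵐ ω ∂P, |g ω| ≤ b) →
      ∀ᵐ ω ∂P, |f ω * g ω| ≤ a * b := fun hf hg => by
    filter_upwards [hf, hg] with ω h1 h2
    rw [abs_mul]
    exact mul_le_mul h1 h2 (abs_nonneg _) ((abs_nonneg _).trans h1)
  have hζ2 : ∀ j, MemLp (ζ j) 2 P := fun j =>
    MemLp.of_bound ((hζm j).mono (hle _)).aestronglyMeasurable K (hζb j)
  have hζsq : ∀ j, ∫ ω, ζ j ω ^ 2 ∂P ≤ K ^ 2 := fun j => by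
    have : ∀ᵐ ω ∂P, ζ j ω ^ 2 ≤ K ^ 2 := by
      filter_upwards [hζb j] with ω hω
      exact sq_le_sq' (abs_le.1 hω).1 (abs_le.1 hω).2
    calc ∫ ω, ζ j ω ^ 2 ∂P ≤ ∫ _, K ^ 2 ∂P :=
          integral_mono_ae (hζ2 j).integrable_sq (integrable_const _) this
      _ = K ^ 2 := by simp
  set c : ℕ → ℕ → ℝ := fun j k => if j + m ≤ k then C j k else 0 with hc
  -- `W k` involves only indices up to k - m, so it is known at the time given which `ζ k` is
  -- centred. The form becomes a sum of products ζ_k W_k.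
  set W : ℕ → Ω → ℝ := fun k ω => ∑ j ∈ Finset.range n, c j k * ζ j ω with hW
  have hcC : ∀ j k, c j k ^ 2 ≤ C j k ^ 2 := fun j k => by
    simp only [hc]; split_ifs
    · exact le_rfl
    · simpa using sq_nonneg _
  have hWm : ∀ k : ℕ, StronglyMeasurable[G (k - m)] (W k) := fun k => by
    refine Finset.stronglyMeasurable_fun_sum _ fun j _ => ?_
    by_cases h : j + m ≤ k
    · exact ((hζm j).mono (hG (by omega))).const_mul _
    · simp only [hc, if_neg h, zero_mul]
      exact stronglyMeasurable_const
  have hWb : ∀ k, ∀ᵐ ω ∂P, |W k ω| ≤ ∑ j ∈ Finset.range n, |c j k| * K := fun k => by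
    filter_upwards [ae_all_iff.2 hζb] with ω hω
    refine (Finset.abs_sum_le_sum_abs _ _).trans (Finset.sum_le_sum fun j _ => ?_)
    rw [abs_mul]
    exact mul_le_mul_of_nonneg_left (hω j) (abs_nonneg _)
  have hW2 : ∀ k, MemLp (W k) 2 P := fun k =>
    MemLp.of_bound ((hWm k).mono (hle _)).aestronglyMeasurable _ (hWb k)
  have hV2 : ∀ k, MemLp (fun ω => ζ k ω * W k ω) 2 P := fun k =>
    MemLp.of_bound (((hζm k).mono (hle _)).mul ((hWm k).mono (hle _))).aestronglyMeasurable _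
      (hbdd (hζb k) (hWb k))
  have hWsq : ∀ k < n, ∫ ω, W k ω ^ 2 ∂P ≤ 2 * m * K ^ 2 := fun k hk => by
    refine (integral_sq_sum_le_of_orthogonal (V := fun j ω => c j k * ζ j ω) (m := m)
      (fun j => (hζ2 j).const_mul _) (fun i j hij => ?_) n).trans ?_
    · have h := integral_mul_eq_zero_of_condExp (hle (j - m)) ((hζ2 j).integrable one_le_two)
        (hζ0 j) ((hζm i).mono (hG (by omega))) (hζb i)
      calc ∫ ω, (c i k * ζ i ω) * (c j k * ζ j ω) ∂P
          = ∫ ω, c i k * c j k * (ζ j ω * ζ i ω) ∂P := by congr 1; ext ω; ring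
        _ = 0 := by rw [integral_const_mul, h, mul_zero]
    · gcongr
      calc ∑ j ∈ Finset.range n, ∫ ω, (c j k * ζ j ω) ^ 2 ∂P
          ≤ ∑ j ∈ Finset.range n, C j k ^ 2 * K ^ 2 := by
            refine Finset.sum_le_sum fun j _ => ?_
            simp only [mul_pow]
            rw [integral_const_mul]
            exact mul_le_mul (hcC j k) (hζsq j) (integral_nonneg fun ω => sq_nonneg _)
              (sq_nonneg _)
        _ ≤ K ^ 2 := by
            rw [← Finset.sum_mul]
            exact mul_le_of_le_one_left (sq_nonneg _) (hC k hk)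
  have hVsq : ∀ k < n, ∫ ω, (ζ k ω * W k ω) ^ 2 ∂P ≤ K ^ 2 * (2 * m * K ^ 2) := fun k hk => by
    have : ∀ᵐ ω ∂P, (ζ k ω * W k ω) ^ 2 ≤ K ^ 2 * W k ω ^ 2 := by
      filter_upwards [hζb k] with ω hω
      rw [mul_pow]
      exact mul_le_mul_of_nonneg_right (sq_le_sq' (abs_le.1 hω).1 (abs_le.1 hω).2) (sq_nonneg _)
    calc ∫ ω, (ζ k ω * W k ω) ^ 2 ∂P ≤ ∫ ω, K ^ 2 * W k ω ^ 2 ∂P :=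
          integral_mono_ae (hV2 k).integrable_sq ((hW2 k).integrable_sq.const_mul _) this
      _ ≤ K ^ 2 * (2 * m * K ^ 2) := by
          rw [integral_const_mul]
          exact mul_le_mul_of_nonneg_left (hWsq k hk) (sq_nonneg _)
  have hsum : ∀ ω, ∑ k ∈ Finset.range n, ∑ j ∈ Finset.range n,
      (if j + m ≤ k then C j k * ζ j ω * ζ k ω else 0)
      = ∑ k ∈ Finset.range n, ζ k ω * W k ω := fun ω => by
    refine Finset.sum_congr rfl fun k _ => ?_
    rw [hW, Finset.mul_sum]
    refine Finset.sum_congr rfl fun j _ => ?_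
    simp only [hc]
    split_ifs
    · ring
    · simp
  simp only [hsum]
  refine ⟨memLp_finsetSum _ fun k _ => hV2 k, ?_⟩
  refine (integral_sq_sum_le_of_orthogonal (m := m) hV2 (fun i j hij => ?_) n).trans ?_
  -- For i + m ≤ j, all factors other than ζ_j are measurable at time j - m, so the products are
  -- orthogonal at distance `m`. Orthogonality is thus used twice, inside `W` and here, whence the
  -- factor m².
  · have h := integral_mul_eq_zero_of_condExp (hle (j - m)) ((hζ2 j).integrable one_le_two)
      (hζ0 j) (H := fun ω => W j ω * (ζ i ω * W i ω))
      ((hWm j).mul (((hζm i).mono (hG (by omega))).mul ((hWm i).mono (hG (by omega)))))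
      (hbdd (hWb j) (hbdd (hζb i) (hWb i)))
    rw [← h]
    congr 1
    ext ω
    ring
  · calc 2 * (m : ℝ) * ∑ k ∈ Finset.range n, ∫ ω, (ζ k ω * W k ω) ^ 2 ∂P
        ≤ 2 * m * ∑ k ∈ Finset.range n, K ^ 2 * (2 * m * K ^ 2) := by
          gcongr with k hk
          exact hVsq k (Finset.mem_range.1 hk)
      _ = 4 * m ^ 2 * K ^ 4 * n := by
          rw [Finset.sum_const, Finset.card_range, nsmul_eq_mul]; ring

/-- First moment of a quadratic form with small entries near the diagonal. -/
theorem integral_abs_offdiag_le (hG : Monotone G) (hle : ∀ k, G k ≤ m0) {ζ : ℕ → Ω → ℝ} {m : ℕ}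
    (hm : 0 < m) {K : ℝ} (hζm : ∀ j : ℕ, StronglyMeasurable[G j] (ζ j))
    (hζb : ∀ j, ∀ᵐ ω ∂P, |ζ j ω| ≤ K)
    (hζ0 : ∀ j : ℕ, P[ζ j | G (j - m)] =ᵐ[P] 0) {n : ℕ} {C : ℕ → ℕ → ℝ} {r δ : ℝ} (hr : 0 ≤ r)
    (hδ : 0 < δ)
    (hC1 : ∀ k < n, ∑ j ∈ Finset.range n, C j k ^ 2 ≤ 1)
    (hC2 : ∀ j < n, ∑ k ∈ Finset.range n, C j k ^ 2 ≤ 1)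
    (hC : ∀ j < n, ∀ k < n, j < k + m → k < j + m → |C j k| ≤ r) :
    ∫ ω, |∑ j ∈ Finset.range n, ∑ k ∈ Finset.range n, C j k * ζ j ω * ζ k ω| ∂P
      ≤ δ * n + 4 * m ^ 2 * K ^ 4 / δ + 2 * m * r * K ^ 2 * n := by
  obtain ⟨hf1, hv1⟩ := integral_sq_far_le hG hle hζm hζb hζ0 hC1
  -- The part far below the diagonal is the part far above it for the transposed coefficients.
  obtain ⟨hf2, hv2⟩ := integral_sq_far_le hG hle hζm hζb hζ0 (C := fun j k => C k j) hC2
  set F1 : Ω → ℝ := fun ω => ∑ k ∈ Finset.range n, ∑ j ∈ Finset.range n,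
      (if j + m ≤ k then C j k * ζ j ω * ζ k ω else 0) with hF1
  set F2 : Ω → ℝ := fun ω => ∑ k ∈ Finset.range n, ∑ j ∈ Finset.range n,
      (if j + m ≤ k then C k j * ζ j ω * ζ k ω else 0) with hF2
  rcases Nat.eq_zero_or_pos n with rfl | hn
  · simp only [Finset.range_zero, Finset.sum_empty, abs_zero, integral_zero]
    positivity
  have hn' : (0 : ℝ) < n := by exact_mod_cast hn
  have hpt : ∀ᵐ ω ∂P, |∑ j ∈ Finset.range n, ∑ k ∈ Finset.range n, C j k * ζ j ω * ζ k ω|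
      ≤ |F1 ω| + |F2 ω| + 2 * m * r * K ^ 2 * n := by
    filter_upwards [ae_all_iff.2 hζb] with ω hω
    have hK : 0 ≤ K := (abs_nonneg _).trans (hω 0)
    have hsplit : ∑ j ∈ Finset.range n, ∑ k ∈ Finset.range n, C j k * ζ j ω * ζ k ω
        = F1 ω + F2 ω + ∑ j ∈ Finset.range n, ∑ k ∈ Finset.range n,
          (if j < k + m ∧ k < j + m then C j k * ζ j ω * ζ k ω else 0) := by
      simp only [hF1, hF2]
      rw [Finset.sum_comm (f := fun k j => if j + m ≤ k then C j k * ζ j ω * ζ k ω else 0),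
        ← Finset.sum_add_distrib, ← Finset.sum_add_distrib]
      refine Finset.sum_congr rfl fun j _ => ?_
      rw [← Finset.sum_add_distrib, ← Finset.sum_add_distrib]
      refine Finset.sum_congr rfl fun k _ => ?_
      by_cases h1 : j + m ≤ k
      · rw [if_pos h1, if_neg (by omega), if_neg (by omega)]; ring
      · by_cases h2 : k + m ≤ j
        · rw [if_neg h1, if_pos h2, if_neg (by omega)]; ring
        · rw [if_neg h1, if_neg h2, if_pos (by omega)]; ring
    rw [hsplit]
    refine (abs_add_three _ _ _).trans (add_le_add_right ?_ _)
    calc |∑ j ∈ Finset.range n, ∑ k ∈ Finset.range n,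
          (if j < k + m ∧ k < j + m then C j k * ζ j ω * ζ k ω else 0)|
        ≤ ∑ j ∈ Finset.range n, ∑ k ∈ Finset.range n,
          |if j < k + m ∧ k < j + m then C j k * ζ j ω * ζ k ω else 0| :=
          (Finset.abs_sum_le_sum_abs _ _).trans
            (Finset.sum_le_sum fun j _ => Finset.abs_sum_le_sum_abs _ _)
      _ ≤ ∑ j ∈ Finset.range n, ∑ k ∈ Finset.range n,
          (r * K ^ 2) * (if j < k + m ∧ k < j + m then 1 else 0) := by
          refine Finset.sum_le_sum fun j hj => Finset.sum_le_sum fun k hk => ?_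
          split_ifs with h
          · rw [abs_mul, abs_mul, mul_one, sq, ← mul_assoc]
            have := hC j (Finset.mem_range.1 hj) k (Finset.mem_range.1 hk) h.1 h.2
            gcongr
            · exact hω j
            · exact hω k
          · simp
      _ ≤ ∑ j ∈ Finset.range n, (r * K ^ 2) * (2 * m) := by
          refine Finset.sum_le_sum fun j _ => ?_
          rw [← Finset.mul_sum]
          refine mul_le_mul_of_nonneg_left ?_ (by positivity)
          rw [Finset.sum_boole]
          have hsub : (Finset.range n).filter (fun k => j < k + m ∧ k < j + m)
              ⊆ Finset.Ico (j + 1 - m) (j + m) := fun k hk => by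
            simp only [Finset.mem_filter, Finset.mem_Ico] at hk ⊢
            omega
          have := Finset.card_le_card hsub
          rw [Nat.card_Ico] at this
          exact_mod_cast this.trans (by omega)
      _ = 2 * m * r * K ^ 2 * n := by
          rw [Finset.sum_const, Finset.card_range, nsmul_eq_mul]; ring
  have h1 := integral_abs_le_of_integral_sq_le hf1 (t := δ * n) (by positivity) hv1
  have h2 := integral_abs_le_of_integral_sq_le hf2 (t := δ * n) (by positivity) hv2
  have i1 := (hf1.integrable one_le_two).abs
  have i2 := (hf2.integrable one_le_two).abs
  calc ∫ ω, |∑ j ∈ Finset.range n, ∑ k ∈ Finset.range n, C j k * ζ j ω * ζ k ω| ∂P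
      ≤ ∫ ω, (|F1 ω| + |F2 ω| + 2 * m * r * K ^ 2 * n) ∂P :=
        integral_mono_of_nonneg (ae_of_all _ fun ω => abs_nonneg _)
          ((i1.add i2).add (integrable_const _)) hpt
    _ = ∫ ω, |F1 ω| ∂P + ∫ ω, |F2 ω| ∂P + 2 * m * r * K ^ 2 * n := by
        rw [← integral_add i1 i2]
        refine (integral_add (i1.add i2) (integrable_const _)).trans ?_
        rw [integral_const]; simp
    _ ≤ (δ * n / 2 + 4 * m ^ 2 * K ^ 4 * n / (2 * (δ * n)))
        + (δ * n / 2 + 4 * m ^ 2 * K ^ 4 * n / (2 * (δ * n))) + 2 * m * r * K ^ 2 * n := by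
        gcongr
    _ = δ * n + 4 * m ^ 2 * K ^ 4 / δ + 2 * m * r * K ^ 2 * n := by
        field_simp; ring

end Quadratic
end RowIndep

/-! ### Weak law for band matrices and the bounded approximation. -/

namespace RowIndep

/-- Summation of a band matrix along its diagonals. -/
theorem sum_band_eq_sum_diag {n L : ℕ} {f : ℕ → ℕ → ℝ}
    (hf : ∀ j k, j + L ≤ k ∨ k + L ≤ j → f j k = 0) :
    ∑ j ∈ Finset.range n, ∑ k ∈ Finset.range n, f j k
      = ∑ d ∈ Finset.range L, (∑ j ∈ Finset.range n, (if j + d < n then f j (j + d) else 0)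
        + ∑ j ∈ Finset.range n, (if j + d < n ∧ 0 < d then f (j + d) j else 0)) := by
  have e1 : ∀ d, ∑ j ∈ Finset.range n, (if j + d < n then f j (j + d) else 0)
      = ∑ j ∈ Finset.range n, ∑ k ∈ Finset.range n, (if d + j = k then f j k else 0) :=
    fun d => Finset.sum_congr rfl fun j _ => by simp [Finset.sum_ite_eq, add_comm]
  -- The condition `0 < d` prevents the main diagonal from being counted twice.
  have e2 : ∀ d, ∑ j ∈ Finset.range n, (if j + d < n ∧ 0 < d then f (j + d) j else 0)
      = ∑ j ∈ Finset.range n, ∑ k ∈ Finset.range n, (if d + k = j ∧ 0 < d then f j k else 0) := by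
    intro d
    rw [Finset.sum_comm]
    refine Finset.sum_congr rfl fun j _ => ?_
    by_cases hd : 0 < d
    · simp [hd, Finset.sum_ite_eq, add_comm]
    · simp [hd]
  simp only [e1, e2, ← Finset.sum_add_distrib]
  rw [Finset.sum_comm (s := Finset.range L)]
  refine Finset.sum_congr rfl fun j _ => ?_
  rw [Finset.sum_comm (s := Finset.range L)]
  refine Finset.sum_congr rfl fun k _ => ?_
  by_cases h : j + L ≤ k ∨ k + L ≤ j
  · rw [hf j k h]; simp
  · rw [Finset.sum_eq_single_of_mem (if j ≤ k then k - j else j - k)]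
    · split_ifs <;> first | omega | simp
    · rw [Finset.mem_range]; split_ifs <;> omega
    · intro d _ hd
      rw [if_neg, if_neg, add_zero]
      · rintro ⟨h1, h2⟩; apply hd; split_ifs <;> omega
      · intro h1; apply hd; split_ifs <;> omega

namespace IsRegularSeq

variable {Ω : Type*} [MeasurableSpace Ω] {ξ : ℤ → Ω → ℝ} {P : Measure Ω} [IsProbabilityMeasure P]

/-- Weak law of large numbers for weighted sums of products at a fixed lag. -/
theorem exists_integral_abs_weighted_sum_le (hξ : IsRegularSeq ξ P) (d : ℕ) {ε : ℝ} (hε : 0 < ε) :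
    ∃ C : ℝ, ∀ (n : ℕ) (a : ℕ → ℝ), (∀ j, |a j| ≤ 1) →
      ∫ ω, |∑ j ∈ Finset.range n, a j * (ξ j ω * ξ ((j + d : ℕ) : ℤ) ω
        - ∫ ω, ξ j ω * ξ ((j + d : ℕ) : ℤ) ω ∂P)| ∂P ≤ ε * n + C := by
  set c := ∫ ω, ξ 0 ω * ξ (d : ℤ) ω ∂P with hc
  have hcj : ∀ j : ℕ, ∫ ω, ξ j ω * ξ ((j + d : ℕ) : ℤ) ω ∂P = c := fun j => by
    rw [Nat.cast_add]; exact (hξ.identDistrib_mul j d).integral_eq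
  simp only [hcj]
  set Z : ℕ → Ω → ℝ := fun j ω => ξ j ω * ξ ((j + d : ℕ) : ℤ) ω - c with hZ
  have hZ0 : ∀ j, IdentDistrib (Z j) (Z 0) P P := fun j => by
    have := (hξ.identDistrib_mul j d).comp (u := fun x => x - c) (by fun_prop)
    simpa [hZ, Function.comp_def] using this
  have hZm : ∀ j : ℕ, Measurable[pastSigma ξ (j + d)] (Z j) := fun j =>
    ((measurable_pastSigma ξ (by omega)).mul
      (measurable_pastSigma ξ (by push_cast; omega))).sub_const c
  have hZi : ∀ j, Integrable (Z j) P := fun j =>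
    (hξ.integrable_mul _ _).sub (integrable_const _)
  obtain ⟨φ, K, hφ, hK, hφK, hφε⟩ := exists_bounded_comp_approx
    ((hZm 0).mono (pastSigma_le hξ.measurable _) le_rfl)
    (memLp_one_iff_integrable.2 (hZi 0)) (by positivity : 0 < ε / 4)
  have hN := hξ.tendsto_condExp_one d
  rw [ENNReal.tendsto_nhds_zero] at hN
  obtain ⟨N, hN⟩ := (hN (ENNReal.ofReal (ε / 4)) (by simpa using hε)).exists
  -- The truncation level `K` and the horizon `N` depend on `d` and ε only, so the constant is
  -- uniform in `n` and in the weights.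
  refine ⟨4 * (N + d) * K ^ 2 / (ε / 4), fun n a ha => ?_⟩
  have h := integral_abs_weighted_sum_le (P := P) (G := pastSigma ξ)
    (fun _ _ h => pastSigma_mono ξ h) (pastSigma_le hξ.measurable) (Z := Z) (d := d) (N := N)
    (K := K) (δ := ε / 4) (φ := φ) (by positivity) hφ hφK hZm hZi ?_ ?_ n a ha
  · convert h using 2
    ring
  · intro j
    have e := ((hZ0 j).comp (u := fun x => |x - φ x|)
      ((measurable_id.sub hφ).abs)).integral_eq
    refine le_of_eq_of_le e ?_
    exact integral_abs_le_of_eLpNorm_one_le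
      ((hZi 0).1.sub (hφ.comp_aemeasurable (hZi 0).1.aemeasurable).aestronglyMeasurable)
      (by positivity) hφε
  · intro j
    refine integral_abs_le_of_eLpNorm_one_le integrable_condExp.1 (by positivity) ?_
    refine le_of_eq_of_le ?_ hN
    rw [← eLpNorm_condExp_past_eq hξ.measurable hξ.stationary hξ.measurable
      (by simpa using hξ.stationary 0) (h := fun x => x 0 * x d) (by fun_prop)
      (hξ.integrable_mul 0 d) j N c 1]
    refine eLpNorm_congr_ae ?_
    have hd : (fun ω => ξ (0 + j) ω * ξ (d + j) ω) = fun ω => ξ j ω * ξ ((j + d : ℕ) : ℤ) ω := by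
      ext ω; push_cast; rw [zero_add, add_comm (d : ℤ)]
    rw [hd]
    have h1 := condExp_sub (hξ.integrable_mul j ((j + d : ℕ) : ℤ)) (integrable_const c)
      (pastSigma ξ (j - N))
    filter_upwards [h1] with ω hω
    have h2 : P[Z j | pastSigma ξ (j - N)] ω = _ := hω
    rw [h2, Pi.sub_apply, condExp_const (pastSigma_le hξ.measurable _)]

/-- Quadratic forms with band matrices concentrate. -/
theorem exists_integral_abs_band_le (hξ : IsRegularSeq ξ P) (L : ℕ) {ε : ℝ} (hε : 0 < ε) :
    ∃ C : ℝ, ∀ (n : ℕ) (b : ℕ → ℕ → ℝ), (∀ j < n, ∀ k < n, |b j k| ≤ 1) →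
      (∀ j k, j + L ≤ k ∨ k + L ≤ j → b j k = 0) →
      ∫ ω, |∑ j ∈ Finset.range n, ∑ k ∈ Finset.range n, b j k * (ξ j ω * ξ k ω
        - ∫ ω, ξ j ω * ξ k ω ∂P)| ∂P ≤ ε * n + C := by
  -- The 2L diagonal sums share the budget ε; the extra 1 covers `L = 0`.
  have hε' : 0 < ε / (2 * L + 1) := by positivity
  choose C hC using fun d => hξ.exists_integral_abs_weighted_sum_le d hε'
  refine ⟨∑ d ∈ Finset.range L, 2 * C d, fun n b hb hb0 => ?_⟩
  set Z : ℕ → ℕ → Ω → ℝ := fun j k ω => ξ j ω * ξ k ω - ∫ ω, ξ j ω * ξ k ω ∂P with hZ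
  have hZi : ∀ j k, Integrable (Z j k) P := fun j k =>
    (hξ.integrable_mul _ _).sub (integrable_const _)
  have hZs : ∀ j k, Z j k = Z k j := fun j k => by
    ext ω; simp only [hZ, mul_comm (ξ (k : ℤ) _)]
  set a1 : ℕ → ℕ → ℝ := fun d j => if j + d < n then b j (j + d) else 0 with ha1
  set a2 : ℕ → ℕ → ℝ := fun d j => if j + d < n ∧ 0 < d then b (j + d) j else 0 with ha2
  have h1 : ∀ d j, |a1 d j| ≤ 1 := fun d j => by
    simp only [ha1]; split_ifs with h
    · exact hb _ (by omega) _ h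
    · simp
  have h2 : ∀ d j, |a2 d j| ≤ 1 := fun d j => by
    simp only [ha2]; split_ifs with h
    · exact hb _ h.1 _ (by omega)
    · simp
  have hi : ∀ (a : ℕ → ℝ) (d : ℕ),
      Integrable (fun ω => |∑ j ∈ Finset.range n, a j * Z j (j + d) ω|) P := fun a d =>
    (integrable_finsetSum _ fun j _ => (hZi _ _).const_mul _).abs
  have hpt : ∀ ω, |∑ j ∈ Finset.range n, ∑ k ∈ Finset.range n, b j k * Z j k ω|
      ≤ ∑ d ∈ Finset.range L, (|∑ j ∈ Finset.range n, a1 d j * Z j (j + d) ω|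
        + |∑ j ∈ Finset.range n, a2 d j * Z j (j + d) ω|) := fun ω => by
    rw [sum_band_eq_sum_diag (L := L) (fun j k h => by rw [hb0 j k h, zero_mul])]
    refine (Finset.abs_sum_le_sum_abs _ _).trans (Finset.sum_le_sum fun d _ => ?_)
    refine (abs_add_le _ _).trans (le_of_eq ?_)
    congr 2
    · refine Finset.sum_congr rfl fun j _ => ?_
      simp only [ha1]; split_ifs <;> simp
    · refine Finset.sum_congr rfl fun j _ => ?_
      rw [hZs (j + d) j]
      simp only [ha2]; split_ifs <;> simp
  calc ∫ ω, |∑ j ∈ Finset.range n, ∑ k ∈ Finset.range n, b j k * Z j k ω| ∂P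
      ≤ ∫ ω, ∑ d ∈ Finset.range L, (|∑ j ∈ Finset.range n, a1 d j * Z j (j + d) ω|
        + |∑ j ∈ Finset.range n, a2 d j * Z j (j + d) ω|) ∂P :=
        integral_mono_of_nonneg (ae_of_all _ fun ω => abs_nonneg _)
          (integrable_finsetSum _ fun d _ => (hi _ d).add (hi _ d)) (ae_of_all _ hpt)
    _ = ∑ d ∈ Finset.range L, (∫ ω, |∑ j ∈ Finset.range n, a1 d j * Z j (j + d) ω| ∂P
        + ∫ ω, |∑ j ∈ Finset.range n, a2 d j * Z j (j + d) ω| ∂P) := by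
        refine (integral_finsetSum _ fun d _ => (hi (a1 d) d).add (hi (a2 d) d)).trans ?_
        exact Finset.sum_congr rfl fun d _ => integral_add (hi _ d) (hi _ d)
    _ ≤ ∑ d ∈ Finset.range L, ((ε / (2 * L + 1) * n + C d) + (ε / (2 * L + 1) * n + C d)) :=
        Finset.sum_le_sum fun d _ => add_le_add (hC d n _ (h1 d)) (hC d n _ (h2 d))
    _ = ε * (2 * L / (2 * L + 1)) * n + ∑ d ∈ Finset.range L, 2 * C d := by
        have : ∀ d, (ε / (2 * L + 1) * n + C d) + (ε / (2 * L + 1) * n + C d)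
          = 2 * (ε / (2 * L + 1) * n) + 2 * C d := fun d => by ring
        simp only [this, Finset.sum_add_distrib, Finset.sum_const, Finset.card_range, nsmul_eq_mul]
        ring
    _ ≤ _ := by
        gcongr
        refine mul_le_of_le_one_right hε.le (div_le_one_of_le₀ (by linarith) (by positivity))

/-- Bounded `m`-step recentred approximation of a regular sequence. -/
theorem exists_bounded_approx (hξ : IsRegularSeq ξ P) {δ : ℝ} (hδ : 0 < δ) :
    ∃ (ζ : ℕ → Ω → ℝ) (m : ℕ) (K : ℝ), 0 < m ∧
      (∀ j : ℕ, StronglyMeasurable[pastSigma ξ j] (ζ j)) ∧ (∀ j, ∀ᵐ ω ∂P, |ζ j ω| ≤ K) ∧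
      (∀ j : ℕ, P[ζ j | pastSigma ξ (j - m)] =ᵐ[P] 0) ∧
      ∀ j : ℕ, ∫ ω, (ξ j ω - ζ j ω) ^ 2 ∂P ≤ (3 * δ) ^ 2 := by
  obtain ⟨φ, K, hφ, hK, hφK, hφδ⟩ := exists_bounded_comp_approx (hξ.measurable 0) (hξ.memLp 0) hδ
  have hm := hξ.tendsto_condExp_two
  rw [ENNReal.tendsto_nhds_zero] at hm
  obtain ⟨m, hm, hm0⟩ := ((hm (ENNReal.ofReal δ) (by simpa using hδ)).and
    (eventually_gt_atTop 0)).exists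
  have hle := pastSigma_le hξ.measurable
  have hφm : ∀ j : ℕ, StronglyMeasurable[pastSigma ξ j] fun ω => φ (ξ j ω) := fun j =>
    (hφ.comp (measurable_pastSigma ξ le_rfl)).stronglyMeasurable
  have hφi : ∀ j : ℕ, MemLp (fun ω => φ (ξ j ω)) 2 P := fun j =>
    MemLp.of_bound ((hφm j).mono (hle _)).aestronglyMeasurable K (ae_of_all _ fun ω => hφK _)
  have hφi1 : ∀ j : ℕ, Integrable (fun ω => φ (ξ j ω)) P := fun j =>
    (hφi j).integrable one_le_two
  -- The error 3δ collects the truncation, its conditional expectation, and E(ξ_j | 𝒢_{j-m}), which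
  -- is small by the choice of `m`.
  refine ⟨fun j ω => φ (ξ j ω) - P[fun ω => φ (ξ j ω) | pastSigma ξ (j - m)] ω, m, 2 * K, hm0,
    fun j => (hφm j).sub (stronglyMeasurable_condExp.mono (pastSigma_mono ξ (by omega))),
    fun j => ae_abs_sub_condExp_le fun ω => hφK _,
    fun j => condExp_sub_condExp_eq_zero (hle _) (hφi1 j), fun j => ?_⟩
  have hr : MemLp (fun ω => ξ j ω - φ (ξ j ω)) 2 P := (hξ.memLp j).sub (hφi j)
  have hae : (fun ω => ξ j ω - (φ (ξ j ω) - P[fun ω => φ (ξ j ω) | pastSigma ξ (j - m)] ω))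
      =ᵐ[P] (fun ω => ξ j ω - φ (ξ j ω)) - P[fun ω => ξ j ω - φ (ξ j ω) | pastSigma ξ (j - m)]
        + P[ξ j | pastSigma ξ (j - m)] := by
    filter_upwards [condExp_sub ((hξ.memLp j).integrable one_le_two) (hφi1 j)
      (pastSigma ξ (j - m))] with ω hω
    have hω' : P[fun ω => ξ j ω - φ (ξ j ω) | pastSigma ξ (j - m)] ω
        = P[ξ j | pastSigma ξ (j - m)] ω - P[fun ω => φ (ξ j ω) | pastSigma ξ (j - m)] ω := hω
    simp only [Pi.add_apply, Pi.sub_apply, hω']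
    ring
  have hc : ∀ f : Ω → ℝ, MemLp f 2 P → MemLp P[f | pastSigma ξ (j - m)] 2 P := fun f hf =>
    hf.condExp one_le_two
  have hmem := (hr.sub (hc _ hr)).add (hc _ (hξ.memLp j))
  have hn1 : eLpNorm (fun ω => ξ j ω - φ (ξ j ω)) 2 P ≤ ENNReal.ofReal δ :=
    le_of_eq_of_le (((hξ.identDistrib_zero j).comp (u := fun x => x - φ x)
      (measurable_id.sub hφ)).eLpNorm_eq 2) hφδ
  have hn2 : eLpNorm P[ξ j | pastSigma ξ (j - m)] 2 P ≤ ENNReal.ofReal δ := by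
    have := eLpNorm_condExp_past_eq hξ.measurable hξ.stationary hξ.measurable
      (by simpa using hξ.stationary 0) (h := fun x => x 0) (by fun_prop)
      ((hξ.memLp 0).integrable one_le_two) j m 0 2
    simp only [sub_zero, zero_add] at this
    exact this.le.trans hm
  refine integral_sq_le_of_eLpNorm_two_le ((memLp_congr_ae hae).2 hmem) (by positivity) ?_
  rw [eLpNorm_congr_ae hae]
  refine (eLpNorm_add_le (hr.sub (hc _ hr)).1 (hc _ (hξ.memLp j)).1 one_le_two).trans
    ((add_le_add ((eLpNorm_sub_le hr.1 (hc _ hr).1 one_le_two).trans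
      (add_le_add hn1 ((eLpNorm_condExp_le_eLpNorm _ one_le_two).trans hn1))) hn2).trans
      (le_of_eq ?_))
  rw [← ENNReal.ofReal_add hδ.le hδ.le, ← ENNReal.ofReal_add (by positivity) hδ.le]
  congr 1
  ring

end IsRegularSeq
end RowIndep

/-! ### Concentration of quadratic forms of a regular sequence. -/

namespace RowIndep

/-- C(x,x) - C(z,z) = C(x-z,x) + C(z,x-z); in each term the weight δ⁻¹ goes to the difference and δ
to the other vector. The absence of 1/2 in the hypothesis allows forms of norm 2. -/
theorem quad_diff_le {n : ℕ} {C : ℕ → ℕ → ℝ} (hC : ∀ t : ℝ, 0 < t → ∀ x y : ℕ → ℝ,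
      |∑ j ∈ Finset.range n, ∑ k ∈ Finset.range n, C j k * x j * y k|
        ≤ t * ∑ j ∈ Finset.range n, x j ^ 2 + t⁻¹ * ∑ k ∈ Finset.range n, y k ^ 2)
    {δ : ℝ} (hδ : 0 < δ) (x z : ℕ → ℝ) :
    |∑ j ∈ Finset.range n, ∑ k ∈ Finset.range n, C j k * x j * x k
      - ∑ j ∈ Finset.range n, ∑ k ∈ Finset.range n, C j k * z j * z k|
      ≤ ∑ j ∈ Finset.range n, ((2 * δ⁻¹ + 2 * δ) * (x j - z j) ^ 2 + 3 * δ * x j ^ 2) := by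
  have e : ∑ j ∈ Finset.range n, ∑ k ∈ Finset.range n, C j k * x j * x k
      - ∑ j ∈ Finset.range n, ∑ k ∈ Finset.range n, C j k * z j * z k
      = ∑ j ∈ Finset.range n, ∑ k ∈ Finset.range n, C j k * (x j - z j) * x k
        + ∑ j ∈ Finset.range n, ∑ k ∈ Finset.range n, C j k * z j * (x k - z k) := by
    simp only [← Finset.sum_add_distrib, ← Finset.sum_sub_distrib]
    exact Finset.sum_congr rfl fun j _ => Finset.sum_congr rfl fun k _ => by ring
  have h1 := hC δ⁻¹ (by positivity) (fun j => x j - z j) x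
  have h2 := hC δ hδ z (fun j => x j - z j)
  rw [inv_inv] at h1
  have h3 : ∑ j ∈ Finset.range n, z j ^ 2
      ≤ ∑ j ∈ Finset.range n, (2 * x j ^ 2 + 2 * (x j - z j) ^ 2) :=
    Finset.sum_le_sum fun j _ => by nlinarith [sq_nonneg (2 * x j - z j)]
  rw [Finset.sum_add_distrib, ← Finset.mul_sum, ← Finset.mul_sum] at h3
  rw [e, Finset.sum_add_distrib, ← Finset.mul_sum, ← Finset.mul_sum]
  refine (abs_add_le _ _).trans ((add_le_add h1 h2).trans ?_)
  have h4 := mul_le_mul_of_nonneg_left h3 hδ.le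
  linarith

namespace IsRegularSeq

variable {Ω : Type*} [MeasurableSpace Ω] {ξ : ℤ → Ω → ℝ} {P : Measure Ω}

theorem integral_sq_eq (hξ : IsRegularSeq ξ P) (j : ℤ) :
    ∫ ω, ξ j ω ^ 2 ∂P = ∫ ω, ξ 0 ω ^ 2 ∂P :=
  ((hξ.identDistrib_zero j).comp (u := fun x => x ^ 2) (by fun_prop)).integral_eq

variable [IsProbabilityMeasure P]

/-- Quadratic forms with bounded matrices of a regular sequence concentrate around their mean. -/
theorem exists_integral_abs_quad_le (hξ : IsRegularSeq ξ P) {ε : ℝ} (hε : 0 < ε) :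
    ∃ C : ℝ, ∀ (n : ℕ) (B : ℕ → ℕ → ℝ), BilinBound n B →
      ∫ ω, |∑ j ∈ Finset.range n, ∑ k ∈ Finset.range n, B j k * (ξ j ω * ξ k ω
        - ∫ ω, ξ j ω * ξ k ω ∂P)| ∂P ≤ ε * n + C := by
  set σ := ∫ ω, ξ 0 ω ^ 2 ∂P with hσ
  have hσ0 : 0 ≤ σ := integral_nonneg fun ω => sq_nonneg _
  -- 77 + 6σ = 1 + 2(38 + 3σ): one δ for the band part, and the cost 38 + 3σ of the remainder
  -- counted for the form and again for its mean.
  obtain ⟨δ, hδ, hδ1, hδε⟩ : ∃ δ : ℝ, 0 < δ ∧ δ ≤ 1 ∧ δ * (77 + 6 * σ) ≤ ε := by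
    refine ⟨min 1 (ε / (77 + 6 * σ)), lt_min one_pos (by positivity), min_le_left _ _, ?_⟩
    rw [← le_div_iff₀ (by positivity)]
    exact min_le_right _ _
  obtain ⟨ζ, m, K, hm, hζm, hζb, hζ0, hξζ⟩ := hξ.exists_bounded_approx hδ
  -- The window is chosen after `m` and `K`, long enough for the near-diagonal entries of the
  -- remainder, of size m / L, to be harmless.
  obtain ⟨L, hL0, hL⟩ : ∃ L : ℕ, 0 < L ∧ 2 * m * (m / L) * K ^ 2 ≤ δ := by
    obtain ⟨L, hL⟩ := exists_nat_gt (2 * m * m * K ^ 2 / δ)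
    have hL0 : (0 : ℝ) < L := lt_of_le_of_lt (by positivity) hL
    refine ⟨L, by exact_mod_cast hL0, ?_⟩
    rw [div_lt_iff₀ hδ] at hL
    calc 2 * m * (m / L) * K ^ 2 = (2 * m * m * K ^ 2) / L := by ring
      _ ≤ δ := by rw [div_le_iff₀ hL0, mul_comm δ]; exact hL.le
  obtain ⟨C2, hC2⟩ := hξ.exists_integral_abs_band_le L hδ
  refine ⟨C2 + 2 * (4 * m ^ 2 * K ^ 4 / δ), fun n B hB => ?_⟩
  set w := windowWeight L with hw
  -- Smooth weights are needed here: unlike a sharp cutoff to a band, they keep both pieces bounded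
  -- uniformly in `n`.
  set C : ℕ → ℕ → ℝ := fun j k => B j k - w j k * B j k with hC
  have hwB := hB.window hL0
  have hCb : ∀ t : ℝ, 0 < t → ∀ x y : ℕ → ℝ,
      |∑ j ∈ Finset.range n, ∑ k ∈ Finset.range n, C j k * x j * y k|
        ≤ t * ∑ j ∈ Finset.range n, x j ^ 2 + t⁻¹ * ∑ k ∈ Finset.range n, y k ^ 2 := by
    intro t ht x y
    have e : ∑ j ∈ Finset.range n, ∑ k ∈ Finset.range n, C j k * x j * y k
        = ∑ j ∈ Finset.range n, ∑ k ∈ Finset.range n, B j k * x j * y k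
          - ∑ j ∈ Finset.range n, ∑ k ∈ Finset.range n, (w j k * B j k) * x j * y k := by
      simp only [← Finset.sum_sub_distrib]
      exact Finset.sum_congr rfl fun j _ => Finset.sum_congr rfl fun k _ => by
        simp only [hC]; ring
    rw [e]
    refine (abs_sub _ _).trans ((add_le_add (hB.scaled ht x y) (hwB.scaled ht x y)).trans ?_)
    linarith
  have hCB : ∀ j k, C j k ^ 2 ≤ B j k ^ 2 := fun j k => by
    have h0 := windowWeight_nonneg L j k
    have h1 := windowWeight_le_one L j k
    have : C j k = (1 - w j k) * B j k := by simp only [hC]; ring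
    rw [this, mul_pow]
    refine mul_le_of_le_one_left (sq_nonneg _) ?_
    exact pow_le_one₀ (by linarith) (by linarith)
  have hCnear : ∀ j < n, ∀ k < n, j < k + m → k < j + m → |C j k| ≤ (m : ℝ) / L := by
    intro j hj k hk h1 h2
    have : C j k = (1 - w j k) * B j k := by simp only [hC]; ring
    rw [this, abs_mul, abs_of_nonneg (by linarith [windowWeight_le_one L j k])]
    exact (mul_le_of_le_one_right (by linarith [windowWeight_le_one L j k])
      (hB.abs_le hj hk)).trans (one_sub_windowWeight_le hL0 h1.le h2.le)
  have hoff := integral_abs_offdiag_le (P := P) (G := pastSigma ξ)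
    (fun _ _ h => pastSigma_mono ξ h) (pastSigma_le hξ.measurable) hm hζm hζb hζ0 (n := n) (C := C)
    (r := (m : ℝ) / L) (by positivity) hδ
    (fun k hk => (Finset.sum_le_sum fun j _ => hCB j k).trans (hB.transpose.sum_sq_le hk))
    (fun j hj => (Finset.sum_le_sum fun k _ => hCB j k).trans (hB.sum_sq_le hj)) hCnear
  have hζ2 : ∀ j, MemLp (ζ j) 2 P := fun j =>
    MemLp.of_bound ((hζm j).mono (pastSigma_le hξ.measurable _)).aestronglyMeasurable K (hζb j)
  set qξ : Ω → ℝ := fun ω => ∑ j ∈ Finset.range n, ∑ k ∈ Finset.range n, C j k * ξ j ω * ξ k ω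
    with hqξ
  set qζ : Ω → ℝ := fun ω => ∑ j ∈ Finset.range n, ∑ k ∈ Finset.range n, C j k * ζ j ω * ζ k ω
    with hqζ
  have hqξi : Integrable qξ P := integrable_finsetSum _ fun j _ => integrable_finsetSum _ fun k _ =>
    by simpa only [mul_assoc] using (hξ.integrable_mul j k).const_mul (C j k)
  have hqζi : Integrable qζ P := integrable_finsetSum _ fun j _ => integrable_finsetSum _ fun k _ =>
    by simpa only [mul_assoc, Pi.mul_apply] using ((hζ2 j).integrable_mul (hζ2 k)).const_mul (C j k)
  have hdi : ∀ j : ℕ, Integrable (fun ω => (2 * δ⁻¹ + 2 * δ) * (ξ j ω - ζ j ω) ^ 2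
      + 3 * δ * ξ j ω ^ 2) P := fun j =>
    (((hξ.memLp j).sub (hζ2 j)).integrable_sq.const_mul _).add
      ((hξ.memLp j).integrable_sq.const_mul _)
  have hq : ∫ ω, |qξ ω - qζ ω| ∂P ≤ δ * (36 + 3 * σ) * n := by
    calc ∫ ω, |qξ ω - qζ ω| ∂P
        ≤ ∫ ω, ∑ j ∈ Finset.range n, ((2 * δ⁻¹ + 2 * δ) * (ξ j ω - ζ j ω) ^ 2
          + 3 * δ * ξ j ω ^ 2) ∂P :=
          integral_mono (hqξi.sub hqζi).abs (integrable_finsetSum _ fun j _ => hdi j)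
            fun ω => quad_diff_le hCb hδ (fun j => ξ j ω) (fun j => ζ j ω)
      _ = ∑ j ∈ Finset.range n, ((2 * δ⁻¹ + 2 * δ) * ∫ ω, (ξ j ω - ζ j ω) ^ 2 ∂P
          + 3 * δ * σ) := by
          rw [integral_finsetSum _ fun j _ => hdi j]
          refine Finset.sum_congr rfl fun j _ => ?_
          rw [hσ, ← hξ.integral_sq_eq j, ← integral_const_mul, ← integral_const_mul]
          exact integral_add (((hξ.memLp j).sub (hζ2 j)).integrable_sq.const_mul _)
            ((hξ.memLp j).integrable_sq.const_mul _)
      _ ≤ ∑ j ∈ Finset.range n, ((2 * δ⁻¹ + 2 * δ) * (3 * δ) ^ 2 + 3 * δ * σ) := by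
          gcongr with j
          exact hξζ j
      _ = (18 * δ + 18 * δ ^ 3 + 3 * δ * σ) * n := by
          rw [Finset.sum_const, Finset.card_range, nsmul_eq_mul]; field_simp; ring
      _ ≤ δ * (36 + 3 * σ) * n := by
          gcongr
          have : δ ^ 3 ≤ δ := by
            calc δ ^ 3 = δ * δ ^ 2 := by ring
              _ ≤ δ * 1 := by gcongr; exact pow_le_one₀ hδ.le hδ1
              _ = δ := mul_one _
          linarith
  have hqξ1 : ∫ ω, |qξ ω| ∂P ≤ δ * (38 + 3 * σ) * n + 4 * m ^ 2 * K ^ 4 / δ := by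
    calc ∫ ω, |qξ ω| ∂P ≤ ∫ ω, (|qξ ω - qζ ω| + |qζ ω|) ∂P :=
          integral_mono hqξi.abs ((hqξi.sub hqζi).abs.add hqζi.abs) fun ω => by
            simpa using abs_add_le (qξ ω - qζ ω) (qζ ω)
      _ = ∫ ω, |qξ ω - qζ ω| ∂P + ∫ ω, |qζ ω| ∂P :=
          integral_add (hqξi.sub hqζi).abs hqζi.abs
      _ ≤ δ * (36 + 3 * σ) * n + (δ * n + 4 * m ^ 2 * K ^ 4 / δ + δ * n) := by
          refine add_le_add hq (hoff.trans ?_)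
          gcongr
      _ = _ := by ring
  have hband := hC2 n (fun j k => w j k * B j k) (fun j hj k hk => hwB.abs_le hj hk)
    (fun j k h => by simp only [hw, windowWeight_eq_zero h, zero_mul])
  set c : ℕ → ℕ → ℝ := fun j k => ∫ ω, ξ j ω * ξ k ω ∂P with hc
  -- No separate estimate of the mean is needed: |E q| ≤ E|q|.
  have hmean : ∑ j ∈ Finset.range n, ∑ k ∈ Finset.range n, C j k * c j k = ∫ ω, qξ ω ∂P := by
    rw [hqξ, integral_finsetSum _ fun j _ => integrable_finsetSum _ fun k _ => by
      simpa only [mul_assoc] using (hξ.integrable_mul j k).const_mul (C j k)]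
    refine Finset.sum_congr rfl fun j _ => ?_
    rw [integral_finsetSum _ fun k _ => by
      simpa only [mul_assoc] using (hξ.integrable_mul j k).const_mul (C j k)]
    refine Finset.sum_congr rfl fun k _ => ?_
    simp only [mul_assoc]
    rw [integral_const_mul]
  set b : Ω → ℝ := fun ω => ∑ j ∈ Finset.range n, ∑ k ∈ Finset.range n,
    (w j k * B j k) * (ξ j ω * ξ k ω - c j k) with hb
  have hbi : Integrable b P := integrable_finsetSum _ fun j _ => integrable_finsetSum _ fun k _ =>
    ((hξ.integrable_mul j k).sub (integrable_const _)).const_mul _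
  have hpt : ∀ ω, |∑ j ∈ Finset.range n, ∑ k ∈ Finset.range n, B j k * (ξ j ω * ξ k ω - c j k)|
      ≤ |b ω| + |qξ ω| + |∫ ω, qξ ω ∂P| := fun ω => by
    have e : ∑ j ∈ Finset.range n, ∑ k ∈ Finset.range n, B j k * (ξ j ω * ξ k ω - c j k)
        = b ω + qξ ω + -∫ ω, qξ ω ∂P := by
      rw [← hmean]
      simp only [hb, hqξ, ← Finset.sum_add_distrib, ← Finset.sum_neg_distrib]
      exact Finset.sum_congr rfl fun j _ => Finset.sum_congr rfl fun k _ => by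
        simp only [hC]; ring
    rw [e]
    refine (abs_add_three _ _ _).trans ?_
    rw [abs_neg]
  calc ∫ ω, |∑ j ∈ Finset.range n, ∑ k ∈ Finset.range n, B j k * (ξ j ω * ξ k ω - c j k)| ∂P
      ≤ ∫ ω, (|b ω| + |qξ ω| + |∫ ω, qξ ω ∂P|) ∂P :=
        integral_mono_of_nonneg (ae_of_all _ fun ω => abs_nonneg _)
          ((hbi.abs.add hqξi.abs).add (integrable_const _)) (ae_of_all _ hpt)
    _ = ∫ ω, |b ω| ∂P + ∫ ω, |qξ ω| ∂P + |∫ ω, qξ ω ∂P| := by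
        rw [← integral_add hbi.abs hqξi.abs]
        refine (integral_add (hbi.abs.add hqξi.abs) (integrable_const _)).trans ?_
        rw [integral_const]; simp
    _ ≤ (δ * n + C2) + (δ * (38 + 3 * σ) * n + 4 * m ^ 2 * K ^ 4 / δ)
        + (δ * (38 + 3 * σ) * n + 4 * m ^ 2 * K ^ 4 / δ) :=
        add_le_add (add_le_add hband hqξ1) ((abs_integral_le_integral_abs).trans hqξ1)
    _ = δ * (77 + 6 * σ) * n + (C2 + 2 * (4 * m ^ 2 * K ^ 4 / δ)) := by ring
    _ ≤ _ := by gcongr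

end IsRegularSeq
end RowIndep

namespace RowIndep

/-! ### Fourth moments of Gaussian processes. -/

section Gaussian

/-- Fourth moment of a centered real Gaussian distribution. -/
theorem integral_pow_four_gaussianReal (v : NNReal) :
    ∫ x, x ^ 4 ∂(gaussianReal 0 v) = 3 * (v : ℝ) ^ 2 := by
  have hset : integrableExpSet id (gaussianReal 0 v) = Set.univ := by
    ext t
    simpa [integrableExpSet] using integrable_exp_mul_gaussianReal (μ := 0) (v := v) t
  -- The fourth moment is the fourth derivative at 0 of exp(v t² / 2).
  have h := iteratedDeriv_mgf_zero (X := id) (μ := gaussianReal 0 v) (by simp [hset]) 4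
  have h0 : mgf id (gaussianReal 0 v) = fun t => Real.exp (v * t ^ 2 / 2) := by
    rw [mgf_id_gaussianReal]; ext t; simp
  set e : ℝ → ℝ := fun t => Real.exp (v * t ^ 2 / 2) with he
  have hd : ∀ t, HasDerivAt e (v * t * e t) t := fun t => by
    have : HasDerivAt (fun t : ℝ => (v : ℝ) * t ^ 2 / 2) (v * t) t := by
      refine (((hasDerivAt_pow 2 t).const_mul (v : ℝ)).div_const 2).congr_deriv ?_
      norm_num; ring
    refine this.exp.congr_deriv ?_
    rw [he]; ring
  have hp : ∀ (p p' : ℝ → ℝ), (∀ t, HasDerivAt p (p' t) t) →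
      deriv (fun t => p t * e t) = fun t => (p' t + v * t * p t) * e t := fun p p' hp => by
    ext t
    refine (((hp t).mul (hd t)).congr_deriv ?_).deriv
    ring
  have h1 : deriv e = fun t => (v * t) * e t := funext fun t => (hd t).deriv
  have h2 := hp (fun t => (v : ℝ) * t) (fun _ => v) fun t => by
    simpa using (hasDerivAt_id t).const_mul (v : ℝ)
  have h3 := hp (fun t => (v : ℝ) + v * t * (v * t)) (fun t => 2 * v ^ 2 * t) fun t => by
    have h := (((hasDerivAt_pow 2 t).const_mul ((v : ℝ) ^ 2)).const_add (v : ℝ))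
    refine (h.congr_deriv (by norm_num; ring)).congr_of_eventuallyEq (.of_forall fun t => ?_)
    simp only; ring
  have h4 := hp (fun t => 2 * (v : ℝ) ^ 2 * t + v * t * ((v : ℝ) + v * t * (v * t)))
    (fun t => 3 * v ^ 2 + 3 * v ^ 3 * t ^ 2) fun t => by
    have h := ((hasDerivAt_id t).const_mul (3 * (v : ℝ) ^ 2)).add
      ((hasDerivAt_pow 3 t).const_mul ((v : ℝ) ^ 3))
    refine (h.congr_deriv (by norm_num; ring)).congr_of_eventuallyEq (.of_forall fun t => ?_)
    simp only [Pi.add_apply, id]; ring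
  rw [h0, iteratedDeriv_succ, iteratedDeriv_succ, iteratedDeriv_succ, iteratedDeriv_succ,
    iteratedDeriv_zero, h1, h2, h3, h4] at h
  simp only [he] at h
  simpa using h.symm

variable {Ω : Type*} [MeasurableSpace Ω] {Q : Measure Ω}

theorem integral_pow_four_of_hasGaussianLaw {U : Ω → ℝ} (hU : HasGaussianLaw U Q)
    (hU0 : ∫ ω, U ω ∂Q = 0) : ∫ ω, U ω ^ 4 ∂Q = 3 * (∫ ω, U ω ^ 2 ∂Q) ^ 2 := by
  have := hU.isProbabilityMeasure
  have h := integral_map (μ := Q) hU.aemeasurable (f := fun x : ℝ => x ^ 4)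
    (by fun_prop)
  rw [hU.map_eq_gaussianReal, hU0, integral_pow_four_gaussianReal,
    Real.coe_toNNReal _ (variance_nonneg _ _), variance_of_integral_eq_zero hU.aemeasurable hU0] at h
  exact h.symm

/-- Fourth mixed moments of a centered Gaussian process. -/
theorem integral_mul_four_of_isGaussianProcess {ι : Type*} {Y : ι → Ω → ℝ}
    (hY : IsGaussianProcess Y Q) (hY0 : ∀ i, ∫ ω, Y i ω ∂Q = 0) (a b c d : ι) :
    ∫ ω, Y a ω * Y b ω * (Y c ω * Y d ω) ∂Q
      = (∫ ω, Y a ω * Y b ω ∂Q) * (∫ ω, Y c ω * Y d ω ∂Q)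
        + (∫ ω, Y a ω * Y c ω ∂Q) * (∫ ω, Y b ω * Y d ω ∂Q)
        + (∫ ω, Y a ω * Y d ω ∂Q) * (∫ ω, Y b ω * Y c ω ∂Q) := by
  have := hY.isProbabilityMeasure
  set Z : Fin 4 → Ω → ℝ := fun i => Y (![a, b, c, d] i) with hZ
  have hm2 : ∀ i, MemLp (Z i) 2 Q := fun i => (hY.hasGaussianLaw_eval _).memLp (by simp)
  have hint2 : ∀ i j, Integrable (fun ω => Z i ω * Z j ω) Q := fun i j =>
    (hm2 i).integrable_mul (hm2 j)
  set A : Fin 4 → Fin 4 → ℝ := fun i j => ∫ ω, Z i ω * Z j ω ∂Q with hA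
  have hAs : ∀ i j, A i j = A j i := fun i j => by simp only [hA, mul_comm (Z i _)]
  set U : (Fin 4 → ℝ) → Ω → ℝ := fun t ω => ∑ i, t i * Z i ω with hU
  have hlin : ∀ t : Fin 4 → ℝ, HasGaussianLaw (U t) Q := fun t => by
    have h := (hY.comp_right ![a, b, c, d]).smul t
    exact h.hasGaussianLaw_fun_sum (I := Finset.univ)
  have hU0 : ∀ t, ∫ ω, U t ω ∂Q = 0 := fun t => by
    simp only [hU]
    rw [integral_finsetSum _ fun i _ => ((hm2 i).integrable one_le_two).const_mul _]
    refine Finset.sum_eq_zero fun i _ => ?_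
    rw [integral_const_mul, hY0, mul_zero]
  have hU2 : ∀ t, ∫ ω, U t ω ^ 2 ∂Q = ∑ i, ∑ j, t i * t j * A i j := fun t => by
    have e : ∀ ω, U t ω ^ 2 = ∑ i, ∑ j, t i * t j * (Z i ω * Z j ω) := fun ω => by
      simp only [hU, sq, Finset.sum_mul_sum]
      exact Finset.sum_congr rfl fun i _ => Finset.sum_congr rfl fun j _ => by ring
    simp only [e]
    rw [integral_finsetSum _ fun i _ => integrable_finsetSum _ fun j _ => (hint2 i j).const_mul _]
    refine Finset.sum_congr rfl fun i _ => ?_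
    rw [integral_finsetSum _ fun j _ => (hint2 i j).const_mul _]
    exact Finset.sum_congr rfl fun j _ => integral_const_mul _ _
  have hU4 : ∀ t, ∫ ω, U t ω ^ 4 ∂Q = 3 * (∫ ω, U t ω ^ 2 ∂Q) ^ 2 := fun t =>
    integral_pow_four_of_hasGaussianLaw (hlin t) (hU0 t)
  have hUi : ∀ t, Integrable (fun ω => U t ω ^ 4) Q := fun t => by
    have h4 : MemLp (U t) ((4 : ℕ) : ENNReal) Q := (hlin t).memLp (by simp)
    refine (h4.integrable_norm_pow (by norm_num)).congr (ae_of_all _ fun ω => ?_)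
    simp only [Real.norm_eq_abs]
    exact Even.pow_abs ⟨2, rfl⟩ _
  -- Polarization: the product of four variables is a combination of fourth powers over the sign
  -- vectors up to a global sign. The coefficient is the product of the signs, and 192 = 8 · 4!.
  set T : Fin 8 → Fin 4 → ℝ := ![![1, 1, 1, 1], ![1, 1, 1, -1], ![1, 1, -1, 1], ![1, -1, 1, 1],
    ![1, 1, -1, -1], ![1, -1, 1, -1], ![1, -1, -1, 1], ![1, -1, -1, -1]] with hT
  set s : Fin 8 → ℝ := ![1, -1, -1, -1, 1, 1, 1, -1] with hs
  have hpol : ∀ ω, Z 0 ω * Z 1 ω * (Z 2 ω * Z 3 ω) = ∑ k, s k / 192 * U (T k) ω ^ 4 := fun ω => by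
    simp only [hU, hT, hs, Fin.sum_univ_eight, Fin.sum_univ_four, Matrix.cons_val]
    ring
  change ∫ ω, Z 0 ω * Z 1 ω * (Z 2 ω * Z 3 ω) ∂Q = A 0 1 * A 2 3 + A 0 2 * A 1 3 + A 0 3 * A 1 2
  simp only [hpol]
  rw [integral_finsetSum _ fun k _ => (hUi (T k)).const_mul _]
  simp only [integral_const_mul, hU4, hU2]
  clear_value A U Z
  simp only [hT, hs, Fin.sum_univ_eight, Fin.sum_univ_four, Matrix.cons_val]
  rw [hAs 1 0, hAs 2 0, hAs 3 0, hAs 2 1, hAs 3 1, hAs 3 2]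
  ring

end Gaussian
end RowIndep

namespace RowIndep

/-! ### Resolvents and the Schur complement. -/

section Resolvent

open Matrix

variable {ι : Type*}

/-- A real vector seen as a complex vector. -/
def complexify (u : ι → ℝ) : ι → ℂ := fun i => (u i : ℂ)

theorem complexify_add (u v : ι → ℝ) :
    complexify (u + v) = complexify u + complexify v := by
  ext i; simp [complexify]

/-- The matrix `A` with the row and the column of index `k` set to zero. -/
def zeroCross [DecidableEq ι] (A : Matrix ι ι ℝ) (k : ι) : Matrix ι ι ℝ :=
  Matrix.of fun i j => if i = k ∨ j = k then 0 else A i j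

/-- The row of index `k` without its diagonal entry. -/
def crossVec [DecidableEq ι] (A : Matrix ι ι ℝ) (k : ι) : ι → ℝ := fun j => if j = k then 0 else A k j

theorem zeroCross_isSymm [DecidableEq ι] {A : Matrix ι ι ℝ} (hA : A.IsSymm) (k : ι) : (zeroCross A k).IsSymm := by
  ext i j
  simp only [zeroCross, Matrix.transpose_apply, Matrix.of_apply, or_comm, hA.apply i j]

variable [Fintype ι]

theorem norm_dotProduct_le (x y : ι → ℂ) {t : ℝ} (ht : 0 < t) :
    ‖x ⬝ᵥ y‖ ≤ (t * ∑ i, ‖x i‖ ^ 2 + t⁻¹ * ∑ i, ‖y i‖ ^ 2) / 2 := by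
  calc ‖x ⬝ᵥ y‖ ≤ ∑ i, ‖x i * y i‖ := norm_sum_le _ _
    _ ≤ ∑ i, (t * ‖x i‖ ^ 2 + t⁻¹ * ‖y i‖ ^ 2) / 2 := by
        refine Finset.sum_le_sum fun i _ => ?_
        rw [norm_mul]
        have h : t * ‖x i‖ ^ 2 + t⁻¹ * ‖y i‖ ^ 2 - 2 * (‖x i‖ * ‖y i‖)
          = t⁻¹ * (t * ‖x i‖ - ‖y i‖) ^ 2 := by field_simp; ring
        have h2 : 0 ≤ t⁻¹ * (t * ‖x i‖ - ‖y i‖) ^ 2 := by positivity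
        linarith
    _ = _ := by rw [← Finset.sum_div, Finset.sum_add_distrib, Finset.mul_sum, Finset.mul_sum]

theorem sum_sq_complexify (u : ι → ℝ) : ∑ i, ‖complexify u i‖ ^ 2 = ∑ i, u i ^ 2 := by
  simp [complexify]

theorem norm_one_add_dotProduct_self_le (w : ι → ℂ) : ‖1 + w ⬝ᵥ w‖ ≤ 1 + ∑ i, ‖w i‖ ^ 2 := by
  have h := norm_dotProduct_le w w one_pos
  have h2 := norm_add_le (1 : ℂ) (w ⬝ᵥ w)
  rw [norm_one] at h2
  rw [inv_one] at h
  linarith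

variable [DecidableEq ι]

/-- The resolvent `(A - z)⁻¹` of a real matrix. -/
noncomputable def resolvent (A : Matrix ι ι ℝ) (z : ℂ) : Matrix ι ι ℂ :=
  (A.map (fun t : ℝ => (t : ℂ)) - z • (1 : Matrix ι ι ℂ))⁻¹

/-- The imaginary part of the quadratic form of `A - z`. -/
theorem im_star_dotProduct {A : Matrix ι ι ℝ} (hA : A.IsSymm) (z : ℂ) (w : ι → ℂ) :
    (star w ⬝ᵥ ((A.map (fun t : ℝ => (t : ℂ)) - z • (1 : Matrix ι ι ℂ)) *ᵥ w)).im
      = -z.im * ∑ i, ‖w i‖ ^ 2 := by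
  have hherm : (A.map (fun t : ℝ => (t : ℂ))).IsHermitian := by
    ext i j
    simp [Matrix.conjTranspose_apply, hA.apply i j]
  have h1 : (star w ⬝ᵥ (A.map (fun t : ℝ => (t : ℂ)) *ᵥ w)).im = 0 :=
    hherm.im_star_dotProduct_mulVec_self w
  rw [sub_mulVec, smul_mulVec, one_mulVec, dotProduct_sub, dotProduct_smul, Complex.sub_im, h1,
    zero_sub]
  have h2 : star w ⬝ᵥ w = ((∑ i, ‖w i‖ ^ 2 : ℝ) : ℂ) := by
    simp only [dotProduct, Pi.star_apply, Complex.ofReal_sum]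
    refine Finset.sum_congr rfl fun i _ => ?_
    rw [Complex.star_def, Complex.conj_mul']
    norm_cast
  rw [h2, smul_eq_mul, Complex.im_mul_ofReal]
  ring

variable {A : Matrix ι ι ℝ} {z : ℂ}

theorem isUnit_det_sub (hA : A.IsSymm) (hz : 0 < z.im) :
    IsUnit (A.map (fun t : ℝ => (t : ℂ)) - z • (1 : Matrix ι ι ℂ)).det := by
  rw [isUnit_iff_ne_zero]
  intro h
  obtain ⟨w, hw, hw0⟩ := Matrix.exists_mulVec_eq_zero_iff.2 h
  have := im_star_dotProduct hA z w
  rw [hw0, dotProduct_zero, Complex.zero_im] at this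
  have h2 : ∑ i, ‖w i‖ ^ 2 = 0 := by
    rcases mul_eq_zero.1 this.symm with h | h
    · linarith
    · exact h
  rw [Finset.sum_eq_zero_iff_of_nonneg fun i _ => sq_nonneg _] at h2
  exact hw (funext fun i => by simpa using h2 i (Finset.mem_univ i))

theorem mul_resolvent (hA : A.IsSymm) (hz : 0 < z.im) :
    (A.map (fun t : ℝ => (t : ℂ)) - z • (1 : Matrix ι ι ℂ)) * resolvent A z = 1 :=
  Matrix.mul_nonsing_inv _ (isUnit_det_sub hA hz)

theorem resolvent_transpose (hA : A.IsSymm) : (resolvent A z)ᵀ = resolvent A z := by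
  rw [resolvent, Matrix.transpose_nonsing_inv]
  congr 1
  ext i j
  simp [hA.apply i j, Matrix.one_apply, eq_comm]

/-- For real `u` the bilinear and sesquilinear pairings agree up to conjugation, so this is the
quadratic form of A - z evaluated at Ru. -/
theorem im_dotProduct_resolvent (hA : A.IsSymm) (hz : 0 < z.im) (u : ι → ℝ) :
    (complexify u ⬝ᵥ (resolvent A z *ᵥ complexify u)).im
      = z.im * ∑ i, ‖(resolvent A z *ᵥ complexify u) i‖ ^ 2 := by
  set w := resolvent A z *ᵥ complexify u with hw
  have h := im_star_dotProduct hA z w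
  rw [hw, mulVec_mulVec, mul_resolvent hA hz, one_mulVec, ← hw] at h
  have h2 : star w ⬝ᵥ complexify u = star (complexify u ⬝ᵥ w) := by
    rw [Matrix.star_dotProduct]
    congr 2
    ext i
    simp [complexify]
  rw [h2, Complex.star_def, Complex.conj_im] at h
  linarith

/-- With w = R a, the quantity Im z ‖w‖² equals -Im⟨w, a⟩. AM–GM with parameter Im z lets half of it
be absorbed on the left. -/
theorem sum_sq_resolvent_le (hA : A.IsSymm) (hz : 0 < z.im) (a : ι → ℂ) :
    ∑ i, ‖(resolvent A z *ᵥ a) i‖ ^ 2 ≤ (z.im⁻¹) ^ 2 * ∑ i, ‖a i‖ ^ 2 := by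
  set w := resolvent A z *ᵥ a with hw
  have h1 := im_star_dotProduct hA z w
  rw [hw, mulVec_mulVec, mul_resolvent hA hz, one_mulVec, ← hw] at h1
  have h2 := norm_dotProduct_le (star w) a hz
  have h3 := (neg_le_abs _).trans (Complex.abs_im_le_norm (star w ⬝ᵥ a))
  simp only [Pi.star_apply, norm_star] at h2
  have h5 : z.im * ∑ i, ‖w i‖ ^ 2 ≤ z.im⁻¹ * ∑ i, ‖a i‖ ^ 2 := by linarith
  calc ∑ i, ‖w i‖ ^ 2 = z.im⁻¹ * (z.im * ∑ i, ‖w i‖ ^ 2) := by field_simp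
    _ ≤ z.im⁻¹ * (z.im⁻¹ * ∑ i, ‖a i‖ ^ 2) := by gcongr
    _ = _ := by ring

/-- The denominator in the Schur complement formula. -/
theorem im_schur_denom (hA : A.IsSymm) (hz : 0 < z.im) (α : ℝ) (u : ι → ℝ) :
    ((α : ℂ) - z - complexify u ⬝ᵥ (resolvent A z *ᵥ complexify u)).im
      = -(z.im * (1 + ∑ i, ‖(resolvent A z *ᵥ complexify u) i‖ ^ 2)) := by
  rw [Complex.sub_im, Complex.sub_im, im_dotProduct_resolvent hA hz, Complex.ofReal_im]
  ring

/-- Schur complement formula for the trace of the resolvent. -/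
theorem trace_resolvent_eq (hA : A.IsSymm) (hz : 0 < z.im) (k : ι) :
    (resolvent A z).trace = (resolvent (zeroCross A k) z).trace + z⁻¹
      + (1 + (resolvent (zeroCross A k) z *ᵥ complexify (crossVec A k)) ⬝ᵥ
            (resolvent (zeroCross A k) z *ᵥ complexify (crossVec A k)))
        / ((A k k : ℂ) - z - complexify (crossVec A k) ⬝ᵥ
            (resolvent (zeroCross A k) z *ᵥ complexify (crossVec A k))) := by
  have hA0 := zeroCross_isSymm hA k
  set R := resolvent (zeroCross A k) z with hR
  set a := complexify (crossVec A k) with ha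
  set w := R *ᵥ a with hw
  set D := (A k k : ℂ) - z - a ⬝ᵥ w with hD
  set e : ι → ℂ := Pi.single k 1 with he
  have hz0 : z ≠ 0 := fun h => by simp [h] at hz
  have hD0 : D ≠ 0 := fun h => by
    have h1 := im_schur_denom hA0 hz (A k k) (crossVec A k)
    rw [← hR, ← ha, ← hw, ← hD, h, Complex.zero_im] at h1
    have h2 : 0 ≤ ∑ i, ‖w i‖ ^ 2 := Finset.sum_nonneg fun _ _ => sq_nonneg _
    have : 0 < z.im * (1 + ∑ i, ‖w i‖ ^ 2) := by positivity
    linarith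
  set M0 := (zeroCross A k).map (fun t : ℝ => (t : ℂ)) - z • (1 : Matrix ι ι ℂ) with hM0
  have hMR : M0 * R = 1 := mul_resolvent hA0 hz
  have hRM : R * M0 = 1 := Matrix.nonsing_inv_mul _ (isUnit_det_sub hA0 hz)
  have hRT : Rᵀ = R := resolvent_transpose hA0
  have hM : A.map (fun t : ℝ => (t : ℂ)) - z • (1 : Matrix ι ι ℂ)
      = M0 + vecMulVec a e + vecMulVec e a + (A k k : ℂ) • vecMulVec e e := by
    ext i j
    simp only [hM0, zeroCross, ha, complexify, crossVec, he, Matrix.sub_apply, Matrix.add_apply,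
      Matrix.map_apply, Matrix.of_apply, Matrix.smul_apply, vecMulVec_apply, Pi.single_apply]
    by_cases hi : i = k <;> by_cases hj : j = k
    · subst hi; subst hj; simp; ring
    · subst hi; simp [hj]; ring
    · subst hj; simp [hi, hA.apply]
    · simp [hi, hj]
  have hM0e : M0 *ᵥ e = (-z) • e := by
    ext i
    rw [he, Matrix.mulVec_single_one]
    simp only [hM0, zeroCross, Matrix.col_apply, Matrix.sub_apply, Matrix.map_apply,
      Matrix.of_apply, Matrix.smul_apply, Matrix.one_apply, Pi.smul_apply, Pi.single_apply]
    by_cases hi : i = k <;> simp [hi]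
  have hRe : R *ᵥ e = (-z⁻¹) • e := by
    have h : R *ᵥ (M0 *ᵥ e) = e := by rw [mulVec_mulVec, hRM, one_mulVec]
    rw [hM0e, mulVec_smul] at h
    rw [← h, smul_smul]
    simp [h, hz0]
  have heR : e ᵥ* R = (-z⁻¹) • e := by
    rw [← hRe, ← mulVec_transpose, hRT]
  have haR : a ᵥ* R = w := by rw [hw, ← mulVec_transpose, hRT]
  have hM0w : M0 *ᵥ w = a := by rw [hw, mulVec_mulVec, hMR, one_mulVec]
  have hae : a ⬝ᵥ e = 0 := by simp [he, ha, complexify, crossVec]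
  have hee : e ⬝ᵥ e = 1 := by simp [he]
  have hwe : w ⬝ᵥ e = 0 := by
    rw [hw, dotProduct_comm, dotProduct_mulVec, heR, smul_dotProduct, dotProduct_comm, hae,
      smul_zero]
  have hew : e ⬝ᵥ w = 0 := by rw [dotProduct_comm, hwe]
  -- The inverse is explicit: remove the spurious eigenvalue and add a rank one term along e - w.
  have hinv : resolvent A z = R + z⁻¹ • vecMulVec e e + D⁻¹ • vecMulVec (e - w) (e - w) := by
    rw [resolvent]
    refine Matrix.inv_eq_right_inv ?_
    have h1 : (M0 + vecMulVec a e + vecMulVec e a + (A k k : ℂ) • vecMulVec e e) * R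
        = 1 + vecMulVec a ((-z⁻¹) • e) + vecMulVec e w
          + (A k k : ℂ) • vecMulVec e ((-z⁻¹) • e) := by
      simp only [Matrix.add_mul, Matrix.smul_mul, vecMulVec_mul, hMR, heR, haR]
    have h2 : (M0 + vecMulVec a e + vecMulVec e a + (A k k : ℂ) • vecMulVec e e) *ᵥ e
        = (-z) • e + a + (A k k : ℂ) • e := by
      simp only [Matrix.add_mulVec, Matrix.smul_mulVec, vecMulVec_mulVec, hM0e, hae, hee,
        MulOpposite.op_zero, MulOpposite.op_one, zero_smul, one_smul, add_zero]
    have h3 : (M0 + vecMulVec a e + vecMulVec e a + (A k k : ℂ) • vecMulVec e e) *ᵥ (e - w)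
        = D • e := by
      rw [mulVec_sub, h2]
      simp only [Matrix.add_mulVec, Matrix.smul_mulVec, vecMulVec_mulVec, hM0w, hew,
        MulOpposite.op_zero, zero_smul, op_smul_eq_smul, smul_zero, add_zero]
      ext i
      simp only [hD, Pi.add_apply, Pi.sub_apply, Pi.smul_apply, smul_eq_mul]
      ring
    rw [hM, Matrix.mul_add, Matrix.mul_add, Matrix.mul_smul, Matrix.mul_smul, mul_vecMulVec,
      mul_vecMulVec, h1, h2, h3]
    have hDD : D⁻¹ * D = 1 := inv_mul_cancel₀ hD0
    have hzz : z⁻¹ * z = 1 := inv_mul_cancel₀ hz0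
    ext i j
    simp only [Matrix.add_apply, Matrix.smul_apply, vecMulVec_apply, Pi.sub_apply, Pi.smul_apply,
      Pi.add_apply, smul_eq_mul]
    linear_combination (e i * e j - e i * w j) * hDD - e i * e j * hzz
  rw [hinv, trace_add, trace_add, trace_smul, trace_smul, trace_vecMulVec, trace_vecMulVec, hee,
    dotProduct_sub, sub_dotProduct, sub_dotProduct, hee, hwe, hew]
  simp only [smul_eq_mul]
  field_simp
  ring

/-- Removing a row and the column of the same index changes the trace of the resolvent by a bounded
quantity. -/
theorem norm_trace_resolvent_sub_zeroCross_le (hA : A.IsSymm) (hz : 0 < z.im) (k : ι) :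
    ‖(resolvent A z).trace - ((resolvent (zeroCross A k) z).trace + z⁻¹)‖ ≤ z.im⁻¹ := by
  rw [trace_resolvent_eq hA hz k, add_sub_cancel_left, norm_div]
  set w := resolvent (zeroCross A k) z *ᵥ complexify (crossVec A k) with hw
  have h1 := norm_one_add_dotProduct_self_le w
  have h2 := im_schur_denom (zeroCross_isSymm hA k) hz (A k k) (crossVec A k)
  rw [← hw] at h2
  set D := (A k k : ℂ) - z - complexify (crossVec A k) ⬝ᵥ w with hD
  -- Numerator and denominator are controlled by the same quantity 1 + ‖w‖², so the quotient is
  -- bounded however large the row is.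
  have h3 := (neg_le_abs _).trans (Complex.abs_im_le_norm D)
  have h0 : 0 ≤ ∑ i, ‖w i‖ ^ 2 := Finset.sum_nonneg fun _ _ => sq_nonneg _
  rw [h2, neg_neg] at h3
  have hpos : 0 < z.im * (1 + ∑ i, ‖w i‖ ^ 2) := by positivity
  rw [div_le_iff₀ (hpos.trans_le h3)]
  calc _ ≤ _ := h1
    _ = z.im⁻¹ * (z.im * (1 + ∑ i, ‖w i‖ ^ 2)) := by field_simp
    _ ≤ _ := by gcongr

/-- Both matrices are compared with their common zeroed matrix. This is the bounded difference used
for concentration. -/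
theorem norm_trace_resolvent_sub_le {A' : Matrix ι ι ℝ} (hA : A.IsSymm) (hA' : A'.IsSymm)
    (hz : 0 < z.im) {k : ι} (h : zeroCross A k = zeroCross A' k) :
    ‖(resolvent A z).trace - (resolvent A' z).trace‖ ≤ 2 * z.im⁻¹ := by
  have h1 := norm_trace_resolvent_sub_zeroCross_le hA hz k
  have h2 := norm_trace_resolvent_sub_zeroCross_le hA' hz k
  rw [← h, norm_sub_rev] at h2
  refine (norm_sub_le_norm_sub_add_norm_sub _ _ _).trans ((add_le_add h1 h2).trans ?_)
  linarith

/-- `N'` need not be bounded, only the quotient N'/D', since N/D - N'/D' = (N - N')/D - (N'/D')(D -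
D')/D. -/
theorem norm_div_sub_div_le {N D N' D' : ℂ} {y : ℝ} (hy : 0 < y) (hD : y ≤ ‖D‖) (hD' : y ≤ ‖D'‖)
    (hN' : y * ‖N'‖ ≤ ‖D'‖) :
    ‖N / D - N' / D'‖ ≤ y⁻¹ * ‖N - N'‖ + y⁻¹ ^ 2 * ‖D - D'‖ := by
  have hD0 : D ≠ 0 := norm_pos_iff.1 (hy.trans_le hD)
  have hD0' : D' ≠ 0 := norm_pos_iff.1 (hy.trans_le hD')
  have e : N / D - N' / D' = D⁻¹ * (N - N') - N' / D' * (D⁻¹ * (D - D')) := by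
    field_simp; ring
  have h1 : ‖D⁻¹‖ ≤ y⁻¹ := by rw [norm_inv]; gcongr
  have h2 : ‖N' / D'‖ ≤ y⁻¹ := by
    rw [norm_div, div_le_iff₀ (hy.trans_le hD'), inv_mul_eq_div, le_div_iff₀ hy, mul_comm]
    exact hN'
  rw [e]
  refine (norm_sub_le _ _).trans ?_
  rw [norm_mul, norm_mul, norm_mul, sq, mul_assoc]
  gcongr

/-- Approximation of the trace of the resolvent by a quantity where the quadratic forms of a part
of a row are replaced with deterministic values. -/
theorem norm_trace_resolvent_sub_approx_le (hA : A.IsSymm) (hz : 0 < z.im) {k : ι} {u v : ι → ℝ}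
    (huv : crossVec A k = u + v) {R : Matrix ι ι ℂ} (hR : R = resolvent (zeroCross A k) z)
    {τ₁ τ₂ : ℂ} (hτ : z.im * ‖τ₂‖ ≤ τ₁.im) :
    ‖(resolvent A z).trace - (R.trace + z⁻¹
        + (1 + (R *ᵥ complexify v) ⬝ᵥ (R *ᵥ complexify v) + τ₂)
          / (-z - complexify v ⬝ᵥ (R *ᵥ complexify v) - τ₁))‖
      ≤ z.im⁻¹ * (‖complexify u ⬝ᵥ ((R * R) *ᵥ complexify u) - τ₂‖
          + 2 * ‖complexify u ⬝ᵥ ((R * R) *ᵥ complexify v)‖)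
        + z.im⁻¹ ^ 2 * (|A k k| + ‖complexify u ⬝ᵥ (R *ᵥ complexify u) - τ₁‖
          + 2 * ‖complexify u ⬝ᵥ (R *ᵥ complexify v)‖) := by
  have hA0 := zeroCross_isSymm hA k
  have hRT : Rᵀ = R := by rw [hR]; exact resolvent_transpose hA0
  have hsymm : ∀ a b : ι → ℂ, a ⬝ᵥ (R *ᵥ b) = (R *ᵥ a) ⬝ᵥ b := fun a b => by
    rw [dotProduct_mulVec, ← mulVec_transpose, hRT]
  have him := im_dotProduct_resolvent hA0 hz v
  rw [← hR] at him
  have him' := im_schur_denom hA0 hz (A k k) (crossVec A k)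
  rw [← hR, huv] at him'
  rw [trace_resolvent_eq hA hz k, ← hR, add_sub_add_left_eq_sub, huv]
  set a := complexify u with ha
  set b := complexify v with hb
  rw [complexify_add, ← ha, ← hb] at him' ⊢
  set D := (A k k : ℂ) - z - (a + b) ⬝ᵥ (R *ᵥ (a + b)) with hD
  set D' := -z - b ⬝ᵥ (R *ᵥ b) - τ₁ with hD'
  have hDy : z.im ≤ ‖D‖ := by
    refine le_trans ?_ ((neg_le_abs _).trans (Complex.abs_im_le_norm D))
    rw [him', neg_neg]
    refine le_mul_of_one_le_right hz.le (le_add_of_nonneg_right ?_)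
    exact Finset.sum_nonneg fun _ _ => sq_nonneg _
  -- The hypothesis on τ₁ and τ₂ keeps the approximate denominator as large as the approximate
  -- numerator, as for genuine quadratic forms.
  have hDN' : z.im * (1 + ∑ i, ‖(R *ᵥ b) i‖ ^ 2 + ‖τ₂‖) ≤ ‖D'‖ := by
    refine le_trans ?_ ((neg_le_abs _).trans (Complex.abs_im_le_norm D'))
    rw [hD', Complex.sub_im, Complex.sub_im, Complex.neg_im, him]
    linarith
  have h0 : 0 ≤ ∑ i, ‖(R *ᵥ b) i‖ ^ 2 := Finset.sum_nonneg fun _ _ => sq_nonneg _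
  refine (norm_div_sub_div_le hz hDy (le_trans ?_ hDN') (le_trans ?_ hDN')).trans ?_
  · exact le_mul_of_one_le_right hz.le (by linarith [norm_nonneg τ₂])
  · refine mul_le_mul_of_nonneg_left ((norm_add_le _ _).trans ?_) hz.le
    exact add_le_add_left (norm_one_add_dotProduct_self_le _) _
  · have e1 : 1 + (R *ᵥ (a + b)) ⬝ᵥ (R *ᵥ (a + b)) - (1 + (R *ᵥ b) ⬝ᵥ (R *ᵥ b) + τ₂)
        = (a ⬝ᵥ ((R * R) *ᵥ a) - τ₂) + 2 * (a ⬝ᵥ ((R * R) *ᵥ b)) := by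
      rw [← mulVec_mulVec, ← mulVec_mulVec, hsymm a, hsymm a, mulVec_add, dotProduct_add,
        add_dotProduct, add_dotProduct, dotProduct_comm (R *ᵥ b) (R *ᵥ a)]
      ring
    have e2 : D - D' = (A k k : ℂ) - (a ⬝ᵥ (R *ᵥ a) - τ₁) - 2 * (a ⬝ᵥ (R *ᵥ b)) := by
      rw [hD, hD', mulVec_add, dotProduct_add, add_dotProduct, add_dotProduct, hsymm b a,
        dotProduct_comm (R *ᵥ b) a]
      ring
    rw [e1, e2]
    gcongr
    · refine (norm_add_le _ _).trans (le_of_eq ?_)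
      rw [norm_mul, Complex.norm_ofNat]
    · refine (norm_sub_le _ _).trans (add_le_add ((norm_sub_le _ _).trans (le_of_eq ?_))
        (le_of_eq ?_))
      · rw [Complex.norm_real, Real.norm_eq_abs]
      · rw [norm_mul, Complex.norm_ofNat]

end Resolvent
end RowIndep

namespace RowIndep

/-! ### Linear and quadratic forms of a random row. -/

section RowLaw

open Matrix

/-- A matrix of operator norm at most `1` for the Euclidean norms, in terms of its bilinear form. -/
def IsContractionForm {ι : Type*} [Fintype ι] (B : ι → ι → ℝ) : Prop :=
  ∀ x y : ι → ℝ, |∑ j, ∑ k, B j k * x j * y k| ≤ (∑ j, x j ^ 2 + ∑ k, y k ^ 2) / 2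

/-- The law of a row of length `n` with covariances `c`, whose quadratic forms with contraction
coefficients concentrate around their expectations. -/
structure RowLaw {n : ℕ} (μ : Measure (Fin n → ℝ)) (c : Fin n → Fin n → ℝ) (ε σ : ℝ) : Prop where
  memLp : ∀ j, MemLp (fun x : Fin n → ℝ => x j) 2 μ
  moment : ∀ j k, ∫ x, x j * x k ∂μ = c j k
  quad : ∀ B : Fin n → Fin n → ℝ, IsContractionForm B →
    ∫ x, |∑ j, ∑ k, B j k * (x j * x k - c j k)| ∂μ ≤ ε * n
  row : ∀ j, ∑ k, |c j k| ≤ ε ^ 2 * n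
  diag : ∀ j, c j j ≤ σ

/-- The complex matrix `M` has operator norm at most `K`. -/
def OpBound {ι : Type*} [Fintype ι] (M : Matrix ι ι ℂ) (K : ℝ) : Prop :=
  0 < K ∧ ∀ a : ι → ℂ, ∑ i, ‖(M *ᵥ a) i‖ ^ 2 ≤ K ^ 2 * ∑ i, ‖a i‖ ^ 2

theorem OpBound.mul {ι : Type*} [Fintype ι] {M N : Matrix ι ι ℂ} {K L : ℝ} (hM : OpBound M K)
    (hN : OpBound N L) : OpBound (M * N) (K * L) := by
  refine ⟨mul_pos hM.1 hN.1, fun a => ?_⟩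
  rw [← mulVec_mulVec]
  refine (hM.2 _).trans ?_
  rw [mul_pow, mul_assoc]
  exact mul_le_mul_of_nonneg_left (hN.2 a) (sq_nonneg _)

theorem opBound_resolvent {ι : Type*} [Fintype ι] [DecidableEq ι] {A : Matrix ι ι ℝ} {z : ℂ}
    (hA : A.IsSymm) (hz : 0 < z.im) : OpBound (resolvent A z) z.im⁻¹ :=
  ⟨inv_pos.2 hz, sum_sq_resolvent_le hA hz⟩

theorem dotProduct_mulVec_eq_sum {ι : Type*} [Fintype ι] (M : Matrix ι ι ℂ) (x y : ι → ℝ) :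
    complexify x ⬝ᵥ (M *ᵥ complexify y)
      = (∑ j, ∑ k, (M j k).re * x j * y k : ℝ) + (∑ j, ∑ k, (M j k).im * x j * y k : ℝ) * Complex.I := by
  simp only [dotProduct, mulVec, complexify, Complex.ofReal_sum, Finset.sum_mul, Finset.mul_sum,
    ← Finset.sum_add_distrib]
  refine Finset.sum_congr rfl fun j _ => Finset.sum_congr rfl fun k _ => ?_
  conv_lhs => rw [← Complex.re_add_im (M j k)]
  push_cast
  ring

theorem OpBound.norm_le {ι : Type*} [Fintype ι] {M : Matrix ι ι ℂ} {K : ℝ} (hM : OpBound M K)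
    (x y : ι → ℝ) : ‖complexify x ⬝ᵥ (M *ᵥ complexify y)‖ ≤ K * ((∑ j, x j ^ 2 + ∑ k, y k ^ 2) / 2) := by
  have h1 := norm_dotProduct_le (complexify x) (M *ᵥ complexify y) hM.1
  have h2 := hM.2 (complexify y)
  rw [sum_sq_complexify] at h1 h2
  have h3 : K⁻¹ * ∑ i, ‖(M *ᵥ complexify y) i‖ ^ 2 ≤ K⁻¹ * (K ^ 2 * ∑ k, y k ^ 2) :=
    mul_le_mul_of_nonneg_left h2 (inv_nonneg.2 hM.1.le)
  have h4 : K⁻¹ * (K ^ 2 * ∑ k, y k ^ 2) = K * ∑ k, y k ^ 2 := by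
    have := hM.1.ne'
    field_simp
  linarith

/-- On real vectors the real and imaginary parts of the form have coefficients Re M and Im M. The
multiplier `a` will be the indicator of the entries left of the diagonal. -/
theorem OpBound.isContractionForm {ι : Type*} [Fintype ι] {M : Matrix ι ι ℂ} {K : ℝ}
    (hM : OpBound M K) (a : ι → ℝ) (ha : ∀ i, a i ^ 2 ≤ 1) :
    IsContractionForm (fun j k => K⁻¹ * (M j k).re * (a j * a k)) ∧
      IsContractionForm (fun j k => K⁻¹ * (M j k).im * (a j * a k)) := by
  have hle : ∀ x : ι → ℝ, ∑ j, (a j * x j) ^ 2 ≤ ∑ j, x j ^ 2 := fun x =>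
    Finset.sum_le_sum fun j _ => by
      rw [mul_pow]; exact mul_le_of_le_one_left (sq_nonneg _) (ha j)
  have hnorm : ∀ x y : ι → ℝ, K⁻¹ * ‖complexify (fun j => a j * x j) ⬝ᵥ
      (M *ᵥ complexify (fun j => a j * y j))‖ ≤ (∑ j, x j ^ 2 + ∑ k, y k ^ 2) / 2 := fun x y => by
    have h := hM.norm_le (fun j => a j * x j) (fun j => a j * y j)
    rw [inv_mul_le_iff₀ hM.1]
    refine h.trans (mul_le_mul_of_nonneg_left ?_ hM.1.le)
    linarith [hle x, hle y]
  constructor <;> intro x y <;> refine le_trans ?_ (hnorm x y) <;>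
    rw [dotProduct_mulVec_eq_sum]
  · refine le_trans (le_of_eq ?_) (mul_le_mul_of_nonneg_left (Complex.abs_re_le_norm _)
      (inv_nonneg.2 hM.1.le))
    rw [Complex.add_re, Complex.ofReal_re, Complex.re_ofReal_mul, Complex.I_re, mul_zero, add_zero]
    nth_rewrite 2 [← abs_of_pos (inv_pos.2 hM.1)]
    rw [← abs_mul, Finset.mul_sum]
    refine congrArg _ (Finset.sum_congr rfl fun j _ => ?_)
    rw [Finset.mul_sum]
    exact Finset.sum_congr rfl fun k _ => by ring
  · refine le_trans (le_of_eq ?_) (mul_le_mul_of_nonneg_left (Complex.abs_im_le_norm _)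
      (inv_nonneg.2 hM.1.le))
    rw [Complex.add_im, Complex.ofReal_im, Complex.im_ofReal_mul, Complex.I_im, mul_one, zero_add]
    nth_rewrite 2 [← abs_of_pos (inv_pos.2 hM.1)]
    rw [← abs_mul, Finset.mul_sum]
    refine congrArg _ (Finset.sum_congr rfl fun j _ => ?_)
    rw [Finset.mul_sum]
    exact Finset.sum_congr rfl fun k _ => by ring

/-- The expectation of a quadratic form of a row. -/
noncomputable def quadMean {n : ℕ} (M : Matrix (Fin n) (Fin n) ℂ) (b : Fin n → ℝ)
    (c : Fin n → Fin n → ℝ) : ℂ := ∑ j, ∑ k, M j k * (b j * b k : ℝ) * (c j k : ℝ)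

theorem quadForm_eq_sum {n : ℕ} (M : Matrix (Fin n) (Fin n) ℂ) (b x : Fin n → ℝ) :
    complexify (fun j => b j * x j) ⬝ᵥ (M *ᵥ complexify fun j => b j * x j)
      = ∑ j, ∑ k, M j k * (b j * b k : ℝ) * (x j * x k : ℝ) := by
  simp only [dotProduct, mulVec, complexify, Finset.mul_sum]
  refine Finset.sum_congr rfl fun j _ => Finset.sum_congr rfl fun k _ => ?_
  push_cast
  ring

namespace RowLaw

variable {n : ℕ} {μ : Measure (Fin n → ℝ)} {c : Fin n → Fin n → ℝ} {ε σ : ℝ}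

theorem integrable_mul (h : RowLaw μ c ε σ) (j k : Fin n) :
    Integrable (fun x : Fin n → ℝ => x j * x k) μ :=
  (h.memLp j).integrable_mul (h.memLp k)

theorem memLp_sum (h : RowLaw μ c ε σ) (b : Fin n → ℝ) :
    MemLp (fun x : Fin n → ℝ => ∑ j, b j * x j) 2 μ :=
  memLp_finsetSum _ fun j _ => (h.memLp j).const_mul (b j)

/-- Schur's test: the absolute row sums of the symmetric covariance matrix bound its norm. -/
theorem integral_sq_sum_le (h : RowLaw μ c ε σ) (b : Fin n → ℝ) :
    ∫ x, (∑ j, b j * x j) ^ 2 ∂μ ≤ ε ^ 2 * n * ∑ j, b j ^ 2 := by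
  have hs : ∀ j k, c j k = c k j := fun j k => by
    rw [← h.moment, ← h.moment]; simp only [mul_comm]
  have e : ∀ x : Fin n → ℝ, (∑ j, b j * x j) ^ 2 = ∑ j, ∑ k, b j * b k * (x j * x k) := fun x => by
    rw [sq, Finset.sum_mul_sum]
    exact Finset.sum_congr rfl fun j _ => Finset.sum_congr rfl fun k _ => by ring
  simp only [e]
  rw [integral_finsetSum _ fun j _ => integrable_finsetSum _ fun k _ =>
    (h.integrable_mul j k).const_mul _]
  have e2 : ∀ j, ∫ x, ∑ k, b j * b k * (x j * x k) ∂μ = ∑ k, b j * b k * c j k := fun j => by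
    rw [integral_finsetSum _ fun k _ => (h.integrable_mul j k).const_mul _]
    simp only [integral_const_mul, h.moment]
  simp only [e2]
  calc ∑ j, ∑ k, b j * b k * c j k
      ≤ ∑ j, ∑ k, (b j ^ 2 * |c j k| / 2 + b k ^ 2 * |c k j| / 2) := by
        refine Finset.sum_le_sum fun j _ => Finset.sum_le_sum fun k _ => ?_
        rw [hs k j]
        refine (le_abs_self _).trans ?_
        rw [abs_mul]
        have h1 : |b j * b k| ≤ (b j ^ 2 + b k ^ 2) / 2 := by
          rw [abs_le]; constructor <;> nlinarith [sq_nonneg (b j + b k), sq_nonneg (b j - b k)]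
        nlinarith [mul_le_mul_of_nonneg_right h1 (abs_nonneg (c j k))]
    _ = ∑ j, b j ^ 2 * ∑ k, |c j k| := by
        simp only [Finset.sum_add_distrib]
        rw [Finset.sum_comm (f := fun j k => b k ^ 2 * |c k j| / 2), ← Finset.sum_add_distrib]
        refine Finset.sum_congr rfl fun j _ => ?_
        rw [← Finset.sum_add_distrib, Finset.mul_sum]
        exact Finset.sum_congr rfl fun k _ => by ring
    _ ≤ ∑ j, b j ^ 2 * (ε ^ 2 * n) :=
        Finset.sum_le_sum fun j _ => mul_le_mul_of_nonneg_left (h.row j) (sq_nonneg _)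
    _ = _ := by rw [← Finset.sum_mul, mul_comm]

theorem integrable_quadForm (h : RowLaw μ c ε σ) (M : Matrix (Fin n) (Fin n) ℂ) (b : Fin n → ℝ) :
    Integrable (fun x => complexify (fun j => b j * x j) ⬝ᵥ (M *ᵥ complexify fun j => b j * x j))
      μ := by
  simp only [quadForm_eq_sum]
  exact integrable_finsetSum _ fun j _ => integrable_finsetSum _ fun k _ =>
    ((h.integrable_mul j k).ofReal).const_mul _

theorem integral_quadForm (h : RowLaw μ c ε σ) (M : Matrix (Fin n) (Fin n) ℂ) (b : Fin n → ℝ) :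
    ∫ x, complexify (fun j => b j * x j) ⬝ᵥ (M *ᵥ complexify fun j => b j * x j) ∂μ
      = quadMean M b c := by
  simp only [quadForm_eq_sum, quadMean]
  rw [integral_finsetSum _ fun j _ => integrable_finsetSum _ fun k _ =>
    ((h.integrable_mul j k).ofReal).const_mul _]
  refine Finset.sum_congr rfl fun j _ => ?_
  rw [integral_finsetSum _ fun k _ => ((h.integrable_mul j k).ofReal).const_mul _]
  refine Finset.sum_congr rfl fun k _ => ?_
  rw [integral_const_mul, integral_complex_ofReal, h.moment]

variable [IsProbabilityMeasure μ]

theorem integral_abs_sum_le (h : RowLaw μ c ε σ) (hε : 0 < ε) (b : Fin n → ℝ) :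
    ∫ x, |∑ j, b j * x j| ∂μ ≤ ε / 2 + ε * (n * ∑ j, b j ^ 2) / 2 := by
  refine (integral_abs_le_of_integral_sq_le (h.memLp_sum b) hε (h.integral_sq_sum_le b)).trans
    (le_of_eq ?_)
  field_simp

theorem integrable_dotProduct (h : RowLaw μ c ε σ) (b : Fin n → ℝ) (w : Fin n → ℂ) :
    Integrable (fun x => complexify (fun j => b j * x j) ⬝ᵥ w) μ := by
  refine integrable_finsetSum _ fun j _ => Integrable.mul_const ?_ _
  exact (((h.memLp j).integrable one_le_two).const_mul _).ofReal

/-- First order estimate for a row: linear forms are small. -/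
theorem integral_norm_dotProduct_le (h : RowLaw μ c ε σ) (hε : 0 < ε) {s : ℝ} (hs : s ^ 2 * n ≤ 1)
    {a : Fin n → ℝ} (ha : ∀ i, a i ^ 2 ≤ 1) {w : Fin n → ℂ} {W : ℝ}
    (hw : ∑ i, ‖w i‖ ^ 2 ≤ W) :
    ∫ x, ‖complexify (fun j => s * a j * x j) ⬝ᵥ w‖ ∂μ ≤ ε * (1 + W / 2) := by
  have hle : ∀ x : Fin n → ℝ, ‖complexify (fun j => s * a j * x j) ⬝ᵥ w‖
      ≤ |∑ j, (s * a j * (w j).re) * x j| + |∑ j, (s * a j * (w j).im) * x j| := fun x => by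
    refine (Complex.norm_le_abs_re_add_abs_im _).trans (le_of_eq ?_)
    simp only [dotProduct, complexify, Complex.re_sum, Complex.im_sum, Complex.re_ofReal_mul,
      Complex.im_ofReal_mul]
    congr 2 <;> exact Finset.sum_congr rfl fun j _ => by ring
  have hI : ∀ b : Fin n → ℝ, Integrable (fun x : Fin n → ℝ => |∑ j, b j * x j|) μ := fun b =>
    ((h.memLp_sum b).integrable one_le_two).abs
  have hsum : n * ∑ j, (s * a j * (w j).re) ^ 2 + n * ∑ j, (s * a j * (w j).im) ^ 2 ≤ W := by
    refine le_trans ?_ hw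
    rw [Finset.mul_sum, Finset.mul_sum, ← Finset.sum_add_distrib]
    refine Finset.sum_le_sum fun j _ => ?_
    rw [← Complex.normSq_eq_norm_sq, Complex.normSq_apply]
    have h1 : s ^ 2 * n * a j ^ 2 ≤ 1 := mul_le_one₀ hs (sq_nonneg _) (ha j)
    have h2 : 0 ≤ (w j).re * (w j).re + (w j).im * (w j).im :=
      add_nonneg (mul_self_nonneg _) (mul_self_nonneg _)
    nlinarith [mul_le_mul_of_nonneg_right h1 h2]
  calc _ ≤ ∫ x, (|∑ j, (s * a j * (w j).re) * x j| + |∑ j, (s * a j * (w j).im) * x j|) ∂μ :=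
        integral_mono (h.integrable_dotProduct _ w).norm ((hI _).add (hI _)) hle
    _ ≤ _ := by
        rw [integral_add (hI _) (hI _)]
        have h1 := h.integral_abs_sum_le hε fun j => s * a j * (w j).re
        have h2 := h.integral_abs_sum_le hε fun j => s * a j * (w j).im
        nlinarith [mul_le_mul_of_nonneg_left hsum hε.le]

/-- Second order estimate for a row: quadratic forms concentrate. -/
theorem integral_norm_quadForm_sub_le (h : RowLaw μ c ε σ) {s : ℝ} (hs : s ^ 2 * n ≤ 1)
    (hε : 0 < ε) {a : Fin n → ℝ} (ha : ∀ i, a i ^ 2 ≤ 1) {M : Matrix (Fin n) (Fin n) ℂ} {K : ℝ}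
    (hM : OpBound M K) :
    ∫ x, ‖complexify (fun j => s * a j * x j) ⬝ᵥ (M *ᵥ complexify fun j => s * a j * x j)
      - quadMean M (fun j => s * a j) c‖ ∂μ ≤ 2 * (ε * K) := by
  obtain ⟨h1, h2⟩ := hM.isContractionForm a ha
  set B₁ : Fin n → Fin n → ℝ := fun j k => K⁻¹ * (M j k).re * (a j * a k) with hB₁
  set B₂ : Fin n → Fin n → ℝ := fun j k => K⁻¹ * (M j k).im * (a j * a k) with hB₂
  have hK := hM.1.ne'
  have hle : ∀ x : Fin n → ℝ, ‖complexify (fun j => s * a j * x j) ⬝ᵥ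
        (M *ᵥ complexify fun j => s * a j * x j) - quadMean M (fun j => s * a j) c‖
      ≤ K * s ^ 2 * (|∑ j, ∑ k, B₁ j k * (x j * x k - c j k)|
        + |∑ j, ∑ k, B₂ j k * (x j * x k - c j k)|) := fun x => by
    have e : complexify (fun j => s * a j * x j) ⬝ᵥ
        (M *ᵥ complexify fun j => s * a j * x j) - quadMean M (fun j => s * a j) c
        = (K * s ^ 2 : ℝ) * ((∑ j, ∑ k, B₁ j k * (x j * x k - c j k) : ℝ)
          + (∑ j, ∑ k, B₂ j k * (x j * x k - c j k) : ℝ) * Complex.I) := by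
      rw [quadForm_eq_sum, quadMean, ← Finset.sum_sub_distrib, Complex.ofReal_sum,
        Complex.ofReal_sum, Finset.sum_mul, ← Finset.sum_add_distrib, Finset.mul_sum]
      refine Finset.sum_congr rfl fun j _ => ?_
      rw [← Finset.sum_sub_distrib, Complex.ofReal_sum, Complex.ofReal_sum, Finset.sum_mul,
        ← Finset.sum_add_distrib, Finset.mul_sum]
      refine Finset.sum_congr rfl fun k _ => ?_
      conv_lhs => rw [← Complex.re_add_im (M j k)]
      have hKc : (K : ℂ) ≠ 0 := by exact_mod_cast hK
      simp only [hB₁, hB₂]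
      push_cast
      field_simp
    rw [e, norm_mul, Complex.norm_real, Real.norm_of_nonneg (by have := hM.1; positivity)]
    refine mul_le_mul_of_nonneg_left ((norm_add_le _ _).trans (le_of_eq ?_))
      (by have := hM.1; positivity)
    rw [norm_mul, Complex.norm_I, mul_one, Complex.norm_real, Complex.norm_real, Real.norm_eq_abs,
      Real.norm_eq_abs]
  have hI : ∀ B : Fin n → Fin n → ℝ,
      Integrable (fun x : Fin n → ℝ => |∑ j, ∑ k, B j k * (x j * x k - c j k)|) μ := fun B =>
    (integrable_finsetSum _ fun j _ => integrable_finsetSum _ fun k _ =>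
      ((h.integrable_mul j k).sub (integrable_const _)).const_mul _).abs
  calc _ ≤ ∫ x, K * s ^ 2 * (|∑ j, ∑ k, B₁ j k * (x j * x k - c j k)|
        + |∑ j, ∑ k, B₂ j k * (x j * x k - c j k)|) ∂μ :=
        integral_mono ((h.integrable_quadForm M _).sub (integrable_const _)).norm
          (((hI _).add (hI _)).const_mul _) hle
    _ ≤ K * s ^ 2 * (ε * n + ε * n) := by
        rw [integral_const_mul, integral_add (hI _) (hI _)]
        exact mul_le_mul_of_nonneg_left (add_le_add (h.quad _ h1) (h.quad _ h2))
          (by have := hM.1; positivity)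
    _ = 2 * (ε * K) * (s ^ 2 * n) := by ring
    _ ≤ _ := mul_le_of_le_one_right (by have := hM.1; positivity) hs

end RowLaw

end RowLaw
end RowIndep

namespace RowIndep

/-! ### Lindeberg replacement in product measures. -/

section Product

variable {ι E : Type*} [DecidableEq ι] [MeasurableSpace E]

theorem isProbabilityMeasure_update {μ : ι → Measure E} [∀ i, IsProbabilityMeasure (μ i)] (k : ι)
    {α : Measure E} [IsProbabilityMeasure α] (i : ι) :
    IsProbabilityMeasure (Function.update μ k α i) := by
  by_cases h : i = k
  · subst h; simpa
  · rw [Function.update_of_ne h]; infer_instance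

variable [Fintype ι]

/-- Overwriting coordinate `k` forgets `μ k`, so the factor `k` may be resampled from any law. -/
theorem measurePreserving_update (μ : ι → Measure E) [∀ i, IsProbabilityMeasure (μ i)] (k : ι)
    (α : Measure E) [IsProbabilityMeasure α] :
    MeasurePreserving (fun p : (ι → E) × E => Function.update p.1 k p.2)
      ((Measure.pi μ).prod α) (Measure.pi (Function.update μ k α)) := by
  have := isProbabilityMeasure_update (μ := μ) k (α := α)
  have hm : Measurable fun p : (ι → E) × E => Function.update p.1 k p.2 := by
    rw [measurable_pi_iff]
    intro i
    by_cases h : i = k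
    · subst h; simpa using measurable_snd
    · simp only [Function.update_of_ne h]; fun_prop
  refine ⟨hm, (Measure.pi_eq fun s hs => ?_).symm⟩
  rw [Measure.map_apply hm (MeasurableSet.univ_pi hs)]
  have e : (fun p : (ι → E) × E => Function.update p.1 k p.2) ⁻¹' (Set.univ.pi s)
      = (Set.univ.pi (Function.update s k Set.univ)) ×ˢ (s k) := by
    ext ⟨x, r⟩
    simp only [Set.mem_preimage, Set.mem_univ_pi, Set.mem_prod]
    constructor
    · intro h
      refine ⟨fun i => ?_, by simpa using h k⟩
      by_cases hi : i = k
      · subst hi; simp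
      · simpa [hi] using h i
    · rintro ⟨h1, h2⟩ i
      by_cases hi : i = k
      · subst hi; simpa
      · simpa [hi] using h1 i
  rw [e, Measure.prod_prod, Measure.pi_pi, ← Finset.mul_prod_erase _ _ (Finset.mem_univ k),
    ← Finset.mul_prod_erase _ _ (Finset.mem_univ k), Function.update_self, Function.update_self,
    measure_univ, one_mul, mul_comm]
  refine congrArg _ (Finset.prod_congr rfl fun i hi => ?_)
  rw [Function.update_of_ne (Finset.ne_of_mem_erase hi),
    Function.update_of_ne (Finset.ne_of_mem_erase hi)]

variable {f : (ι → E) → ℂ} {C : ℝ}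

theorem integrable_of_bounded {X : Type*} [MeasurableSpace X] {μ : Measure X}
    [IsProbabilityMeasure μ] {f : X → ℂ} (hf : Measurable f) (hC : ∀ x, ‖f x‖ ≤ C) :
    Integrable f μ :=
  Integrable.of_bound hf.aestronglyMeasurable C (ae_of_all _ hC)

theorem integral_pi_update (μ : ι → Measure E) [∀ i, IsProbabilityMeasure (μ i)] (k : ι)
    (α : Measure E) [IsProbabilityMeasure α] (hf : Measurable f) (hC : ∀ x, ‖f x‖ ≤ C) :
    Integrable (fun x => ∫ r, f (Function.update x k r) ∂α) (Measure.pi μ) ∧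
    ∫ x, f x ∂(Measure.pi (Function.update μ k α))
      = ∫ x, ∫ r, f (Function.update x k r) ∂α ∂(Measure.pi μ) := by
  have h := measurePreserving_update μ k α
  have hi : Integrable (fun p : (ι → E) × E => f (Function.update p.1 k p.2))
      ((Measure.pi μ).prod α) := integrable_of_bounded (hf.comp h.measurable) fun _ => hC _
  refine ⟨hi.integral_prod_left, ?_⟩
  rw [← integral_prod _ hi, ← h.map_eq, integral_map h.measurable.aemeasurable
    hf.aestronglyMeasurable]

/-- Lindeberg's replacement of the factors of a product measure, one by one. -/
theorem norm_integral_pi_sub_le {μ ν : ι → Measure E} [∀ i, IsProbabilityMeasure (μ i)]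
    [∀ i, IsProbabilityMeasure (ν i)] (hf : Measurable f) (hC : ∀ x, ‖f x‖ ≤ C)
    {V : ι → (ι → E) → ℝ} {δ : ℝ}
    (hV : ∀ k x, ‖∫ r, f (Function.update x k r) ∂(μ k) - ∫ r, f (Function.update x k r) ∂(ν k)‖
      ≤ V k x)
    (hδ : ∀ (ρ : ι → Measure E), (∀ i, IsProbabilityMeasure (ρ i)) → (∀ i, ρ i = μ i ∨ ρ i = ν i) →
      ∀ k, Integrable (V k) (Measure.pi ρ) ∧ ∫ x, V k x ∂(Measure.pi ρ) ≤ δ) :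
    ‖∫ x, f x ∂(Measure.pi μ) - ∫ x, f x ∂(Measure.pi ν)‖ ≤ Fintype.card ι * δ := by
  -- Induction over the set of coordinates already replaced; its mixed products are the reason why
  -- `hδ` ranges over all ρ.
  have key : ∀ s : Finset ι, ‖∫ x, f x ∂(Measure.pi μ)
      - ∫ x, f x ∂(Measure.pi (s.piecewise ν μ))‖ ≤ s.card * δ := fun s => by
    induction s using Finset.induction_on with
    | empty => simp
    | insert k s hk ih =>
      set ρ := s.piecewise ν μ with hρ
      have hρ' : ∀ i, ρ i = μ i ∨ ρ i = ν i := fun i => by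
        by_cases hi : i ∈ s
        · exact Or.inr (Finset.piecewise_eq_of_mem _ _ _ hi)
        · exact Or.inl (Finset.piecewise_eq_of_notMem _ _ _ hi)
      have hρp : ∀ i, IsProbabilityMeasure (ρ i) := fun i => by
        rcases hρ' i with h | h <;> rw [h] <;> infer_instance
      have hρk : ρ = Function.update ρ k (μ k) := by
        rw [← Finset.piecewise_eq_of_notMem s ν μ hk, ← hρ, Function.update_eq_self]
      obtain ⟨i1, e1⟩ := integral_pi_update ρ k (μ k) hf hC
      obtain ⟨i2, e2⟩ := integral_pi_update ρ k (ν k) hf hC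
      obtain ⟨hVi, hVδ⟩ := hδ ρ hρp hρ' k
      have step : ‖∫ x, f x ∂(Measure.pi ρ)
          - ∫ x, f x ∂(Measure.pi (Function.update ρ k (ν k)))‖ ≤ δ := by
        rw [e2]
        nth_rewrite 1 [hρk]
        rw [e1, ← integral_sub i1 i2]
        exact (norm_integral_le_of_norm_le hVi (ae_of_all _ (hV k))).trans hVδ
      rw [Finset.piecewise_insert, ← hρ, Finset.card_insert_of_notMem hk, Nat.cast_add,
        Nat.cast_one, add_mul, one_mul]
      exact (norm_sub_le_norm_sub_add_norm_sub _ _ _).trans (add_le_add ih step)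
  have h := key Finset.univ
  rwa [Finset.piecewise_univ, Finset.card_univ] at h

end Product

/-! ### Replacing one row of the matrix. -/

section RowMatrix

open Matrix

variable {n : ℕ} {z : ℂ}

/-- The normalized symmetric matrix whose rows, up to the diagonal, are given. -/
noncomputable def rowMatrix (x : Fin n → Fin n → ℝ) : Matrix (Fin n) (Fin n) ℝ :=
  (Real.sqrt n)⁻¹ • Matrix.of fun i j => if j ≤ i then x i j else x j i

/-- The trace of the resolvent as a function of the rows. -/
noncomputable def rowTrace (z : ℂ) (x : Fin n → Fin n → ℝ) : ℂ := (resolvent (rowMatrix x) z).trace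

theorem rowMatrix_isSymm (x : Fin n → Fin n → ℝ) : (rowMatrix x).IsSymm := by
  ext i j
  simp only [rowMatrix, Matrix.transpose_apply, Matrix.smul_apply, Matrix.of_apply]
  rcases lt_trichotomy i j with h | h | h
  · simp [h.le, h.not_ge]
  · simp [h]
  · simp [h.le, h.not_ge]

theorem zeroCross_rowMatrix_update (x : Fin n → Fin n → ℝ) (k : Fin n) (r : Fin n → ℝ) :
    zeroCross (rowMatrix (Function.update x k r)) k = zeroCross (rowMatrix x) k := by
  ext i j
  simp only [zeroCross, Matrix.of_apply, rowMatrix, Matrix.smul_apply]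
  by_cases h : i = k ∨ j = k
  · simp [h]
  · have hi : i ≠ k := fun h' => h (Or.inl h')
    have hj : j ≠ k := fun h' => h (Or.inr h')
    simp [hi, hj]

/-- The part of the row of index `k` of the matrix that comes from the other rows. -/
noncomputable def outerRow (x : Fin n → Fin n → ℝ) (k : Fin n) : Fin n → ℝ := fun j =>
  if k < j then (Real.sqrt n)⁻¹ * x j k else 0

/-- Entries left of the diagonal come from the new row `r`, those to the right from the other rows:
the former are random, the latter frozen. -/
theorem crossVec_rowMatrix_update (x : Fin n → Fin n → ℝ) (k : Fin n) (r : Fin n → ℝ) :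
    crossVec (rowMatrix (Function.update x k r)) k
      = (fun j => (Real.sqrt n)⁻¹ * (if j < k then 1 else 0) * r j) + outerRow x k := by
  ext j
  simp only [crossVec, rowMatrix, outerRow, Matrix.smul_apply, Matrix.of_apply, Pi.add_apply,
    smul_eq_mul]
  rcases lt_trichotomy j k with h | h | h
  · simp [h, h.ne, h.le, h.not_gt]
  · simp [h]
  · simp [h, h.ne', h.not_ge, h.not_gt]

theorem continuous_rowTrace (hz : 0 < z.im) : Continuous (rowTrace (n := n) z) := by
  have h1 : Continuous fun x : Fin n → Fin n → ℝ =>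
      (rowMatrix x).map (fun t : ℝ => (t : ℂ)) - z • (1 : Matrix (Fin n) (Fin n) ℂ) := by
    refine Continuous.sub (continuous_matrix fun i j => ?_) continuous_const
    simp only [rowMatrix, Matrix.map_apply, Matrix.smul_apply, Matrix.of_apply]
    by_cases h : j ≤ i <;> simp only [h, if_true, if_false] <;> fun_prop
  refine Continuous.matrix_trace ?_
  simp only [resolvent, Matrix.inv_def, Ring.inverse_eq_inv']
  exact (h1.matrix_det.inv₀ fun x => (isUnit_det_sub (rowMatrix_isSymm x) hz).ne_zero).smul
    h1.matrix_adjugate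

theorem norm_rowTrace_le (hz : 0 < z.im) (x : Fin n → Fin n → ℝ) :
    ‖rowTrace z x‖ ≤ n * z.im⁻¹ := by
  rw [rowTrace, Matrix.trace]
  refine (norm_sum_le _ _).trans ?_
  have h : ∀ i, ‖resolvent (rowMatrix x) z i i‖ ≤ z.im⁻¹ := fun i => by
    have h := sum_sq_resolvent_le (rowMatrix_isSymm x) hz (Pi.single i 1)
    have h2 : ∑ j, ‖(Pi.single i 1 : Fin n → ℂ) j‖ ^ 2 = 1 := by
      rw [Finset.sum_eq_single i] <;> simp +contextual
    rw [h2, mul_one, mulVec_single_one] at h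
    have h3 := Finset.single_le_sum
      (f := fun j => ‖(resolvent (rowMatrix x) z).col i j‖ ^ 2) (fun _ _ => sq_nonneg _)
      (Finset.mem_univ i)
    exact le_of_sq_le_sq (h3.trans h) (inv_nonneg.2 hz.le)
  refine (Finset.sum_le_sum fun i _ => h i).trans (le_of_eq ?_)
  simp

theorem norm_rowTrace_update_sub_le (hz : 0 < z.im) (x : Fin n → Fin n → ℝ) (k : Fin n)
    (r : Fin n → ℝ) : ‖rowTrace z (Function.update x k r) - rowTrace z x‖ ≤ 2 * z.im⁻¹ :=
  norm_trace_resolvent_sub_le (rowMatrix_isSymm _) (rowMatrix_isSymm _) hz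
    (zeroCross_rowMatrix_update x k r)

theorem inv_sqrt_sq_mul_le (n : ℕ) : (Real.sqrt n)⁻¹ ^ 2 * n ≤ 1 := by
  rw [inv_pow, Real.sq_sqrt n.cast_nonneg]
  exact inv_mul_le_one

theorem integral_combination_le {X : Type*} [MeasurableSpace X] {μ : Measure X}
    {f₁ f₂ f₃ f₄ f₅ : X → ℝ} (i₁ : Integrable f₁ μ) (i₂ : Integrable f₂ μ) (i₃ : Integrable f₃ μ)
    (i₄ : Integrable f₄ μ) (i₅ : Integrable f₅ μ) {b₁ b₂ b₃ b₄ b₅ q : ℝ} (h₁ : ∫ x, f₁ x ∂μ ≤ b₁)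
    (h₂ : ∫ x, f₂ x ∂μ ≤ b₂) (h₃ : ∫ x, f₃ x ∂μ ≤ b₃) (h₄ : ∫ x, f₄ x ∂μ ≤ b₄)
    (h₅ : ∫ x, f₅ x ∂μ ≤ b₅) (hq : 0 ≤ q) :
    Integrable (fun x => q * (f₁ x + 2 * f₂ x) + q ^ 2 * (f₃ x + f₄ x + 2 * f₅ x)) μ ∧
      ∫ x, (q * (f₁ x + 2 * f₂ x) + q ^ 2 * (f₃ x + f₄ x + 2 * f₅ x)) ∂μ
        ≤ q * (b₁ + 2 * b₂) + q ^ 2 * (b₃ + b₄ + 2 * b₅) := by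
  have j₁ : Integrable (fun x => f₁ x + 2 * f₂ x) μ := i₁.add (i₂.const_mul 2)
  have j₂ : Integrable (fun x => f₃ x + f₄ x) μ := i₃.add i₄
  have j₃ : Integrable (fun x => f₃ x + f₄ x + 2 * f₅ x) μ := j₂.add (i₅.const_mul 2)
  refine ⟨(j₁.const_mul q).add (j₃.const_mul (q ^ 2)), ?_⟩
  rw [integral_add (j₁.const_mul q) (j₃.const_mul (q ^ 2)), integral_const_mul, integral_const_mul,
    integral_add i₁ (i₂.const_mul 2), integral_add j₂ (i₅.const_mul 2), integral_add i₃ i₄,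
    integral_const_mul, integral_const_mul]
  gcongr

/-- The effect on the expectation of the trace of the resolvent of replacing the law of a row with
another law having the same covariances. -/
theorem norm_integral_rowTrace_sub_le (hz : 0 < z.im) {α β : Measure (Fin n → ℝ)}
    [IsProbabilityMeasure α] [IsProbabilityMeasure β] {c : Fin n → Fin n → ℝ} {ε σ : ℝ}
    (hε : 0 < ε) (hα : RowLaw α c ε σ) (hβ : RowLaw β c ε σ) (x : Fin n → Fin n → ℝ) (k : Fin n) :
    ‖∫ r, rowTrace z (Function.update x k r) ∂α - ∫ r, rowTrace z (Function.update x k r) ∂β‖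
      ≤ 2 * (ε * (z.im⁻¹ * (2 * z.im⁻¹ ^ 2 + 2 + z.im⁻¹ ^ 4 * ∑ j, outerRow x k j ^ 2)
        + z.im⁻¹ ^ 2 * (3 + 2 * z.im⁻¹ + z.im⁻¹ ^ 2 * ∑ j, outerRow x k j ^ 2))) := by
  set q := z.im⁻¹ with hq
  have hq0 : 0 < q := inv_pos.2 hz
  set s := (Real.sqrt n)⁻¹ with hs
  have hsn : s ^ 2 * n ≤ 1 := inv_sqrt_sq_mul_le n
  set a : Fin n → ℝ := fun j => if j < k then 1 else 0 with ha
  have ha1 : ∀ j, a j ^ 2 ≤ 1 := fun j => by simp only [ha]; split_ifs <;> norm_num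
  set v := outerRow x k with hv
  set S := ∑ j, v j ^ 2 with hS
  set R := resolvent (zeroCross (rowMatrix x) k) z with hR
  have hA0 : (zeroCross (rowMatrix x) k).IsSymm := zeroCross_isSymm (rowMatrix_isSymm x) k
  have hRb : OpBound R q := opBound_resolvent hA0 hz
  have hRRb : OpBound (R * R) (q * q) := hRb.mul hRb
  set τ₁ := quadMean R (fun j => s * a j) c with hτ₁
  set τ₂ := quadMean (R * R) (fun j => s * a j) c with hτ₂
  set u : (Fin n → ℝ) → Fin n → ℝ := fun r j => s * a j * r j with hu
  have hRT : Rᵀ = R := resolvent_transpose hA0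
  -- Pointwise Im z |u·R²u| ≤ Im z ‖Ru‖² = Im(u·Ru). Since τ₁ and τ₂ are means of these forms, the
  -- inequality survives integration.
  have hτ : z.im * ‖τ₂‖ ≤ τ₁.im := by
    rw [hτ₁, hτ₂, ← hα.integral_quadForm R, ← hα.integral_quadForm (R * R)]
    have i1 := hα.integrable_quadForm R fun j => s * a j
    have i2 := hα.integrable_quadForm (R * R) fun j => s * a j
    have e := integral_im i1
    simp only [RCLike.im_to_complex] at e
    rw [← e]
    refine (mul_le_mul_of_nonneg_left (norm_integral_le_integral_norm _) hz.le).trans ?_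
    rw [← integral_const_mul]
    refine integral_mono (i2.norm.const_mul _) i1.im fun r => ?_
    have h1 := im_dotProduct_resolvent hA0 hz (u r)
    rw [← hR] at h1
    have h2 : complexify (u r) ⬝ᵥ ((R * R) *ᵥ complexify (u r))
        = (R *ᵥ complexify (u r)) ⬝ᵥ (R *ᵥ complexify (u r)) := by
      rw [← mulVec_mulVec, dotProduct_mulVec, ← mulVec_transpose, hRT]
    have h3 := norm_dotProduct_le (R *ᵥ complexify (u r)) (R *ᵥ complexify (u r)) one_pos
    change z.im * ‖complexify (u r) ⬝ᵥ ((R * R) *ᵥ complexify (u r))‖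
      ≤ (complexify (u r) ⬝ᵥ (R *ᵥ complexify (u r))).im
    rw [h1, h2]
    refine mul_le_mul_of_nonneg_left (h3.trans (le_of_eq ?_)) hz.le
    rw [inv_one]; ring
  -- `g` depends only on the covariances and on the other rows, so it is a common approximation for
  -- α and β.
  set g := R.trace + z⁻¹ + (1 + (R *ᵥ complexify v) ⬝ᵥ (R *ᵥ complexify v) + τ₂)
          / (-z - complexify v ⬝ᵥ (R *ᵥ complexify v) - τ₁) with hg
  have hW₁ : ∑ i, ‖(R *ᵥ complexify v) i‖ ^ 2 ≤ q ^ 2 * S := by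
    have h := hRb.2 (complexify v); rwa [sum_sq_complexify] at h
  have hW₂ : ∑ i, ‖((R * R) *ᵥ complexify v) i‖ ^ 2 ≤ (q * q) ^ 2 * S := by
    have h := hRRb.2 (complexify v); rwa [sum_sq_complexify] at h
  have key : ∀ μ : Measure (Fin n → ℝ), IsProbabilityMeasure μ → RowLaw μ c ε σ →
      ‖∫ r, rowTrace z (Function.update x k r) ∂μ - g‖
        ≤ ε * (q * (2 * q ^ 2 + 2 + q ^ 4 * S) + q ^ 2 * (3 + 2 * q + q ^ 2 * S)) := by
    intro μ _ hμ
    have hcont : Continuous fun r => rowTrace z (Function.update x k r) :=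
      (continuous_rowTrace hz).comp (continuous_const.update k continuous_id)
    have hint : Integrable (fun r => rowTrace z (Function.update x k r)) μ :=
      integrable_of_bounded hcont.measurable fun r => norm_rowTrace_le hz _
    have e : ∫ r, rowTrace z (Function.update x k r) ∂μ - g
        = ∫ r, (rowTrace z (Function.update x k r) - g) ∂μ := by
      rw [integral_sub hint (integrable_const _)]; simp
    have hdiag : ∀ r : Fin n → ℝ, |rowMatrix (Function.update x k r) k k|
        = |∑ j, (Pi.single k s : Fin n → ℝ) j * r j| := fun r => by
      simp [rowMatrix, Pi.single_apply, hs]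
    have hle : ∀ r, ‖rowTrace z (Function.update x k r) - g‖
        ≤ q * (‖complexify (u r) ⬝ᵥ ((R * R) *ᵥ complexify (u r)) - τ₂‖
            + 2 * ‖complexify (u r) ⬝ᵥ ((R * R) *ᵥ complexify v)‖)
          + q ^ 2 * (|∑ j, (Pi.single k s : Fin n → ℝ) j * r j|
            + ‖complexify (u r) ⬝ᵥ (R *ᵥ complexify (u r)) - τ₁‖
            + 2 * ‖complexify (u r) ⬝ᵥ (R *ᵥ complexify v)‖) := fun r => by
      rw [← hdiag]
      refine norm_trace_resolvent_sub_approx_le (rowMatrix_isSymm _) hz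
        (crossVec_rowMatrix_update x k r) ?_ hτ
      rw [zeroCross_rowMatrix_update]
    have i1 := ((hμ.integrable_quadForm (R * R) fun j => s * a j).sub
      (integrable_const τ₂)).norm
    have i2 := (hμ.integrable_dotProduct (fun j => s * a j) ((R * R) *ᵥ complexify v)).norm
    have i3 := ((hμ.memLp_sum (Pi.single k s)).integrable one_le_two).abs
    have i4 := ((hμ.integrable_quadForm R fun j => s * a j).sub (integrable_const τ₁)).norm
    have i5 := (hμ.integrable_dotProduct (fun j => s * a j) (R *ᵥ complexify v)).norm
    have b1 := hμ.integral_norm_quadForm_sub_le hsn hε ha1 hRRb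
    have b2 := hμ.integral_norm_dotProduct_le hε hsn ha1 hW₂
    have b3 := hμ.integral_abs_sum_le hε (Pi.single k s)
    have b4 := hμ.integral_norm_quadForm_sub_le hsn hε ha1 hRb
    have b5 := hμ.integral_norm_dotProduct_le hε hsn ha1 hW₁
    have b3' : ∫ r, |∑ j, (Pi.single k s : Fin n → ℝ) j * r j| ∂μ ≤ ε := by
      refine b3.trans ?_
      have h1 : ∑ j, (Pi.single k s : Fin n → ℝ) j ^ 2 = s ^ 2 := by
        rw [Finset.sum_eq_single k] <;> simp +contextual
      rw [h1, mul_comm (n : ℝ)]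
      nlinarith [mul_le_mul_of_nonneg_left hsn hε.le]
    rw [e]
    obtain ⟨hci, hcb⟩ := integral_combination_le i1 i2 i3 i4 i5 b1 b2 b3' b4 b5 hq0.le
    refine (norm_integral_le_of_norm_le hci (ae_of_all _ hle)).trans (hcb.trans (le_of_eq ?_))
    ring
  have h1 := key α inferInstance hα
  have h2 := key β inferInstance hβ
  rw [norm_sub_rev] at h2
  refine (norm_sub_le_norm_sub_add_norm_sub _ g _).trans ((add_le_add h1 h2).trans (le_of_eq ?_))
  ring

end RowMatrix
end RowIndep

namespace RowIndep

/-! ### Replacing all rows. -/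

section Comparison

variable {n : ℕ} {z : ℂ}

/-- Comparison of the expected traces for two families of independent rows with the same
covariances. -/
theorem norm_integral_rowTrace_pi_sub_le (hz : 0 < z.im) {μ ν : Fin n → Measure (Fin n → ℝ)}
    [∀ i, IsProbabilityMeasure (μ i)] [∀ i, IsProbabilityMeasure (ν i)] {c : Fin n → Fin n → ℝ}
    {ε σ : ℝ} (hε : 0 < ε) (hμ : ∀ i, RowLaw (μ i) c ε σ) (hν : ∀ i, RowLaw (ν i) c ε σ) :
    ‖∫ x, rowTrace z x ∂(Measure.pi μ) - ∫ x, rowTrace z x ∂(Measure.pi ν)‖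
      ≤ n * (2 * (ε * (z.im⁻¹ * (2 * z.im⁻¹ ^ 2 + 2 + z.im⁻¹ ^ 4 * σ)
        + z.im⁻¹ ^ 2 * (3 + 2 * z.im⁻¹ + z.im⁻¹ ^ 2 * σ)))) := by
  set q := z.im⁻¹ with hq
  have hq0 : 0 < q := inv_pos.2 hz
  have h := norm_integral_pi_sub_le (μ := μ) (ν := ν) (continuous_rowTrace hz).measurable
    (norm_rowTrace_le hz)
    (V := fun k x => 2 * (ε * (q * (2 * q ^ 2 + 2 + q ^ 4 * ∑ j, outerRow x k j ^ 2)
        + q ^ 2 * (3 + 2 * q + q ^ 2 * ∑ j, outerRow x k j ^ 2)))) (δ := 2 * (ε * (q * (2 * q ^ 2 + 2 + q ^ 4 * σ)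
        + q ^ 2 * (3 + 2 * q + q ^ 2 * σ))))
    (fun k x => norm_integral_rowTrace_sub_le hz hε (hμ k) (hν k) x k) fun ρ hρ hρ' k => ?_
  · rwa [Fintype.card_fin] at h
  -- Every mixed product has rows with the same covariances, so the mean squared norm of the frozen
  -- part is at most σ throughout the replacement.
  have hlaw : ∀ i, RowLaw (ρ i) c ε σ := fun i => by
    rcases hρ' i with h | h <;> rw [h]
    exacts [hμ i, hν i]
  have hev : ∀ j, MeasurePreserving (Function.eval j) (Measure.pi ρ) (ρ j) := fun j =>
    measurePreserving_eval ρ j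
  have hi : ∀ j, Integrable (fun x : Fin n → Fin n → ℝ => x j k * x j k) (Measure.pi ρ) := fun j =>
    ((hev j).integrable_comp (g := fun r : Fin n → ℝ => r k * r k) (by fun_prop)).2
      ((hlaw j).integrable_mul k k)
  have hm : ∀ j, ∫ x : Fin n → Fin n → ℝ, x j k * x j k ∂(Measure.pi ρ) ≤ σ := fun j => by
    have h1 : ∫ x : Fin n → Fin n → ℝ, x j k * x j k ∂(Measure.pi ρ) = c k k := by
      rw [← (hlaw j).moment, ← (hev j).map_eq,
        integral_map (hev j).measurable.aemeasurable (by fun_prop)]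
    rw [h1]; exact (hlaw j).diag k
  have hσ : 0 ≤ σ := (integral_nonneg fun x => mul_self_nonneg _).trans (hm k)
  set s := (Real.sqrt n)⁻¹ with hs
  have hsq : ∀ x : Fin n → Fin n → ℝ, ∑ j, outerRow x k j ^ 2
      = ∑ j, (if k < j then s ^ 2 else 0) * (x j k * x j k) := fun x =>
    Finset.sum_congr rfl fun j _ => by
      simp only [outerRow]; split_ifs
      · ring
      · simp
  have hSi : Integrable (fun x : Fin n → Fin n → ℝ => ∑ j, outerRow x k j ^ 2) (Measure.pi ρ) := by
    simp only [hsq]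
    exact integrable_finsetSum _ fun j _ => (hi j).const_mul _
  have hSm : ∫ x, ∑ j, outerRow x k j ^ 2 ∂(Measure.pi ρ) ≤ σ := by
    simp only [hsq]
    rw [integral_finsetSum _ fun j _ => (hi j).const_mul _]
    calc _ ≤ ∑ _j : Fin n, s ^ 2 * σ := by
          refine Finset.sum_le_sum fun j _ => ?_
          rw [integral_const_mul]
          refine mul_le_mul ?_ (hm j) (integral_nonneg fun x => mul_self_nonneg _) (sq_nonneg _)
          split_ifs
          exacts [le_rfl, sq_nonneg _]
      _ = s ^ 2 * n * σ := by simp; ring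
      _ ≤ σ := mul_le_of_le_one_left hσ (inv_sqrt_sq_mul_le n)
  have e : ∀ x : Fin n → Fin n → ℝ, 2 * (ε * (q * (2 * q ^ 2 + 2 + q ^ 4 * ∑ j, outerRow x k j ^ 2)
        + q ^ 2 * (3 + 2 * q + q ^ 2 * ∑ j, outerRow x k j ^ 2)))
      = 2 * (ε * (q * (2 * q ^ 2 + 2) + q ^ 2 * (3 + 2 * q)))
        + (2 * (ε * (q * q ^ 4 + q ^ 2 * q ^ 2))) * ∑ j, outerRow x k j ^ 2 := fun x => by ring
  simp only [e]
  refine ⟨(integrable_const _).add (hSi.const_mul _), ?_⟩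
  rw [integral_add (integrable_const _) (hSi.const_mul _), integral_const, probReal_univ,
    one_smul, integral_const_mul]
  have h2 : (2 * (ε * (q * q ^ 4 + q ^ 2 * q ^ 2))) * ∫ x, ∑ j, outerRow x k j ^ 2 ∂(Measure.pi ρ)
      ≤ (2 * (ε * (q * q ^ 4 + q ^ 2 * q ^ 2))) * σ :=
    mul_le_mul_of_nonneg_left hSm (by positivity)
  linarith

end Comparison

/-! ### Bounded differences inequality and almost sure convergence. -/

section BoundedDifferences

variable {E : Type*} [MeasurableSpace E]

theorem integral_pi_cons {m : ℕ} (μ : Fin (m + 1) → Measure E) [∀ i, IsProbabilityMeasure (μ i)]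
    {f : (Fin (m + 1) → E) → ℝ} (hf : Measurable f) {C : ℝ} (hC : ∀ x, |f x| ≤ C) :
    ∫ x, f x ∂(Measure.pi μ)
      = ∫ x, ∫ r, f (Fin.cons r x) ∂(μ 0) ∂(Measure.pi fun j => μ j.succ) := by
  have h := (measurePreserving_piFinSuccAbove μ 0).symm
  have e : ∀ p : E × (Fin m → E),
      (MeasurableEquiv.piFinSuccAbove (fun _ : Fin (m + 1) => E) 0).symm p = Fin.cons p.1 p.2 :=
    fun p => by
      simp [MeasurableEquiv.piFinSuccAbove, Fin.insertNthEquiv]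
  rw [← h.integral_comp', integral_prod_symm]
  · simp only [e]; rfl
  · exact Integrable.of_bound (hf.comp h.measurable).aestronglyMeasurable C (ae_of_all _ fun _ => hC _)

/-- The bounded differences inequality, as a bound on the moment generating function. -/
theorem integral_exp_sub_le_of_bounded_differences {d : ℝ} {m : ℕ} (μ : Fin m → Measure E)
    [∀ i, IsProbabilityMeasure (μ i)] {f : (Fin m → E) → ℝ} (hf : Measurable f) {C : ℝ}
    (hC : ∀ x, |f x| ≤ C) (hd : ∀ x k r, |f (Function.update x k r) - f x| ≤ d) (t : ℝ) :
    ∫ x, Real.exp (t * (f x - ∫ x', f x' ∂(Measure.pi μ))) ∂(Measure.pi μ)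
      ≤ Real.exp (m * d ^ 2 * t ^ 2 / 2) := by
  induction m with
  | zero =>
    have h : ∀ x, f x = f default := fun x => congrArg f (Subsingleton.elim _ _)
    simp only [h]
    simp
  | succ m ih =>
    set π := Measure.pi (fun j : Fin m => μ j.succ) with hπ
    have hcons : Measurable fun p : (Fin m → E) × E => (Fin.cons p.2 p.1 : Fin (m + 1) → E) := by
      rw [measurable_pi_iff]
      intro i
      refine Fin.cases ?_ (fun j => ?_) i
      · simpa using measurable_snd
      · simp only [Fin.cons_succ]; fun_prop
    have hfc : Measurable fun p : (Fin m → E) × E => f (Fin.cons p.2 p.1) := hf.comp hcons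
    have hfx : ∀ x, Measurable fun r => f (Fin.cons r x) := fun x => hfc.comp measurable_prodMk_left
    -- Averaging over the first coordinate keeps the bounded differences; f - F is then handled by
    -- Hoeffding's lemma for each fixed `x`, and F by induction.
    set F : (Fin m → E) → ℝ := fun x => ∫ r, f (Fin.cons r x) ∂(μ 0) with hF
    have hfi : ∀ x, Integrable (fun r => f (Fin.cons r x)) (μ 0) := fun x =>
      Integrable.of_bound (hfx x).aestronglyMeasurable C (ae_of_all _ fun r => (hC (Fin.cons r x) :))
    have hFm : Measurable F := (hfc.stronglyMeasurable.integral_prod_right (ν := μ 0)).measurable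
    have hFC : ∀ x, |F x| ≤ C := fun x => by
      have h := norm_integral_le_of_norm_le_const (μ := μ 0) (f := fun r => f (Fin.cons r x)) (C := C)
        (ae_of_all _ fun r => hC _)
      simpa using h
    have hFd : ∀ x k r, |F (Function.update x k r) - F x| ≤ d := fun x k r => by
      simp only [hF]
      rw [← integral_sub (hfi _) (hfi _)]
      have h := norm_integral_le_of_norm_le_const (μ := μ 0) (C := d)
        (f := fun r' => f (Fin.cons r' (Function.update x k r)) - f (Fin.cons r' x))
        (ae_of_all _ fun r' => by rw [Fin.cons_update]; exact hd _ _ _)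
      simpa using h
    have hIF : ∫ x, f x ∂(Measure.pi μ) = ∫ x, F x ∂π := integral_pi_cons μ hf hC
    have hih := ih (fun j => μ j.succ) hFm hFC hFd
    rw [← hπ] at hih
    obtain ⟨r₀⟩ : Nonempty E := nonempty_of_isProbabilityMeasure (μ 0)
    have hslice : ∀ x, ∫ r, Real.exp (t * (f (Fin.cons r x) - F x)) ∂(μ 0)
        ≤ Real.exp (d ^ 2 * t ^ 2 / 2) := fun x => by
      -- Relative to the reference point `r₀` the values lie in an interval of length 2d, so
      -- Hoeffding's parameter is d².
      have h := (hasSubgaussianMGF_of_mem_Icc (μ := μ 0) (X := fun r => f (Fin.cons r x))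
        (a := f (Fin.cons r₀ x) - d) (b := f (Fin.cons r₀ x) + d) (hfx x).aemeasurable
        (ae_of_all _ fun r => by
          have h1 := hd (Fin.cons r₀ x) 0 r
          rw [Fin.update_cons_zero] at h1
          rw [Set.mem_Icc]
          rw [abs_le] at h1
          constructor <;> linarith)).mgf_le t
      refine h.trans (le_of_eq ?_)
      congr 3
      push_cast
      rw [div_pow, Real.norm_eq_abs, sq_abs]
      ring
    set I := ∫ x, F x ∂π with hI
    have hexp : ∀ (g : ℝ), |g| ≤ 2 * C → Real.exp (t * g) ≤ Real.exp (|t| * (2 * C)) := fun g hg => by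
      refine Real.exp_le_exp.2 ((le_abs_self _).trans ?_)
      rw [abs_mul]
      exact mul_le_mul_of_nonneg_left hg (abs_nonneg t)
    have hIC : |I| ≤ C := by
      have h := norm_integral_le_of_norm_le_const (μ := π) (f := F) (C := C) (ae_of_all _ hFC)
      simpa using h
    have hab : ∀ {a b : ℝ}, |a| ≤ C → |b| ≤ C → |a - b| ≤ 2 * C := fun ha hb => by
      refine (abs_sub _ _).trans ?_
      linarith
    rw [hIF, integral_pi_cons μ (C := Real.exp (|t| * (2 * C))) (by fun_prop) fun x => by
      rw [abs_of_pos (Real.exp_pos _)]; exact hexp _ (hab (hC _) hIC)]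
    have hFe : Integrable (fun x => Real.exp (t * (F x - I))) π :=
      Integrable.of_bound (by fun_prop) (Real.exp (|t| * (2 * C))) (ae_of_all _ fun x => by
        rw [Real.norm_of_nonneg (Real.exp_pos _).le]; exact hexp _ (hab (hFC _) hIC))
    calc _ ≤ ∫ x, Real.exp (d ^ 2 * t ^ 2 / 2) * Real.exp (t * (F x - I)) ∂π := by
          refine integral_mono_of_nonneg (ae_of_all _ fun x => integral_nonneg fun r =>
            (Real.exp_pos _).le) (hFe.const_mul _) (ae_of_all _ fun x => ?_)
          have e : ∀ r, Real.exp (t * (f (Fin.cons r x) - I))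
              = Real.exp (t * (f (Fin.cons r x) - F x)) * Real.exp (t * (F x - I)) := fun r => by
            rw [← Real.exp_add]; ring_nf
          simp only [e]
          rw [integral_mul_const]
          exact mul_le_mul_of_nonneg_right (hslice x) (Real.exp_pos _).le
      _ ≤ Real.exp (d ^ 2 * t ^ 2 / 2) * Real.exp (m * d ^ 2 * t ^ 2 / 2) := by
          rw [integral_const_mul]
          exact mul_le_mul_of_nonneg_left hih (Real.exp_pos _).le
      _ = _ := by rw [← Real.exp_add]; congr 1; push_cast; ring

theorem hasSubgaussianMGF_of_bounded_differences {d : ℝ} {m : ℕ} (μ : Fin m → Measure E)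
    [∀ i, IsProbabilityMeasure (μ i)] {f : (Fin m → E) → ℝ} (hf : Measurable f) {C : ℝ}
    (hC : ∀ x, |f x| ≤ C) (hd : ∀ x k r, |f (Function.update x k r) - f x| ≤ d) :
    HasSubgaussianMGF (fun x => f x - ∫ x', f x' ∂(Measure.pi μ)) (m * (Real.toNNReal (d ^ 2)))
      (Measure.pi μ) where
  integrable_exp_mul t := integrable_exp_mul_of_mem_Icc (a := -C - ∫ x', f x' ∂(Measure.pi μ))
    (b := C - ∫ x', f x' ∂(Measure.pi μ)) (by fun_prop) (ae_of_all _ fun x => by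
      have := abs_le.1 (hC x)
      constructor <;> linarith)
  mgf_le t := by
    refine (integral_exp_sub_le_of_bounded_differences μ hf hC hd t).trans (le_of_eq ?_)
    rw [NNReal.coe_mul, Real.coe_toNNReal _ (sq_nonneg d), NNReal.coe_natCast]

variable {Ω : Type*} [MeasurableSpace Ω] {P : Measure Ω} [IsProbabilityMeasure P]

/-- The tails P(|X_n| ≥ δ n) are at most 2 exp(-n δ² / (2c)), hence summable; Borel–Cantelli is
applied along δ = 1/(j+1). -/
theorem ae_tendsto_div_of_hasSubgaussianMGF {X : ℕ → Ω → ℝ} {c : NNReal} (hc : 0 < c)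
    (hX : ∀ n : ℕ, HasSubgaussianMGF (X n) (n * c) P) :
    ∀ᵐ ω ∂P, Tendsto (fun n : ℕ => X n ω / n) atTop (𝓝 0) := by
  have key : ∀ δ : ℝ, 0 < δ → ∀ᵐ ω ∂P, ∀ᶠ n : ℕ in atTop, |X n ω| < δ * n := fun δ hδ => by
    have hc' : (0 : ℝ) < c := hc
    have hb : ∀ n : ℕ, P.real {ω | δ * n ≤ |X n ω|}
        ≤ 2 * Real.exp (n * (-(δ ^ 2 / (2 * c)))) := fun n => by
      have h0 : (0 : ℝ) ≤ δ * n := by positivity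
      have e : -(δ * n) ^ 2 / (2 * ((n * c : NNReal) : ℝ)) = n * (-(δ ^ 2 / (2 * c))) := by
        rcases Nat.eq_zero_or_pos n with rfl | hn
        · simp
        · have hn' : (0 : ℝ) < n := by exact_mod_cast hn
          push_cast
          field_simp
      have h1 := (hX n).measure_ge_le h0
      have h2 := (hX n).neg.measure_ge_le h0
      rw [e] at h1 h2
      have h3 : {ω | δ * n ≤ |X n ω|} ⊆ {ω | δ * n ≤ X n ω} ∪ {ω | δ * n ≤ (-X n) ω} :=
        fun ω (hω : δ * n ≤ |X n ω|) => (le_abs.1 hω : δ * n ≤ X n ω ∨ δ * n ≤ -X n ω)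
      refine (measureReal_mono h3).trans ((measureReal_union_le _ _).trans ?_)
      linarith
    have hsum : Summable fun n : ℕ => 2 * Real.exp (n * (-(δ ^ 2 / (2 * (c : ℝ))))) :=
      (Real.summable_exp_nat_mul_iff.2 (neg_lt_zero.2 (by positivity))).mul_left 2
    have hfin : ∑' n, P {ω | δ * n ≤ |X n ω|} ≠ ⊤ := by
      refine ne_top_of_le_ne_top hsum.tsum_ofReal_ne_top (ENNReal.tsum_le_tsum fun n => ?_)
      rw [← ofReal_measureReal]
      exact ENNReal.ofReal_le_ofReal (hb n)
    filter_upwards [ae_eventually_notMem hfin] with ω hω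
    exact hω.mono fun n hn => not_le.1 hn
  have h2 : ∀ᵐ ω ∂P, ∀ j : ℕ, ∀ᶠ n : ℕ in atTop, |X n ω| < (1 / ((j : ℝ) + 1)) * n :=
    ae_all_iff.2 fun j => key _ Nat.one_div_pos_of_nat
  filter_upwards [h2] with ω hω
  rw [Metric.tendsto_nhds]
  intro ε hε
  obtain ⟨j, hj⟩ := exists_nat_one_div_lt hε
  filter_upwards [hω j, eventually_gt_atTop 0] with n hn hn0
  have hn0' : (0 : ℝ) < n := by exact_mod_cast hn0
  rw [dist_zero_right, Real.norm_eq_abs, abs_div, Nat.abs_cast, div_lt_iff₀ hn0']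
  exact hn.trans (by gcongr)

end BoundedDifferences
end RowIndep

namespace RowIndep

/-! ### Row laws of Gaussian vectors and of regular sequences. -/

section Contraction

variable {ι : Type*} [Fintype ι] {B B₂ : ι → ι → ℝ}

theorem IsContractionForm.transpose (hB : IsContractionForm B) :
    IsContractionForm fun j k => B k j := fun x y => by
  rw [Finset.sum_comm, add_comm]
  refine le_trans (le_of_eq ?_) (hB y x)
  refine congrArg _ (Finset.sum_congr rfl fun j _ => Finset.sum_congr rfl fun k _ => ?_)
  ring

/-- The form is tested on `x` and on its own image, half of which is absorbed. -/
theorem IsContractionForm.sum_sq_le (hB : IsContractionForm B) (x : ι → ℝ) :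
    ∑ k, (∑ j, B j k * x j) ^ 2 ≤ ∑ j, x j ^ 2 := by
  have h := (le_abs_self _).trans (hB x fun k => ∑ j, B j k * x j)
  have e : ∑ j, ∑ k, B j k * x j * ∑ i, B i k * x i = ∑ k, (∑ j, B j k * x j) ^ 2 := by
    rw [Finset.sum_comm]
    refine Finset.sum_congr rfl fun k _ => ?_
    rw [← Finset.sum_mul, sq]
  rw [e] at h
  linarith

/-- Contractions do not increase the Hilbert–Schmidt norm of `c`; then AM–GM. These are the sums
produced by Wick's formula. -/
theorem IsContractionForm.sum_mul_mul_le (hB : IsContractionForm B) (hB₂ : IsContractionForm B₂)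
    (c : ι → ι → ℝ) :
    ∑ k, ∑ m, (∑ l, B₂ l m * ∑ j, B j k * c j l) * c k m ≤ ∑ j, ∑ k, c j k ^ 2 := by
  have h1 : ∑ k, ∑ m, (∑ l, B₂ l m * ∑ j, B j k * c j l) ^ 2 ≤ ∑ j, ∑ k, c j k ^ 2 := by
    calc _ ≤ ∑ k, ∑ l, (∑ j, B j k * c j l) ^ 2 :=
          Finset.sum_le_sum fun k _ => hB₂.sum_sq_le fun l => ∑ j, B j k * c j l
      _ = ∑ l, ∑ k, (∑ j, B j k * c j l) ^ 2 := Finset.sum_comm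
      _ ≤ ∑ l, ∑ j, c j l ^ 2 := Finset.sum_le_sum fun l _ => hB.sum_sq_le fun j => c j l
      _ = _ := Finset.sum_comm
  have h2 : ∑ k, ∑ m, (∑ l, B₂ l m * ∑ j, B j k * c j l) * c k m
      ≤ ∑ k, ∑ m, ((∑ l, B₂ l m * ∑ j, B j k * c j l) ^ 2 / 2 + c k m ^ 2 / 2) :=
    Finset.sum_le_sum fun k _ => Finset.sum_le_sum fun m _ => by
      nlinarith [sq_nonneg ((∑ l, B₂ l m * ∑ j, B j k * c j l) - c k m)]
  simp only [Finset.sum_add_distrib, ← Finset.sum_div] at h2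
  linarith

end Contraction

section RowLaws

variable {Ω : Type*} [MeasurableSpace Ω] {P : Measure Ω} {n : ℕ}

theorem RowLaw.of_map {Z : Fin n → Ω → ℝ} {c : Fin n → Fin n → ℝ} {ε σ : ℝ}
    (hZ : ∀ j, MemLp (Z j) 2 P) (hc : ∀ j k, ∫ ω, Z j ω * Z k ω ∂P = c j k)
    (hq : ∀ B : Fin n → Fin n → ℝ, IsContractionForm B →
      ∫ ω, |∑ j, ∑ k, B j k * (Z j ω * Z k ω - c j k)| ∂P ≤ ε * n)
    (hrow : ∀ j, ∑ k, |c j k| ≤ ε ^ 2 * n) (hdiag : ∀ j, c j j ≤ σ) :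
    RowLaw (P.map fun ω j => Z j ω) c ε σ := by
  have hm : AEMeasurable (fun ω j => Z j ω) P := aemeasurable_pi_lambda _ fun j =>
    (hZ j).aestronglyMeasurable.aemeasurable
  refine ⟨fun j => ?_, fun j k => ?_, fun B hB => ?_, hrow, hdiag⟩
  · exact (memLp_map_measure_iff (measurable_pi_apply j).aestronglyMeasurable hm).2 (hZ j)
  · rw [integral_map hm (by fun_prop)]; exact hc j k
  · rw [integral_map hm (by fun_prop)]; exact hq B hB

/-- Variance bound for the quadratic forms of a Gaussian vector. -/
theorem integral_sq_quad_le_of_isGaussianProcess {Z : Fin n → Ω → ℝ} (hZ : IsGaussianProcess Z P)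
    (hZ0 : ∀ j, ∫ ω, Z j ω ∂P = 0) {c : Fin n → Fin n → ℝ}
    (hc : ∀ j k, ∫ ω, Z j ω * Z k ω ∂P = c j k) {B : Fin n → Fin n → ℝ}
    (hB : IsContractionForm B) :
    MemLp (fun ω => ∑ j, ∑ k, B j k * (Z j ω * Z k ω - c j k)) 2 P ∧
    ∫ ω, (∑ j, ∑ k, B j k * (Z j ω * Z k ω - c j k)) ^ 2 ∂P ≤ 2 * ∑ j, ∑ k, c j k ^ 2 := by
  have := hZ.isProbabilityMeasure
  have : ENNReal.HolderTriple 4 4 2 := ⟨by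
    rw [← two_mul, ← ENNReal.toReal_eq_toReal_iff' (by finiteness) (by finiteness)]
    simp; norm_num⟩
  have h4 : ∀ j, MemLp (Z j) 4 P := fun j => (hZ.hasGaussianLaw_eval j).memLp (by simp)
  have h22 : ∀ j k, MemLp (fun ω => Z j ω * Z k ω) 2 P := fun j k => (h4 k).mul (h4 j)
  have hq : ∀ j k, MemLp (fun ω => Z j ω * Z k ω - c j k) 2 P := fun j k =>
    (h22 j k).sub (memLp_const _)
  refine ⟨memLp_finsetSum _ fun j _ => memLp_finsetSum _ fun k _ => (hq j k).const_mul _, ?_⟩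
  have hqi : ∀ j k l m, Integrable
      (fun ω => (Z j ω * Z k ω - c j k) * (Z l ω * Z m ω - c l m)) P := fun j k l m =>
    (hq j k).integrable_mul (hq l m)
  -- Wick's formula; recentring cancels the pairing of j with k and of l with m.
  have hqq : ∀ j k l m, ∫ ω, (Z j ω * Z k ω - c j k) * (Z l ω * Z m ω - c l m) ∂P
      = c j l * c k m + c j m * c k l := fun j k l m => by
    have i1 : Integrable (fun ω => Z j ω * Z k ω * (Z l ω * Z m ω)) P :=
      (h22 j k).integrable_mul (h22 l m)
    have i2 := ((h22 j k).integrable one_le_two).mul_const (c l m)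
    have i3 := ((hq l m).integrable one_le_two).const_mul (c j k)
    have i12 : Integrable (fun ω => Z j ω * Z k ω * (Z l ω * Z m ω) - Z j ω * Z k ω * c l m) P :=
      i1.sub i2
    have e : ∀ ω, (Z j ω * Z k ω - c j k) * (Z l ω * Z m ω - c l m)
        = Z j ω * Z k ω * (Z l ω * Z m ω) - Z j ω * Z k ω * c l m
          - c j k * (Z l ω * Z m ω - c l m) := fun ω => by ring
    simp only [e]
    rw [integral_sub i12 i3, integral_sub i1 i2, integral_mul_const, integral_const_mul,
      integral_sub ((h22 l m).integrable one_le_two) (integrable_const _),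
      integral_mul_four_of_isGaussianProcess hZ hZ0, hc, hc, hc, hc, hc, hc, integral_const,
      probReal_univ, one_smul]
    ring
  have e : ∀ ω, (∑ j, ∑ k, B j k * (Z j ω * Z k ω - c j k)) ^ 2
      = ∑ j, ∑ k, ∑ l, ∑ m, B j k * B l m
        * ((Z j ω * Z k ω - c j k) * (Z l ω * Z m ω - c l m)) := fun ω => by
    rw [sq, Finset.sum_mul]
    refine Finset.sum_congr rfl fun j _ => ?_
    rw [Finset.sum_mul]
    refine Finset.sum_congr rfl fun k _ => ?_
    rw [Finset.mul_sum]
    refine Finset.sum_congr rfl fun l _ => ?_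
    rw [Finset.mul_sum]
    exact Finset.sum_congr rfl fun m _ => by ring
  have hi : ∫ ω, (∑ j, ∑ k, B j k * (Z j ω * Z k ω - c j k)) ^ 2 ∂P
      = ∑ j, ∑ k, ∑ l, ∑ m, B j k * B l m * (c j l * c k m + c j m * c k l) := by
    simp only [e]
    rw [integral_finsetSum _ fun j _ => integrable_finsetSum _ fun k _ =>
      integrable_finsetSum _ fun l _ => integrable_finsetSum _ fun m _ =>
        (hqi j k l m).const_mul _]
    refine Finset.sum_congr rfl fun j _ => ?_
    rw [integral_finsetSum _ fun k _ => integrable_finsetSum _ fun l _ =>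
      integrable_finsetSum _ fun m _ => (hqi j k l m).const_mul _]
    refine Finset.sum_congr rfl fun k _ => ?_
    rw [integral_finsetSum _ fun l _ => integrable_finsetSum _ fun m _ =>
      (hqi j k l m).const_mul _]
    refine Finset.sum_congr rfl fun l _ => ?_
    rw [integral_finsetSum _ fun m _ => (hqi j k l m).const_mul _]
    refine Finset.sum_congr rfl fun m _ => ?_
    rw [integral_const_mul, hqq]
  rw [hi]
  -- The two remaining pairings correspond to B with itself and B with its transpose, whence the
  -- factor 2.
  have s1 := hB.sum_mul_mul_le hB c
  have s2 := hB.sum_mul_mul_le hB.transpose c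
  simp only [Finset.mul_sum, Finset.sum_mul] at s1 s2
  have r1 : ∀ f : Fin n → Fin n → Fin n → ℝ,
      ∑ j, ∑ l, ∑ m, f j l m = ∑ l, ∑ m, ∑ j, f j l m := fun f => by
    rw [Finset.sum_comm]
    exact Finset.sum_congr rfl fun l _ => Finset.sum_comm
  have e1 : ∑ j, ∑ k, ∑ l, ∑ m, B j k * B l m * (c j l * c k m + c j m * c k l)
      = (∑ k, ∑ m, ∑ l, ∑ j, B l m * (B j k * c j l) * c k m)
        + ∑ k, ∑ l, ∑ m, ∑ j, B l m * (B j k * c j m) * c k l := by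
    rw [Finset.sum_comm, ← Finset.sum_add_distrib]
    refine Finset.sum_congr rfl fun k _ => ?_
    rw [r1, Finset.sum_comm (f := fun m l => ∑ j, B l m * (B j k * c j l) * c k m),
      ← Finset.sum_add_distrib]
    refine Finset.sum_congr rfl fun l _ => ?_
    rw [← Finset.sum_add_distrib]
    refine Finset.sum_congr rfl fun m _ => ?_
    rw [← Finset.sum_add_distrib]
    exact Finset.sum_congr rfl fun j _ => by ring
  rw [e1]
  linarith

/-- A centered Gaussian vector with small row sums of covariances. -/
theorem rowLaw_of_isGaussianProcess {Z : Fin n → Ω → ℝ} (hZ : IsGaussianProcess Z P)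
    (hZ0 : ∀ j, ∫ ω, Z j ω ∂P = 0) {c : Fin n → Fin n → ℝ}
    (hc : ∀ j k, ∫ ω, Z j ω * Z k ω ∂P = c j k) {ε σ ρ : ℝ} (hε : 0 < ε) (hσ : ∀ j k, |c j k| ≤ σ)
    (hrow : ∀ j, ∑ k, |c j k| ≤ ρ * n) (hρ : ρ ≤ ε ^ 2) (hρσ : 2 * (σ * ρ) ≤ ε ^ 2) :
    RowLaw (P.map fun ω j => Z j ω) c ε σ := by
  have := hZ.isProbabilityMeasure
  refine RowLaw.of_map (fun j => (hZ.hasGaussianLaw_eval j).memLp (by simp)) hc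
    (fun B hB => ?_) (fun j => (hrow j).trans (by gcongr)) fun j => (le_abs_self _).trans (hσ j j)
  rcases Nat.eq_zero_or_pos n with rfl | hn
  · simp
  have hn' : (0 : ℝ) < n := by exact_mod_cast hn
  have hσ0 : 0 ≤ σ := (abs_nonneg _).trans (hσ ⟨0, hn⟩ ⟨0, hn⟩)
  obtain ⟨hm, h2⟩ := integral_sq_quad_le_of_isGaussianProcess hZ hZ0 hc hB
  -- One factor of each square is bounded by σ, the other is summed along the row.
  have hcs : ∑ j, ∑ k, c j k ^ 2 ≤ σ * ρ * n ^ 2 := by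
    calc _ ≤ ∑ j : Fin n, σ * (ρ * n) := by
          refine Finset.sum_le_sum fun j _ => le_trans ?_ (mul_le_mul_of_nonneg_left (hrow j) hσ0)
          rw [Finset.mul_sum]
          refine Finset.sum_le_sum fun k _ => ?_
          rw [← sq_abs, sq]
          exact mul_le_mul_of_nonneg_right (hσ j k) (abs_nonneg _)
      _ = _ := by simp; ring
  have h3 := integral_abs_le_of_integral_sq_le hm (t := ε * n) (by positivity)
    (h2.trans (mul_le_mul_of_nonneg_left hcs zero_le_two))
  refine h3.trans ?_
  have h4 : 2 * (σ * ρ * n ^ 2) / (2 * (ε * n)) ≤ ε * n / 2 := by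
    rw [div_le_div_iff₀ (by positivity) two_pos]
    nlinarith [mul_le_mul_of_nonneg_right hρσ (sq_nonneg (n : ℝ))]
  linarith

/-- Each distance from `j` occurs at most once on either side. -/
theorem sum_dist_le {f : ℕ → ℝ} (hf : ∀ d, 0 ≤ f d) {n j : ℕ} (hj : j < n) :
    ∑ k ∈ Finset.range n, f (Nat.dist j k) ≤ 2 * ∑ d ∈ Finset.range n, f d := by
  have key : ∀ (s : Finset ℕ) (g : ℕ → ℕ), Set.InjOn g s → (∀ k ∈ s, g k < n) →
      ∑ k ∈ s, f (g k) ≤ ∑ d ∈ Finset.range n, f d := fun s g hg hn => by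
    rw [← Finset.sum_image hg]
    refine Finset.sum_le_sum_of_subset_of_nonneg (fun d hd => ?_) fun d _ _ => hf d
    obtain ⟨k, hk, rfl⟩ := Finset.mem_image.1 hd
    exact Finset.mem_range.2 (hn k hk)
  rw [← Finset.sum_filter_add_sum_filter_not _ (fun k => k ≤ j), two_mul]
  refine add_le_add (key _ _ ?_ ?_) (key _ _ ?_ ?_)
  · intro a ha b hb h
    simp only [Finset.coe_filter, Finset.mem_range, Set.mem_ofPred_eq] at ha hb
    simp only [Nat.dist] at h
    omega
  · intro a ha
    simp only [Finset.mem_filter, Finset.mem_range] at ha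
    simp only [Nat.dist]
    omega
  · intro a ha b hb h
    simp only [Finset.coe_filter, Finset.mem_range, Set.mem_ofPred_eq] at ha hb
    simp only [Nat.dist] at h
    omega
  · intro a ha
    simp only [Finset.mem_filter, Finset.mem_range] at ha
    simp only [Nat.dist]
    omega

namespace IsRegularSeq

variable {ξ : ℤ → Ω → ℝ}

theorem integral_mul_eq_dist (hξ : IsRegularSeq ξ P) (j k : ℕ) :
    ∫ ω, ξ j ω * ξ k ω ∂P = ∫ ω, ξ 0 ω * ξ (Nat.dist j k : ℕ) ω ∂P := by
  rcases le_total j k with h | h <;> obtain ⟨d, rfl⟩ := Nat.exists_eq_add_of_le h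
  · have e : Nat.dist j (j + d) = d := by simp [Nat.dist]
    rw [e, ← (hξ.identDistrib_mul j d).integral_eq]
    push_cast; rfl
  · have e : Nat.dist (k + d) k = d := by simp [Nat.dist]
    rw [e, ← (hξ.identDistrib_mul k d).integral_eq]
    push_cast; simp only [mul_comm]

theorem abs_integral_mul_le (hξ : IsRegularSeq ξ P) (j k : ℤ) :
    |∫ ω, ξ j ω * ξ k ω ∂P| ≤ ∫ ω, ξ 0 ω ^ 2 ∂P := by
  have i : ∀ j, Integrable (fun ω => ξ j ω ^ 2) P := fun j => (hξ.memLp j).integrable_sq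
  have h : ∫ ω, (ξ j ω ^ 2 + ξ k ω ^ 2) / 2 ∂P = ∫ ω, ξ 0 ω ^ 2 ∂P := by
    rw [integral_div, integral_add (i j) (i k), hξ.integral_sq_eq j, hξ.integral_sq_eq k]
    ring
  rw [← h]
  rw [← Real.norm_eq_abs]
  refine norm_integral_le_of_norm_le (((i j).add (i k)).div_const 2) (ae_of_all _ fun ω => ?_)
  rw [Real.norm_eq_abs, abs_le]
  constructor <;>
    nlinarith [sq_nonneg (ξ j ω + ξ k ω), sq_nonneg (ξ j ω - ξ k ω)]

variable [IsProbabilityMeasure P]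

/-- Covariances vanish at infinity, hence so do their Cesàro means; ρ/2 pays for the two sides of
`j`. -/
theorem eventually_sum_abs_covariance_le (hξ : IsRegularSeq ξ P) {ρ : ℝ} (hρ : 0 < ρ) :
    ∀ᶠ n : ℕ in atTop, ∀ j : Fin n,
      ∑ k : Fin n, |∫ ω, ξ (j : ℕ) ω * ξ (k : ℕ) ω ∂P| ≤ ρ * n := by
  set f : ℕ → ℝ := fun d => |∫ ω, ξ 0 ω * ξ (d : ℤ) ω ∂P| with hf
  have h0 : Tendsto f atTop (𝓝 0) := by simpa using hξ.tendsto_covariance.abs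
  filter_upwards [h0.cesaro.eventually_le_const (show (0 : ℝ) < ρ / 2 by positivity),
    eventually_gt_atTop 0] with n hn hn0 j
  have hn' : (0 : ℝ) < n := by exact_mod_cast hn0
  rw [inv_mul_le_iff₀ hn'] at hn
  simp only [hξ.integral_mul_eq_dist]
  rw [Finset.sum_range fun i => f i] at hn
  have h := sum_dist_le (f := f) (fun d => abs_nonneg _) j.2
  rw [Finset.sum_range, Finset.sum_range] at h
  exact h.trans (by linarith)

/-- The additive constant of the quadratic bound is eventually below ε n / 2. -/
theorem eventually_rowLaw (hξ : IsRegularSeq ξ P) {ε : ℝ} (hε : 0 < ε) :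
    ∀ᶠ n : ℕ in atTop, RowLaw (P.map fun ω (j : Fin n) => ξ (j : ℕ) ω)
      (fun j k => ∫ ω, ξ (j : ℕ) ω * ξ (k : ℕ) ω ∂P) ε (∫ ω, ξ 0 ω ^ 2 ∂P) := by
  obtain ⟨C, hC⟩ := hξ.exists_integral_abs_quad_le (half_pos hε)
  have hlarge : ∀ᶠ n : ℕ in atTop, C ≤ ε / 2 * n :=
    (tendsto_natCast_atTop_atTop.const_mul_atTop (half_pos hε)).eventually_ge_atTop C
  filter_upwards [hlarge, hξ.eventually_sum_abs_covariance_le (sq_pos_of_pos hε)] with n hn hrow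
  refine RowLaw.of_map (fun j => hξ.memLp _) (fun j k => rfl) (fun B hB => ?_) hrow
    fun j => (le_abs_self _).trans (hξ.abs_integral_mul_le _ _)
  set B' : ℕ → ℕ → ℝ := fun j k => if h : j < n ∧ k < n then B ⟨j, h.1⟩ ⟨k, h.2⟩ else 0 with hB'
  have e : ∀ j k : Fin n, B' j k = B j k := fun j k => by simp [hB']
  have hbil : BilinBound n B' := fun x y => by
    have h := hB (fun j => x j) (fun k => y k)
    simp only [Finset.sum_range, e]
    exact h
  have h := hC n B' hbil
  simp only [Finset.sum_range, e] at h
  exact h.trans (by linarith)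

end IsRegularSeq

end RowLaws
end RowIndep

namespace RowIndep

theorem stieltjes_scaledMatrix (x : ℕ+ → ℕ+ → ℝ) (n : ℕ) (z : ℂ) :
    stieltjes (scaledMatrix x n) z
      = rowTrace z (fun i j : Fin n => x (Nat.succPNat i) (Nat.succPNat j)) / n := by
  rw [div_eq_inv_mul, ← one_div]
  rfl

/-! ### Conclusion for the matrix models. -/

section Rows

variable {Ω₀ Ω Ω' : Type*} [MeasurableSpace Ω₀] [MeasurableSpace Ω] [MeasurableSpace Ω']
  {P₀ : Measure Ω₀} {P : Measure Ω} {Q : Measure Ω'} {ξ : ℤ → Ω₀ → ℝ} {X : ℕ+ → ℤ → Ω → ℝ}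
  {Y : ℕ+ → ℕ+ → Ω' → ℝ}

theorem succPNat_injective {n : ℕ} : Function.Injective fun i : Fin n => Nat.succPNat i :=
  fun _ _ h => Fin.ext (Nat.succPNat_injective h)

theorem map_row_eq (hξ : IsRegularSeq ξ P₀)
    (hX_copy : ∀ i, IdentDistrib (fun ω (j : ℤ) => X i j ω) (fun ω (j : ℤ) => ξ j ω) P P₀) (i : ℕ+)
    (n : ℕ) :
    P.map (fun ω (j : Fin n) => X i (Nat.succPNat j : ℕ+) ω)
      = P₀.map fun ω (j : Fin n) => ξ (j : ℕ) ω := by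
  have h1 := (hX_copy i).comp
    (u := fun (x : ℤ → ℝ) (j : Fin n) => x ((Nat.succPNat j : ℕ+) : ℤ)) (by fun_prop)
  -- Entry `j` of `Fin n` is column j + 1, so one unit of shift separates the two indexings.
  have h2 := (hξ.stationary 1).comp
    (u := fun (x : ℤ → ℝ) (j : Fin n) => x ((j : ℕ) : ℤ)) (by fun_prop)
  refine (h1.map_eq.trans (congrArg (fun f => P₀.map f) ?_)).trans h2.map_eq
  ext ω j
  simp

theorem map_rows_eq_pi (hξ : IsRegularSeq ξ P₀) (hX_meas : ∀ i j, Measurable (X i j))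
    (hX_copy : ∀ i, IdentDistrib (fun ω (j : ℤ) => X i j ω) (fun ω (j : ℤ) => ξ j ω) P P₀)
    (hX_indep : iIndepFun (fun (i : ℕ+) (ω : Ω) (j : ℤ) => X i j ω) P) (n : ℕ) :
    P.map (fun ω (i j : Fin n) => X (Nat.succPNat i) (Nat.succPNat j : ℕ+) ω)
      = Measure.pi fun _ : Fin n => P₀.map fun ω (j : Fin n) => ξ (j : ℕ) ω := by
  have h1 := (hX_indep.precomp (succPNat_injective (n := n))).comp
    (fun _ (x : ℤ → ℝ) (j : Fin n) => x ((Nat.succPNat j : ℕ+) : ℤ)) (fun _ => by fun_prop)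
  have h2 := h1.map_fun_eq_pi_map fun i => by
    refine Measurable.aemeasurable ?_
    exact measurable_pi_iff.2 fun j => hX_meas _ _
  refine h2.trans (congrArg Measure.pi (funext fun i => ?_))
  exact map_row_eq hξ hX_copy (Nat.succPNat i) n

theorem IsGaussianCopy.integral_mul_eq [IsProbabilityMeasure P] [IsProbabilityMeasure Q]
    (hξ : IsRegularSeq ξ P₀)
    (hX_copy : ∀ i, IdentDistrib (fun ω (j : ℤ) => X i j ω) (fun ω (j : ℤ) => ξ j ω) P P₀)
    (hY : IsGaussianCopy Y Q (fun i j : ℕ+ => X i (j : ℤ)) P) (i j k : ℕ+) :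
    ∫ ω, Y i j ω * Y i k ω ∂Q = ∫ ω, ξ j ω * ξ k ω ∂P₀ := by
  have hX : ∀ l : ℤ, IdentDistrib (X i l) (ξ l) P P₀ := fun l =>
    (hX_copy i).comp (u := fun x : ℤ → ℝ => x l) (by fun_prop)
  have hXm : ∀ l : ℤ, MemLp (X i l) 2 P := fun l => (hX l).memLp_iff.2 (hξ.memLp l)
  have hX0 : ∀ l : ℤ, ∫ ω, X i l ω ∂P = 0 := fun l => (hX l).integral_eq.trans (hξ.centered l)
  have hYm : ∀ l, MemLp (Y i l) 2 Q := fun l =>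
    (hY.gaussian.hasGaussianLaw_eval (i, l)).memLp (by simp)
  have h := hY.covariance_eq i j i k
  rw [covariance_eq_sub (hYm j) (hYm k), covariance_eq_sub (hXm _) (hXm _), hY.centered, hX0,
    zero_mul, zero_mul, sub_zero, sub_zero] at h
  have h2 := ((hX_copy i).comp (u := fun x : ℤ → ℝ => x j * x k) (by fun_prop)).integral_eq
  exact h.trans h2

/-- Distinct rows of `X` are independent, hence uncorrelated; so are those of `Y`, and a jointly
Gaussian family with uncorrelated blocks has independent blocks. -/
theorem IsGaussianCopy.map_rows_eq_pi [IsProbabilityMeasure Q] (hξ : IsRegularSeq ξ P₀)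
    (hX_copy : ∀ i, IdentDistrib (fun ω (j : ℤ) => X i j ω) (fun ω (j : ℤ) => ξ j ω) P P₀)
    (hX_indep : iIndepFun (fun (i : ℕ+) (ω : Ω) (j : ℤ) => X i j ω) P)
    (hY : IsGaussianCopy Y Q (fun i j : ℕ+ => X i (j : ℤ)) P) (n : ℕ) :
    Q.map (fun ω (i j : Fin n) => Y (Nat.succPNat i) (Nat.succPNat j) ω)
      = Measure.pi fun i : Fin n => Q.map fun ω (j : Fin n) =>
        Y (Nat.succPNat i) (Nat.succPNat j) ω := by
  have hm : ∀ i j, AEMeasurable (Y i j) Q := fun i j => hY.gaussian.aemeasurable (i, j)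
  have hXm : ∀ i (l : ℤ), MemLp (X i l) 2 P := fun i l =>
    ((hX_copy i).comp (u := fun x : ℤ → ℝ => x l) (by fun_prop)).memLp_iff.2 (hξ.memLp l)
  refine iIndepFun.map_fun_eq_pi_map
    (f := fun (i : Fin n) ω (j : Fin n) => Y (Nat.succPNat i) (Nat.succPNat j) ω)
    (fun i => aemeasurable_pi_lambda _ fun j => hm _ _) ?_
  refine IsGaussianProcess.iIndepFun_of_covariance_eq_zero
    (X := fun (i j : Fin n) => Y (Nat.succPNat i) (Nat.succPNat j))
    (hY.gaussian.comp_right fun p : (_ : Fin n) × Fin n => (Nat.succPNat p.1, Nat.succPNat p.2))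
    (fun i j => hm _ _) fun i k hik j l => ?_
  rw [hY.covariance_eq]
  have hind := hX_indep.indepFun (fun h => hik (succPNat_injective h) :
    Nat.succPNat (i : ℕ) ≠ Nat.succPNat (k : ℕ))
  exact (hind.comp (φ := fun x : ℤ → ℝ => x (Nat.succPNat j : ℕ+))
    (ψ := fun x : ℤ → ℝ => x (Nat.succPNat l : ℕ+)) (by fun_prop) (by fun_prop)).covariance_eq_zero
    (hXm _ _) (hXm _ _)

theorem tendsto_integral_rowTrace_sub [IsProbabilityMeasure P₀] [IsProbabilityMeasure P]
    [IsProbabilityMeasure Q] (hξ : IsRegularSeq ξ P₀)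
    (hX_copy : ∀ i, IdentDistrib (fun ω (j : ℤ) => X i j ω) (fun ω (j : ℤ) => ξ j ω) P P₀)
    (hY : IsGaussianCopy Y Q (fun i j : ℕ+ => X i (j : ℤ)) P) {z : ℂ} (hz : 0 < z.im) :
    Tendsto (fun n : ℕ => (∫ x, rowTrace z x ∂(Measure.pi fun _ : Fin n =>
        P₀.map fun ω (j : Fin n) => ξ (j : ℕ) ω)
      - ∫ x, rowTrace z x ∂(Measure.pi fun i : Fin n => Q.map fun ω (j : Fin n) =>
        Y (Nat.succPNat i) (Nat.succPNat j) ω)) / n) atTop (𝓝 0) := by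
  set σ := ∫ ω, ξ 0 ω ^ 2 ∂P₀ with hσ
  have hσ0 : 0 ≤ σ := integral_nonneg fun ω => sq_nonneg _
  set q := z.im⁻¹ with hq
  have hq0 : 0 < q := inv_pos.2 hz
  set K := 2 * (q * (2 * q ^ 2 + 2 + q ^ 4 * σ) + q ^ 2 * (3 + 2 * q + q ^ 2 * σ)) with hK
  have hK0 : 0 < K := by positivity
  rw [Metric.tendsto_nhds]
  intro δ hδ
  obtain ⟨ε, hε, hεK⟩ : ∃ ε : ℝ, 0 < ε ∧ ε * K < δ := by
    refine ⟨δ / (2 * K), by positivity, ?_⟩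
    have e : δ / (2 * K) * K = δ / 2 := by field_simp
    rw [e]; exact half_lt_self hδ
  -- ρ bounds the covariance row sums: ρ ≤ ε² is for linear forms, 2σρ ≤ ε² for the Gaussian
  -- quadratic forms.
  obtain ⟨ρ, hρ0, hρ, hρσ⟩ : ∃ ρ : ℝ, 0 < ρ ∧ ρ ≤ ε ^ 2 ∧ 2 * (σ * ρ) ≤ ε ^ 2 := by
    refine ⟨ε ^ 2 / (1 + 2 * σ), by positivity, div_le_self (sq_nonneg _) (by linarith), ?_⟩
    have e : 2 * (σ * (ε ^ 2 / (1 + 2 * σ))) = ε ^ 2 * (2 * σ / (1 + 2 * σ)) := by ring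
    rw [e]
    exact mul_le_of_le_one_right (sq_nonneg _) ((div_le_one (by positivity)).2 (by linarith))
  filter_upwards [hξ.eventually_rowLaw hε, hξ.eventually_sum_abs_covariance_le hρ0,
    eventually_gt_atTop 0] with n hn hrow hn0
  have hn' : (0 : ℝ) < n := by exact_mod_cast hn0
  have hYm : ∀ i j, AEMeasurable (Y i j) Q := fun i j => hY.gaussian.aemeasurable (i, j)
  have hprob : ∀ i : Fin n, IsProbabilityMeasure (Q.map fun ω (j : Fin n) =>
      Y (Nat.succPNat i) (Nat.succPNat j) ω) := fun i =>
    Measure.isProbabilityMeasure_map (aemeasurable_pi_lambda _ fun j => hYm _ _)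
  have hprob₀ : IsProbabilityMeasure (P₀.map fun ω (j : Fin n) => ξ (j : ℕ) ω) :=
    Measure.isProbabilityMeasure_map
      (measurable_pi_iff.2 fun j => hξ.measurable _).aemeasurable
  have hlaw : ∀ i : Fin n, RowLaw (Q.map fun ω (j : Fin n) =>
      Y (Nat.succPNat i) (Nat.succPNat j) ω)
      (fun j k => ∫ ω, ξ (j : ℕ) ω * ξ (k : ℕ) ω ∂P₀) ε σ := fun i => by
    refine rowLaw_of_isGaussianProcess
      (hY.gaussian.comp_right fun j : Fin n => (Nat.succPNat i, Nat.succPNat j))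
      (fun j => hY.centered _ _) (fun j k => ?_) hε (fun j k => hξ.abs_integral_mul_le _ _) hrow hρ
      hρσ
    refine (hY.integral_mul_eq hξ hX_copy _ _ _).trans ?_
    have h := hξ.integral_mul_eq_dist (j + 1) (k + 1)
    rw [Nat.dist_add_add_right, ← hξ.integral_mul_eq_dist] at h
    simpa using h
  have h := norm_integral_rowTrace_pi_sub_le hz hε (fun _ : Fin n => hn) hlaw
  rw [dist_zero_right, norm_div, Complex.norm_natCast, div_lt_iff₀ hn']
  refine h.trans_lt ?_
  calc _ = ε * K * n := by rw [hK]; ring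
    _ < δ * n := by gcongr

theorem ae_tendsto_rowTrace_sub [IsProbabilityMeasure P₀] [IsProbabilityMeasure P]
    (hξ : IsRegularSeq ξ P₀) (hX_meas : ∀ i j, Measurable (X i j))
    (hX_copy : ∀ i, IdentDistrib (fun ω (j : ℤ) => X i j ω) (fun ω (j : ℤ) => ξ j ω) P P₀)
    (hX_indep : iIndepFun (fun (i : ℕ+) (ω : Ω) (j : ℤ) => X i j ω) P) {z : ℂ} (hz : 0 < z.im) :
    ∀ᵐ ω ∂P, Tendsto (fun n : ℕ =>
      (rowTrace z (fun i j : Fin n => X (Nat.succPNat i) (Nat.succPNat j : ℕ+) ω)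
        - ∫ x, rowTrace z x ∂(Measure.pi fun _ : Fin n =>
          P₀.map fun ω (j : Fin n) => ξ (j : ℕ) ω)) / n) atTop (𝓝 0) := by
  have hprob₀ : ∀ n : ℕ, IsProbabilityMeasure (P₀.map fun ω (j : Fin n) => ξ (j : ℕ) ω) := fun n =>
    Measure.isProbabilityMeasure_map
      (measurable_pi_iff.2 fun j => hξ.measurable _).aemeasurable
  have hrows : ∀ n : ℕ, AEMeasurable
      (fun ω (i j : Fin n) => X (Nat.succPNat i) (Nat.succPNat j : ℕ+) ω) P := fun n =>
    (measurable_pi_iff.2 fun i => measurable_pi_iff.2 fun j => hX_meas _ _).aemeasurable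
  set c : NNReal := Real.toNNReal ((2 * z.im⁻¹) ^ 2) with hc
  have hc0 : 0 < c := Real.toNNReal_pos.2 (by positivity)
  -- Concentration is for real functions, so it is proved for an abstract `L` and used with the real
  -- and imaginary parts. No relation between different n is needed.
  have key : ∀ L : ℂ → ℝ, Measurable L → (∀ w, |L w| ≤ ‖w‖) → (∀ w w', L (w - w') = L w - L w') →
      (∀ n : ℕ, L (∫ x, rowTrace z x ∂(Measure.pi fun _ : Fin n =>
          P₀.map fun ω (j : Fin n) => ξ (j : ℕ) ω))
        = ∫ x, L (rowTrace z x) ∂(Measure.pi fun _ : Fin n =>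
          P₀.map fun ω (j : Fin n) => ξ (j : ℕ) ω)) →
      ∀ᵐ ω ∂P, Tendsto (fun n : ℕ =>
        L (rowTrace z (fun i j : Fin n => X (Nat.succPNat i) (Nat.succPNat j : ℕ+) ω)
          - ∫ x, rowTrace z x ∂(Measure.pi fun _ : Fin n =>
            P₀.map fun ω (j : Fin n) => ξ (j : ℕ) ω)) / n) atTop (𝓝 0) := by
    intro L hL hLn hLs hLi
    refine ae_tendsto_div_of_hasSubgaussianMGF hc0 fun n => ?_
    have h := hasSubgaussianMGF_of_bounded_differences (d := 2 * z.im⁻¹)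
      (fun _ : Fin n => P₀.map fun ω (j : Fin n) => ξ (j : ℕ) ω)
      (f := fun x => L (rowTrace z x)) (hL.comp (continuous_rowTrace hz).measurable)
      (fun x => (hLn _).trans (norm_rowTrace_le hz x)) fun x k r => by
        rw [← hLs]
        exact (hLn _).trans (norm_rowTrace_update_sub_le hz x k r)
    rw [← map_rows_eq_pi hξ hX_meas hX_copy hX_indep n] at h
    have h2 := h.of_map (hrows n)
    rw [map_rows_eq_pi hξ hX_meas hX_copy hX_indep n, ← hLi] at h2
    simp only [hLs]
    exact h2
  have hint : ∀ n : ℕ, Integrable (rowTrace z) (Measure.pi fun _ : Fin n =>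
      P₀.map fun ω (j : Fin n) => ξ (j : ℕ) ω) := fun n =>
    integrable_of_bounded (continuous_rowTrace hz).measurable (norm_rowTrace_le hz)
  filter_upwards [key Complex.re Complex.measurable_re Complex.abs_re_le_norm Complex.sub_re
    fun n => (integral_re (hint n)).symm, key Complex.im Complex.measurable_im
    Complex.abs_im_le_norm Complex.sub_im fun n => (integral_im (hint n)).symm] with ω h1 h2
  have h3 := ((Complex.continuous_ofReal.tendsto 0).comp h1).add
    (((Complex.continuous_ofReal.tendsto 0).comp h2).mul_const Complex.I)
  rw [Complex.ofReal_zero, zero_mul, add_zero] at h3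
  refine h3.congr fun n => ?_
  simp only [Function.comp_apply, Complex.ofReal_div, Complex.ofReal_natCast]
  rw [div_mul_eq_mul_div, ← add_div, Complex.re_add_im]

/-- The Stieltjes transform of the spectral distribution is asymptotically that of the Gaussian
model. -/
theorem ae_tendsto_stieltjes_sub [IsProbabilityMeasure P₀] [IsProbabilityMeasure P]
    [IsProbabilityMeasure Q] (hξ : IsRegularSeq ξ P₀) (hX_meas : ∀ i j, Measurable (X i j))
    (hX_copy : ∀ i, IdentDistrib (fun ω (j : ℤ) => X i j ω) (fun ω (j : ℤ) => ξ j ω) P P₀)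
    (hX_indep : iIndepFun (fun (i : ℕ+) (ω : Ω) (j : ℤ) => X i j ω) P)
    (hY : IsGaussianCopy Y Q (fun i j : ℕ+ => X i (j : ℤ)) P) {z : ℂ} (hz : 0 < z.im) :
    ∀ᵐ ω ∂P, Tendsto (fun n : ℕ =>
      stieltjes (scaledMatrix (fun i j => X i (j : ℤ) ω) n) z
        - ∫ ω', stieltjes (scaledMatrix (fun i j => Y i j ω') n) z ∂Q) atTop (𝓝 0) := by
  have hYm : ∀ n : ℕ, AEMeasurable
      (fun ω (i j : Fin n) => Y (Nat.succPNat i) (Nat.succPNat j) ω) Q := fun n =>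
    aemeasurable_pi_lambda _ fun i => aemeasurable_pi_lambda _ fun j =>
      hY.gaussian.aemeasurable (Nat.succPNat i, Nat.succPNat j)
  filter_upwards [ae_tendsto_rowTrace_sub hξ hX_meas hX_copy hX_indep hz] with ω hω
  have h := hω.add (tendsto_integral_rowTrace_sub hξ hX_copy hY hz)
  rw [add_zero] at h
  refine h.congr fun n => ?_
  simp only [stieltjes_scaledMatrix]
  rw [integral_div, ← hY.map_rows_eq_pi hξ hX_copy hX_indep n,
    integral_map (hYm n) (continuous_rowTrace hz).aestronglyMeasurable]
  ring

end Rows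
end RowIndep

/-- Universality for symmetric matrices whose rows below the diagonal are independent copies of a
stationary sequence satisfying the two regularity conditions. -/
theorem mainTheorem4
    {Ω₀ : Type*} [MeasurableSpace Ω₀] (P₀ : Measure Ω₀) [IsProbabilityMeasure P₀]
    (ξ : ℤ → Ω₀ → ℝ) (hξ_meas : ∀ k, Measurable (ξ k))
    (hξ_stat : RowIndep.IsStationarySeq ξ P₀)
    (hξ_L2 : ∀ k, MemLp (ξ k) 2 P₀)
    (hξ_centered : ∀ k, ∫ ω, ξ k ω ∂P₀ = 0)
    (hreg1 : RowIndep.Regular1 ξ P₀)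
    (hreg2 : RowIndep.Regular2 ξ P₀)
    {Ω : Type*} [MeasurableSpace Ω] (P : Measure Ω) [IsProbabilityMeasure P]
    (X : ℕ+ → ℤ → Ω → ℝ) (hX_meas : ∀ i j, Measurable (X i j))
    (hX_copy : ∀ i, IdentDistrib (fun ω (j : ℤ) => X i j ω) (fun ω (j : ℤ) => ξ j ω) P P₀)
    (hX_indep : iIndepFun (fun (i : ℕ+) (ω : Ω) (j : ℤ) => X i j ω) P) :
    RowIndep.LindebergCondition (fun i j : ℕ+ => X i (j : ℤ)) P ∧
    Tendsto (RowIndep.eta (fun i j : ℕ+ => X i (j : ℤ)) P) atTop (𝓝 0) ∧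
    Tendsto (RowIndep.gam (fun i j : ℕ+ => X i (j : ℤ)) P) atTop (𝓝 0) ∧
    ∀ {Ω' : Type*} [MeasurableSpace Ω'] (Q : Measure Ω') [IsProbabilityMeasure Q]
      (Y : ℕ+ → ℕ+ → Ω' → ℝ),
      RowIndep.IsGaussianCopy Y Q (fun i j : ℕ+ => X i (j : ℤ)) P →
      ∀ z : ℂ, 0 < z.im →
        ∀ᵐ ω ∂P, Tendsto (fun n : ℕ =>
          RowIndep.stieltjes (RowIndep.scaledMatrix (fun i j => X i (j : ℤ) ω) n) z
            - ∫ ω', RowIndep.stieltjes (RowIndep.scaledMatrix (fun i j => Y i j ω') n) z ∂Q)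
          atTop (𝓝 0) := by
  have hξ : RowIndep.IsRegularSeq ξ P₀ := ⟨hξ_meas, hξ_stat, hξ_L2, hξ_centered, hreg1, hreg2⟩
  refine ⟨RowIndep.lindebergCondition hξ hX_meas hX_copy, RowIndep.tendsto_eta hξ hX_meas hX_copy,
    RowIndep.tendsto_gam hξ hX_meas hX_copy, ?_⟩
  intro Ω' _ Q _ Y hY z hz
  exact RowIndep.ae_tendsto_stieltjes_sub hξ hX_meas hX_copy hX_indep hY hz
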